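/- Fix $a>-1/2$, $\mathfrak a,\mathfrak b\in(0,1)$ and $T>0$. Put $D(\rho)=1+2a\rho$, $\chi(\rho)=\rho(1-\rho)$, $\sigma=\chi D$. Let $\mathcal M$ be the set of non-negative measures on $]-1,1[$ with total mass at most $2$, with the weak topology, and $D([0,T],\mathcal M)$ the set of right-continuous trajectories with left limits. Write $\langle f\rangle=\int_{-1}^1 f\,dx$, $\langle f,g\rangle=\int_{-1}^1 fg\,dx$, $\langle\!\langle f,g\rangle\!\rangle=\int_0^T\langle f_t,g_t\rangle dt$, and let $\mathbb L^2(\sigma(u)^{-1})$ be the set of measurable $F$ on $[0,T]\times[-1,1]$ with $\int_0^T\langle F_t^2\,\sigma(u_t)^{-1}\rangle dt<\infty$, where $1/0=\infty$ and $0\cdot\infty=0$. The rate functional. A trajectory $\pi$ has finite energy if $\pi_t(dx)=u(t,x)\,dx$ for all $t\in[0,T]$, with $u$ measurable, $0\le u\le1$, and $$\sup_G\Big\{2\int_0^T\langle u_t,\nabla G_t\rangle dt-\int_0^T\langle\chi(u_t),G_t^2\rangle dt\Big\}<\infty,$$ the supremum being over $G\in C^{1,2}([0,T]\times[-1,1])$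 that vanish at $x=\pm1$. Then $u\in L^2([0,T],\mathcal H^1)$, and $u_t$ denotes, for almost every $t$, its continuous version on $[-1,1]$; $\nabla u$ is the weak gradient. For $H\in C^{1,1}([0,T]\times[-1,1])$ let $$\hat J_H(\pi)=\langle u_T,H_T\rangle-\langle u_0,H_0\rangle-\int_0^T\langle u_t,\partial_tH_t\rangle dt+\int_0^T\langle D(u_t)\nabla u_t,\nabla H_t\rangle dt-\int_0^T\langle\sigma(u_t),(\nabla H_t)^2\rangle dt-\int_0^TB(u_t,H_t)\,dt,$$ $$B(u_t,H_t)=u_t(1)(1-\mathfrak b)(e^{-H_t(1)}-1)+\mathfrak b(1-u_t(1))(e^{H_t(1)}-1)+u_t(-1)(1-\mathfrak a)(e^{-H_t(-1)}-1)+\mathfrak a(1-u_t(-1))(e^{H_t(-1)}-1).$$ Set $I_{[0,T]}(\pi)=\sup_{H\in C^{1,1}}\hat J_H(\pi)$ if $\pi$ has finite energy and $I_{[0,T]}(\pi)=+\infty$ otherwise. Let $\pi\in D([0,T],\mathcal M)$ with $I_{[0,T]}(\pi)<\infty$, $\pi_t(dx)=u(t,x)\,dx$. Then there exist $P\in\mathbb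 L^2(\sigma(u)^{-1})$ with $$-\int_0^T\langle u_t,\partial_tH_t\rangle dt=\langle\!\langle\nabla H,P\rangle\!\rangle\qquad\text{for all }H\in C_K^\infty(]0,T[\times]-1,1[),$$ and, for $f=\mathbb 1$ ($\mathbb 1(x)=1$) and $f=X$ ($X(x)=x$), functions $P^f\in L^1([0,T])$ with $-\int_0^TH'(t)\langle u_t,f\rangle dt=\int_0^TH(t)P^f(t)\,dt$ for all $H\in C^1_0([0,T])$, the $C^1$ functions on $[0,T]$ vanishing at $0$ and $T$. For every choice of such $P,P^{\mathbb 1},P^X$, put $M_t=P_t+D(u_t)\nabla u_t$, $\mathcal S_t=1/\langle\sigma(u_t)^{-1}\rangle$ (equal to $0$ if $\langle\sigma(u_t)^{-1}\rangle=\infty$; products with the factor $\mathcal S_t=0$ are $0$), $$g(t)=2\big\{P^{\mathbb 1}(t)-P^X(t)-\langle D(u_t)\nabla u_t\rangle+2(u_t(-1)-\mathfrak a)+\langle M_t\rangle-2\langle M_t\sigma(u_t)^{-1}\rangle\mathcal S_t\big\},$$ $$h(t)=2\big\{P^{\mathbb 1}(t)+P^X(t)+\langle D(u_t)\nabla u_t\rangle+2(u_t(1)-\mathfrak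 b)-\langle M_t\rangle+2\langle M_t\sigma(u_t)^{-1}\rangle\mathcal S_t\big\},$$ $$\Psi(r,s,\alpha,\beta)=4\mathfrak a(1-r)(e^\alpha-\alpha-1)+4r(1-\mathfrak a)(e^{-\alpha}+\alpha-1)+4\mathfrak b(1-s)(e^\beta-\beta-1)+4s(1-\mathfrak b)(e^{-\beta}+\beta-1),$$ $$\Upsilon_t(r,s,\alpha,\beta)=4(\alpha-\beta)^2\mathcal S_t+\Psi(r,s,\alpha,\beta).$$ Then $M\in\mathbb L^2(\sigma(u)^{-1})$, $g,h\in L^1([0,T])$, the integrand of $I^{(1)}_{[0,T]}$ below is in $L^1([0,T])$, and $I_{[0,T]}(\pi)=I^{(1)}_{[0,T]}(\pi)+I^{(2)}_{[0,T]}(\pi)$, where $$I^{(1)}_{[0,T]}(\pi)=\frac14\int_0^T\Big\{\langle M_t^2\,\sigma(u_t)^{-1}\rangle-\langle M_t\sigma(u_t)^{-1}\rangle^2\,\mathcal S_t\Big\}dt,$$ $$I^{(2)}_{[0,T]}(\pi)=\frac14\sup_{\alpha,\beta\in C^1_0([0,T])}\int_0^T\Big\{\alpha(t)g(t)+\beta(t)h(t)-\Upsilon_t\big(u_t(-1),u_t(1),\alpha(t),\beta(t)\big)\Big\}dt.$$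 -/

import Mathlib

open MeasureTheory Set Filter Topology
open scoped ContDiff

noncomputable section

namespace RobinLD

/-! ### Trajectories of measures -/

/-- The open interval `]-1,1[`. -/
abbrev Omega : Type := Set.Ioo (-1 : ℝ) 1

/-- Non-negative measures on `]-1,1[` with total mass at most `2`, with the weak topology
(the subspace topology inherited from `FiniteMeasure`). -/
abbrev MassTwo : Type := {μ : FiniteMeasure Omega // μ.mass ≤ 2}

/-- The space `D([0,T], M)`: right-continuous trajectories with left limits. -/
structure Trajectory (T : ℝ) where
  toFun : Set.Icc (0 : ℝ) T → MassTwo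
  right_continuous : ∀ t, ContinuousWithinAt toFun (Set.Ici t) t
  left_limit : ∀ t, ∃ l : MassTwo, Tendsto toFun (𝓝[<] t) (𝓝 l)

/-! ### Coefficients -/

/-- The diffusivity `D(ρ) = 1 + 2 a ρ`. -/
def diffusivity (a ρ : ℝ) : ℝ := 1 + 2 * a * ρ

/-- The static compressibility `χ(ρ) = ρ (1 - ρ)`. -/
def chi (ρ : ℝ) : ℝ := ρ * (1 - ρ)

/-- The mobility `σ(ρ) = χ(ρ) D(ρ)`. -/
def sigma (a ρ : ℝ) : ℝ := chi ρ * diffusivity a ρ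

/-! ### Test functions -/

/-- The closed rectangle `[0,T] × [-1,1]`. -/
def rect (T : ℝ) : Set (ℝ × ℝ) := Set.Icc 0 T ×ˢ Set.Icc (-1) 1

/-- `C^{1,1}([0,T] × [-1,1])`: functions with one continuous derivative in time and one in
space (one-sided at the boundary), bundled with these derivatives. -/
structure C11 (T : ℝ) where
  val : ℝ → ℝ → ℝ
  dt : ℝ → ℝ → ℝ
  dx : ℝ → ℝ → ℝ
  hasDeriv_dt : ∀ t ∈ Set.Icc 0 T, ∀ x ∈ Set.Icc (-1 : ℝ) 1,
    HasDerivWithinAt (fun s => val s x) (dt t x) (Set.Icc 0 T) t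
  hasDeriv_dx : ∀ t ∈ Set.Icc 0 T, ∀ x ∈ Set.Icc (-1 : ℝ) 1,
    HasDerivWithinAt (val t) (dx t x) (Set.Icc (-1) 1) x
  continuous_val : ContinuousOn (Function.uncurry val) (rect T)
  continuous_dt : ContinuousOn (Function.uncurry dt) (rect T)
  continuous_dx : ContinuousOn (Function.uncurry dx) (rect T)

/-- `C^{1,2}([0,T] × [-1,1])` functions that vanish at `x = -1` and `x = 1`. -/
structure C12Zero (T : ℝ) extends C11 T where
  dxx : ℝ → ℝ → ℝ
  hasDeriv_dxx : ∀ t ∈ Set.Icc 0 T, ∀ x ∈ Set.Icc (-1 : ℝ) 1,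
    HasDerivWithinAt (dx t) (dxx t x) (Set.Icc (-1) 1) x
  continuous_dxx : ContinuousOn (Function.uncurry dxx) (rect T)
  vanish_left : ∀ t ∈ Set.Icc 0 T, val t (-1) = 0
  vanish_right : ∀ t ∈ Set.Icc 0 T, val t 1 = 0

/-- `C^1_0([0,T])`: continuously differentiable functions on `[0,T]` that vanish at `0` and
at `T`. -/
def C10 (T : ℝ) : Set (ℝ → ℝ) :=
  {α | ContDiffOn ℝ 1 α (Set.Icc 0 T) ∧ α 0 = 0 ∧ α T = 0}

/-- `C^∞_K(]-1,1[)`. -/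
def SmoothK : Set (ℝ → ℝ) :=
  {φ | ContDiff ℝ ∞ φ ∧ HasCompactSupport φ ∧ tsupport φ ⊆ Set.Ioo (-1) 1}

/-- `C^∞_K(]0,T[ × ]-1,1[)`. -/
def SmoothKT (T : ℝ) : Set (ℝ × ℝ → ℝ) :=
  {H | ContDiff ℝ ∞ H ∧ HasCompactSupport H ∧ tsupport H ⊆ Set.Ioo 0 T ×ˢ Set.Ioo (-1) 1}

/-! ### Density profiles of a trajectory, energy -/

/-- `df` is the weak derivative of `f` on `]-1,1[`. -/
def IsWeakDeriv (f df : ℝ → ℝ) : Prop :=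
  ∀ φ ∈ SmoothK, ∫ x in (-1 : ℝ)..1, f x * deriv φ x = -∫ x in (-1 : ℝ)..1, df x * φ x

/-- `π(t,dx) = u(t,x) dx` for all `t ∈ [0,T]`, with `u` measurable, `0 ≤ u ≤ 1`, `u` in
`L²([0,T], H¹)` with weak gradient `du`, and, for almost every `t`, `u(t,·)` the continuous
version of its class, so that the boundary values `u(t,-1)`, `u(t,1)` make sense. -/
structure IsProfile (T : ℝ) (π : Trajectory T) (u du : ℝ → ℝ → ℝ) : Prop where
  measurable_u : Measurable (Function.uncurry u)
  measurable_du : Measurable (Function.uncurry du)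
  range_u : ∀ t ∈ Set.Icc 0 T, ∀ x ∈ Set.Icc (-1 : ℝ) 1, u t x ∈ Set.Icc (0 : ℝ) 1
  density : ∀ t : Set.Icc (0 : ℝ) T,
    (((π.toFun t : FiniteMeasure Omega)) : Measure Omega)
      = ((volume : Measure ℝ).comap (Subtype.val : Omega → ℝ)).withDensity
          (fun x : Omega => ENNReal.ofReal (u t x))
  continuous_u : ∀ᵐ t ∂(volume.restrict (Set.Icc 0 T)), ContinuousOn (u t) (Set.Icc (-1) 1)
  weak_deriv : ∀ᵐ t ∂(volume.restrict (Set.Icc 0 T)), IsWeakDeriv (u t) (du t)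
  sq_integrable :
    ∫⁻ t in Set.Icc 0 T, ∫⁻ x in Set.Icc (-1) 1, ENNReal.ofReal ((du t x) ^ 2) < ⊤

/-- The energy `Q`. The test functions vanish at `x = -1` and `x = 1`: the supremum is
`∫∫ |∇u|² / χ(u)` for `u` in `L²([0,T], H¹)`. -/
def energy (T : ℝ) (u : ℝ → ℝ → ℝ) : EReal :=
  ⨆ G : C12Zero T,
    (((2 * ∫ t in (0 : ℝ)..T, ∫ x in (-1 : ℝ)..1, u t x * G.dx t x)
      - ∫ t in (0 : ℝ)..T, ∫ x in (-1 : ℝ)..1, chi (u t x) * (G.val t x) ^ 2 : ℝ) : EReal)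

/-! ### The rate functional -/

/-- `⟨π_T, H_T⟩ - ⟨π_0, H_0⟩ - ∫_0^T ⟨π_t, ∂_t H_t⟩ dt` for `π(t,dx) = u(t,x) dx`. -/
def L0 (T : ℝ) (u : ℝ → ℝ → ℝ) (H : C11 T) : ℝ :=
  (∫ x in (-1 : ℝ)..1, u T x * H.val T x) - (∫ x in (-1 : ℝ)..1, u 0 x * H.val 0 x)
    - ∫ t in (0 : ℝ)..T, ∫ x in (-1 : ℝ)..1, u t x * H.dt t x

/-- The boundary term `B(u, H)`, as a function of `r = u(-1)`, `s = u(1)`, `p = H(-1)`,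
`q = H(1)`. -/
def boundaryB (ρl ρr r s p q : ℝ) : ℝ :=
  s * (1 - ρr) * (Real.exp (-q) - 1) + ρr * (1 - s) * (Real.exp q - 1)
    + r * (1 - ρl) * (Real.exp (-p) - 1) + ρl * (1 - r) * (Real.exp p - 1)

/-- The functional `Ĵ_H`, evaluated at a profile `u` with gradient `du`. -/
def Jhat (T a ρl ρr : ℝ) (u du : ℝ → ℝ → ℝ) (H : C11 T) : ℝ :=
  L0 T u H
    + (∫ t in (0 : ℝ)..T, ∫ x in (-1 : ℝ)..1, diffusivity a (u t x) * du t x * H.dx t x)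
    - (∫ t in (0 : ℝ)..T, ∫ x in (-1 : ℝ)..1, sigma a (u t x) * (H.dx t x) ^ 2)
    - ∫ t in (0 : ℝ)..T, boundaryB ρl ρr (u t (-1)) (u t 1) (H.val t (-1)) (H.val t 1)

/-- Trajectories of absolutely continuous measures with density bounded by `1` and with finite
energy: there is a profile `(u, ∇u)` of finite energy. -/
def FiniteEnergy (T : ℝ) (π : Trajectory T) : Prop :=
  ∃ p : (ℝ → ℝ → ℝ) × (ℝ → ℝ → ℝ), IsProfile T π p.1 p.2 ∧ energy T p.1 < ⊤

open scoped Classical in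
/-- `J_H(π) = Ĵ_H(π)` if `π` has finite energy, `+∞` otherwise. The value does not depend on
the profile, since two profiles of `π` agree almost everywhere. -/
def J (T a ρl ρr : ℝ) (π : Trajectory T) (H : C11 T) : EReal :=
  if h : FiniteEnergy T π then
    ((Jhat T a ρl ρr h.choose.1 h.choose.2 H : ℝ) : EReal)
  else ⊤

/-- The rate functional `I_{[0,T]}(π) = sup_H J_H(π)`. -/
def rate (T a ρl ρr : ℝ) (π : Trajectory T) : EReal := ⨆ H : C11 T, J T a ρl ρr π H

/-! ### Ingredients of the decomposition -/

/-- `F ∈ L²(σ(u)⁻¹)` on `[0,T] × [-1,1]`. Here `σ⁻¹ = ∞` where `σ = 0` and `0 · ∞ = 0`, so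
that `F` vanishes almost everywhere on `{σ(u) = 0}`. -/
def MemL2SigmaInv (T a : ℝ) (u F : ℝ → ℝ → ℝ) : Prop :=
  Measurable (Function.uncurry F) ∧
    ∫⁻ t in Set.Icc 0 T, ∫⁻ x in Set.Icc (-1) 1,
      ENNReal.ofReal ((F t x) ^ 2) / ENNReal.ofReal (sigma a (u t x)) < ⊤

/-- `P ∈ L²(σ(u)⁻¹)` and `-∫_0^T ⟨π_t, ∂_t H_t⟩ dt = ⟨⟨∇H, P⟩⟩` for all
`H ∈ C^∞_K(]0,T[ × ]-1,1[)`. -/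
def IsFlux (T a : ℝ) (u P : ℝ → ℝ → ℝ) : Prop :=
  MemL2SigmaInv T a u P ∧
    ∀ H ∈ SmoothKT T,
      (-∫ t in (0 : ℝ)..T, ∫ x in (-1 : ℝ)..1, u t x * deriv (fun s => H (s, x)) t)
        = ∫ t in (0 : ℝ)..T, ∫ x in (-1 : ℝ)..1, deriv (fun y => H (t, y)) x * P t x

/-- `Pf ∈ L¹([0,T])` and `-∫_0^T H'(t) ⟨π_t, f⟩ dt = ∫_0^T H(t) Pf(t) dt` for all
`H ∈ C^1_0([0,T])`. -/
def IsTimeDerivative (T : ℝ) (u : ℝ → ℝ → ℝ) (f Pf : ℝ → ℝ) : Prop :=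
  IntervalIntegrable Pf volume 0 T ∧
    ∀ H ∈ C10 T,
      (-∫ t in (0 : ℝ)..T, derivWithin H (Set.Icc 0 T) t * ∫ x in (-1 : ℝ)..1, u t x * f x)
        = ∫ t in (0 : ℝ)..T, H t * Pf t

/-- `M = P + D(u) ∇u`. -/
def fluxM (a : ℝ) (u du P : ℝ → ℝ → ℝ) (t x : ℝ) : ℝ :=
  P t x + diffusivity a (u t x) * du t x

/-- `S_t = 1 / ⟨σ(u_t)⁻¹⟩`, which is `0` when `⟨σ(u_t)⁻¹⟩ = ∞`. -/
def calS (a : ℝ) (u : ℝ → ℝ → ℝ) (t : ℝ) : ℝ :=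
  ((∫⁻ x in Set.Icc (-1 : ℝ) 1, (ENNReal.ofReal (sigma a (u t x)))⁻¹)⁻¹).toReal

/-- `⟨M_t σ(u_t)⁻¹⟩`. -/
def meanMSigmaInv (a : ℝ) (u du P : ℝ → ℝ → ℝ) (t : ℝ) : ℝ :=
  ∫ x in (-1 : ℝ)..1, fluxM a u du P t x / sigma a (u t x)

/-- The function `g` dual to the left boundary value `α`. -/
def gFun (a ρl : ℝ) (u du P : ℝ → ℝ → ℝ) (P1 PX : ℝ → ℝ) (t : ℝ) : ℝ :=
  2 * (P1 t - PX t - (∫ x in (-1 : ℝ)..1, diffusivity a (u t x) * du t x)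
    + 2 * (u t (-1) - ρl) + (∫ x in (-1 : ℝ)..1, fluxM a u du P t x)
    - 2 * meanMSigmaInv a u du P t * calS a u t)

/-- The function `h` dual to the right boundary value `β`. -/
def hFun (a ρr : ℝ) (u du P : ℝ → ℝ → ℝ) (P1 PX : ℝ → ℝ) (t : ℝ) : ℝ :=
  2 * (P1 t + PX t + (∫ x in (-1 : ℝ)..1, diffusivity a (u t x) * du t x)
    + 2 * (u t 1 - ρr) - (∫ x in (-1 : ℝ)..1, fluxM a u du P t x)
    + 2 * meanMSigmaInv a u du P t * calS a u t)

/-- The function `Ψ(r,s,α,β)`. -/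
def Psi (ρl ρr r s α β : ℝ) : ℝ :=
  4 * ρl * (1 - r) * (Real.exp α - α - 1) + 4 * r * (1 - ρl) * (Real.exp (-α) + α - 1)
    + 4 * ρr * (1 - s) * (Real.exp β - β - 1) + 4 * s * (1 - ρr) * (Real.exp (-β) + β - 1)

/-- `Υ_t(r,s,α,β) = 4 (α - β)² S_t + Ψ(r,s,α,β)`. -/
def Upsilon (a ρl ρr : ℝ) (u : ℝ → ℝ → ℝ) (t r s α β : ℝ) : ℝ :=
  4 * (α - β) ^ 2 * calS a u t + Psi ρl ρr r s α β

/-- `⟨M_t, M_t⟩_{σ(u_t)⁻¹} - ⟨M_t σ(u_t)⁻¹⟩² S_t`. -/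
def bulkIntegrand (a : ℝ) (u du P : ℝ → ℝ → ℝ) (t : ℝ) : ℝ :=
  (∫ x in (-1 : ℝ)..1, (fluxM a u du P t x) ^ 2 / sigma a (u t x))
    - (meanMSigmaInv a u du P t) ^ 2 * calS a u t

/-- The bulk part `I^{(1)}` of the rate functional. -/
def I1 (T a : ℝ) (u du P : ℝ → ℝ → ℝ) : ℝ :=
  1 / 4 * ∫ t in (0 : ℝ)..T, bulkIntegrand a u du P t

/-- The boundary part `I^{(2)}` of the rate functional. -/
def I2 (T a ρl ρr : ℝ) (u du P : ℝ → ℝ → ℝ) (P1 PX : ℝ → ℝ) : EReal :=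
  ((1 / 4 : ℝ) : EReal) * ⨆ α : C10 T, ⨆ β : C10 T,
    ((∫ t in (0 : ℝ)..T, (α.1 t * gFun a ρl u du P P1 PX t + β.1 t * hFun a ρr u du P P1 PX t
      - Upsilon a ρl ρr u t (u t (-1)) (u t 1) (α.1 t) (β.1 t)) : ℝ) : EReal)

end RobinLD

end

/-! Put `k = M / √σ(u)`, which is `ratio`. Since `⟨⟨M, ∇H⟩⟩ = ⟨⟨k, √σ ∇H⟩⟩`, the bulk part of `Ĵ_H`
is a linear form in `√σ ∇H` minus its squared norm, plus terms that see only the traces `α = H(-1)`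
and `β = H(1)`. At a fixed time the traces constrain the gradient by `⟨1/√σ, √σ ∇H⟩ = β - α`. This
constraint is felt in `L²` only if `1/√σ` is square integrable, that is, if `S_t > 0`. Completing
the square under it yields `FluxSetting.Jhat_eq_sub_square`: `Ĵ_H` equals `I1`, plus a quarter of
the boundary action of `(α, β)`, minus the squared norm of `residual`.

The upper bound drops the square. The traces of a general `H` need not vanish at times `0` and `T`;
since `Υ` is convex in `(α, β)` and vanishes at `0`, multiplying them by a factor tending to `1`
loses nothing in the limit (`FluxSetting.boundaryAction_le`).

The lower bound prescribes the traces, takes their affine interpolation, and adds a function `g`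
vanishing at `x = ±1` to make the residual small. This is possible because whatever is orthogonal to
all `√σ ∂ₓg` is, after multiplication by `√σ`, a function of time alone, and the residual is
orthogonal to such functions (`FluxSetting.integral_mul_residual`).

Behind the identity lie two existence results. Test functions vanishing at `x = ±1` kill the
boundary term `B`, so a finite rate bounds a linear form minus a quadratic one, and Riesz
representation gives `M`, hence `P` (`exists_lateral_flux`). The energy enters here: it puts `D(u)
∇u` in `L²(σ(u)⁻¹)`. For the moments `⟨u_t, 1⟩` and `⟨u_t, x⟩` the boundary term survives and grows
exponentially, so the control is of Orlicz type rather than quadratic. It still makes the moments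
absolutely continuous (`absolutelyContinuous_of_timeForm_le`), and their derivatives are `P^𝟙` and
`P^X`. An arbitrary `H` is the affine interpolation of its traces plus a function vanishing at `x =
±1`, so these objects determine the linear part `L0` of `Ĵ_H` (`FluxSetting.L0_eq`). -/

noncomputable section

namespace RobinLD

/-! ### Two Hilbert space lemmas -/

section Hilbert

variable {α E : Type*} [MeasurableSpace α] {μ : Measure α} [AddCommGroup E] [Module ℝ E]

/-- A linear map into square integrable functions, as a map into `L²`. -/
def toL2 (S : E →ₗ[ℝ] (α → ℝ)) (hS : ∀ e, MemLp (S e) 2 μ) : E →ₗ[ℝ] Lp ℝ 2 μ where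
  toFun e := (hS e).toLp (S e)
  map_add' x y := by
    rw [← MemLp.toLp_add (hS x) (hS y)]
    exact MemLp.toLp_congr _ _ (by rw [map_add])
  map_smul' c x := by
    rw [RingHom.id_apply, ← MemLp.toLp_const_smul c (hS x)]
    exact MemLp.toLp_congr _ _ (by rw [map_smul])

theorem inner_toLp {f g : α → ℝ} (hf : MemLp f 2 μ) (hg : MemLp g 2 μ) :
    inner ℝ (hf.toLp f) (hg.toLp g) = ∫ x, f x * g x ∂μ := by
  rw [L2.inner_def]
  refine integral_congr_ae ?_
  filter_upwards [hf.coeFn_toLp, hg.coeFn_toLp] with x h1 h2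
  simp [h1, h2, mul_comm]

theorem norm_toLp_sq {f : α → ℝ} (hf : MemLp f 2 μ) :
    ‖hf.toLp f‖ ^ 2 = ∫ x, (f x) ^ 2 ∂μ := by
  rw [← real_inner_self_eq_norm_sq, inner_toLp]
  simp only [pow_two]

/-- A linear form dominated by a constant plus a quadratic form is represented by a square
integrable function. -/
theorem exists_riesz_of_sub_sq_le (S : E →ₗ[ℝ] (α → ℝ)) (hS : ∀ e, MemLp (S e) 2 μ)
    (l : E →ₗ[ℝ] ℝ) (C : ℝ) (h : ∀ e, l e - ∫ x, (S e x) ^ 2 ∂μ ≤ C) :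
    ∃ k : α → ℝ, Measurable k ∧ MemLp k 2 μ ∧ ∀ e, l e = ∫ x, k x * S e x ∂μ := by
  set L := toL2 S hS with hL
  have hC : 0 ≤ C := by simpa using h 0
  have hN : ∀ e, ‖L e‖ ^ 2 = ∫ x, (S e x) ^ 2 ∂μ := fun e => norm_toLp_sq (hS e)
  -- At `r • e` the first term is linear in `r` and the second quadratic; choosing `r` well bounds
  -- `l` by the seminorm `‖L e‖`.
  have hscale : ∀ (r : ℝ) e, r * l e ≤ C + r ^ 2 * ‖L e‖ ^ 2 := by
    intro r e
    have := h (r • e)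
    rw [← hN, map_smul, map_smul, norm_smul, mul_pow, Real.norm_eq_abs, sq_abs, smul_eq_mul] at this
    linarith
  have hle : ∀ e, l e ≤ (C + 1) * ‖L e‖ := by
    intro e
    rcases (norm_nonneg (L e)).eq_or_lt with h0 | h0
    · rw [← h0, mul_zero]
      by_contra! hp
      have := hscale ((C + 1) / l e) e
      rw [← h0, div_mul_cancel₀ _ hp.ne'] at this
      linarith
    · have := hscale (1 / ‖L e‖) e
      rw [← mul_pow, one_div_mul_cancel h0.ne', one_div, inv_mul_le_iff₀ h0] at this
      linarith
  have hb : ∀ e, |l e| ≤ (C + 1) * ‖L e‖ := by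
    intro e
    refine abs_le.2 ⟨?_, hle e⟩
    have := hle (-e)
    rw [map_neg, map_neg, norm_neg] at this
    linarith
  -- The form `l` vanishes where `L` does, so it factors through the range of `L`. The range need be
  -- neither closed nor dense: Hahn–Banach extends the factor to `L²`, and Riesz represents the
  -- extension.
  obtain ⟨g, hg⟩ := L.rangeRestrict.exists_rightInverse_of_surjective L.range_rangeRestrict
  have hgL : ∀ y : LinearMap.range L, L (g y) = y := fun y =>
    congrArg Subtype.val (LinearMap.congr_fun hg y)
  let f : StrongDual ℝ (LinearMap.range L) := (l.comp g).mkContinuous (C + 1) fun y => by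
    have := hb (g y)
    rw [hgL] at this
    simpa using this
  obtain ⟨F, hF, -⟩ := exists_extension_norm_eq (LinearMap.range L) f
  set k := (InnerProductSpace.toDual ℝ (Lp ℝ 2 μ)).symm F with hk
  have hkL : ∀ e, l e = inner ℝ k (L e) := by
    intro e
    rw [hk, InnerProductSpace.toDual_symm_apply]
    have h1 := hF ⟨L e, LinearMap.mem_range_self L e⟩
    simp only at h1
    rw [h1]
    change l e = l (g _)
    have h2 := hb (e - g ⟨L e, LinearMap.mem_range_self L e⟩)
    rw [map_sub, map_sub, hgL, sub_self, norm_zero, mul_zero] at h2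
    linarith [abs_nonpos_iff.1 h2]
  refine ⟨k, (Lp.stronglyMeasurable k).measurable, Lp.memLp k, fun e => ?_⟩
  rw [hkL, ← inner_toLp (Lp.memLp k) (hS e), Lp.toLp_coeFn]
  rfl

/-- A square integrable function that is orthogonal to the annihilator of a subspace is a limit
of elements of that subspace. -/
theorem exists_integral_sub_sq_lt (S : E →ₗ[ℝ] (α → ℝ)) (hS : ∀ e, MemLp (S e) 2 μ)
    {G : α → ℝ} (hG : MemLp G 2 μ)
    (h : ∀ k : α → ℝ, Measurable k → MemLp k 2 μ → (∀ e, ∫ x, k x * S e x ∂μ = 0) →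
      ∫ x, k x * G x ∂μ = 0) {ε : ℝ} (hε : 0 < ε) :
    ∃ e, ∫ x, (G x - S e x) ^ 2 ∂μ < ε := by
  set L := toL2 S hS with hL
  have hmem : hG.toLp G ∈ (LinearMap.range L).topologicalClosure := by
    rw [← Submodule.orthogonal_orthogonal_eq_closure]
    intro k hk
    have h1 := h k (Lp.stronglyMeasurable k).measurable (Lp.memLp k) (fun e => by
      rw [← inner_toLp (Lp.memLp k) (hS e), Lp.toLp_coeFn, real_inner_comm]
      exact hk _ (LinearMap.mem_range_self L e))
    rwa [← inner_toLp (Lp.memLp k) hG, Lp.toLp_coeFn] at h1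
  have h2 : hG.toLp G ∈ closure (LinearMap.range L : Set (Lp ℝ 2 μ)) := hmem
  obtain ⟨_, ⟨e, rfl⟩, hy⟩ := Metric.mem_closure_iff.1 h2 (Real.sqrt ε) (Real.sqrt_pos.2 hε)
  refine ⟨e, ?_⟩
  rw [dist_eq_norm] at hy
  have h3 : hG.toLp G - L e = (hG.sub (hS e)).toLp _ := (MemLp.toLp_sub hG (hS e)).symm
  have h4 : ‖hG.toLp G - L e‖ ^ 2 < ε := by
    rw [← Real.sq_sqrt hε.le]
    exact pow_lt_pow_left₀ hy (norm_nonneg _) two_ne_zero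
  rw [h3, norm_toLp_sq] at h4
  exact h4

end Hilbert

/-! ### The rectangle as a measure space -/

/-- Lebesgue measure on `[0,T]`. -/
abbrev timeMeasure (T : ℝ) : Measure ℝ := volume.restrict (Ioc 0 T)

/-- Lebesgue measure on `[-1,1]`. -/
abbrev spaceMeasure : Measure ℝ := volume.restrict (Ioc (-1) 1)

/-- Lebesgue measure on `[0,T] × [-1,1]`. -/
abbrev rectMeasure (T : ℝ) : Measure (ℝ × ℝ) := (timeMeasure T).prod spaceMeasure

theorem restrict_Icc_eq_timeMeasure (T : ℝ) : volume.restrict (Icc 0 T) = timeMeasure T :=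
  Measure.restrict_congr_set Ioc_ae_eq_Icc.symm

theorem restrict_Icc_eq_spaceMeasure : volume.restrict (Icc (-1 : ℝ) 1) = spaceMeasure :=
  Measure.restrict_congr_set Ioc_ae_eq_Icc.symm

theorem rectMeasure_eq (T : ℝ) :
    rectMeasure T = (volume : Measure (ℝ × ℝ)).restrict (Ioc 0 T ×ˢ Ioc (-1) 1) := by
  rw [rectMeasure, Measure.prod_restrict, Measure.volume_eq_prod]

theorem timeIntegral_eq {T : ℝ} (hT : 0 ≤ T) (f : ℝ → ℝ) :
    ∫ t in (0 : ℝ)..T, f t = ∫ t, f t ∂timeMeasure T :=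
  intervalIntegral.integral_of_le hT

theorem spaceIntegral_eq (f : ℝ → ℝ) :
    ∫ x in (-1 : ℝ)..1, f x = ∫ x, f x ∂spaceMeasure :=
  intervalIntegral.integral_of_le (by norm_num)

theorem iteratedIntegral_eq {T : ℝ} (hT : 0 ≤ T) {f : ℝ × ℝ → ℝ} (hf : Integrable f (rectMeasure T)) :
    ∫ t in (0 : ℝ)..T, ∫ x in (-1 : ℝ)..1, f (t, x) = ∫ z, f z ∂rectMeasure T := by
  rw [timeIntegral_eq hT, integral_prod f hf]
  simp only [spaceIntegral_eq]

/-! ### The fundamental lemma of the calculus of variations -/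

theorem ae_eq_zero_of_integral_smooth {a b : ℝ} {f : ℝ → ℝ} (hf : IntegrableOn f (Ioc a b))
    (h : ∀ θ : ℝ → ℝ, ContDiff ℝ ∞ θ → HasCompactSupport θ → tsupport θ ⊆ Ioo a b →
      ∫ x in Ioc a b, θ x * f x = 0) :
    ∀ᵐ x ∂(volume.restrict (Ioc a b)), f x = 0 := by
  have h1 := isOpen_Ioo.ae_eq_zero_of_integral_contDiff_smul_eq_zero
    (hf.mono_set Ioo_subset_Ioc_self).locallyIntegrableOn (fun θ h1 h2 h3 => by
      rw [← h θ h1 h2 h3]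
      simp only [smul_eq_mul]
      refine (setIntegral_eq_integral_of_forall_compl_eq_zero fun x hx => ?_).symm
      rw [image_eq_zero_of_notMem_tsupport (fun hx' => hx (Ioo_subset_Ioc_self (h3 hx'))), zero_mul])
  rw [← Measure.restrict_congr_set Ioo_ae_eq_Ioc, ae_restrict_iff' measurableSet_Ioo]
  exact h1

/-- Rectangles form a π-system that generates the product σ-algebra, and the sets over which `G`
integrates to zero are stable under complements and disjoint unions. -/
theorem ae_eq_zero_of_setIntegral_prod {α β : Type*} [MeasurableSpace α] [MeasurableSpace β]
    {μ : Measure (α × β)} {G : α × β → ℝ} (hG : Integrable G μ)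
    (h : ∀ s t, MeasurableSet s → MeasurableSet t → ∫ z in s ×ˢ t, G z ∂μ = 0) : G =ᵐ[μ] 0 := by
  refine hG.ae_eq_zero_of_forall_setIntegral_eq_zero fun s hs _ => ?_
  refine MeasurableSpace.induction_on_inter generateFrom_prod.symm isPiSystem_prod (by simp)
    ?_ ?_ ?_ s hs
  · rintro - ⟨s, hs, t, ht, rfl⟩
    exact h s t hs ht
  · intro t ht h0
    have h1 := integral_add_compl ht hG
    have h2 := h univ univ .univ .univ
    rw [univ_prod_univ, setIntegral_univ] at h2
    linarith
  · intro f hd hf h0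
    rw [integral_iUnion hf hd hG.integrableOn]
    simp [h0]

theorem exists_bound_of_hasCompactSupport {θ : ℝ → ℝ} (h1 : Continuous θ) (h2 : HasCompactSupport θ) :
    ∃ C, ∀ x, ‖θ x‖ ≤ C :=
  h2.exists_bound_of_continuous h1

/-- The one-dimensional lemma is used twice: in time with `ζ` frozen, which frees `θ` to be any
bounded measurable function, then in space with `θ` an indicator. Integrals over measurable
rectangles then vanish. -/
theorem ae_eq_zero_of_integral_smooth_prod {T : ℝ} {G : ℝ × ℝ → ℝ}
    (hG : Integrable G (rectMeasure T))
    (h : ∀ θ : ℝ → ℝ, ContDiff ℝ ∞ θ → HasCompactSupport θ → tsupport θ ⊆ Ioo 0 T →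
      ∀ ζ ∈ SmoothK, ∫ z, θ z.1 * ζ z.2 * G z ∂rectMeasure T = 0) :
    ∀ᵐ z ∂rectMeasure T, G z = 0 := by
  have hbdd : ∀ f g : ℝ → ℝ, Measurable f → Measurable g → (∃ C, ∀ x, ‖f x‖ ≤ C) →
      (∃ C, ∀ x, ‖g x‖ ≤ C) → Integrable (fun z => f z.1 * g z.2 * G z) (rectMeasure T) := by
    rintro f g hf hg ⟨C, hC⟩ ⟨D, hD⟩
    refine hG.bdd_mul (c := C * D) (by fun_prop) (Eventually.of_forall fun z => ?_)
    rw [norm_mul]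
    exact mul_le_mul (hC _) (hD _) (norm_nonneg _) ((norm_nonneg _).trans (hC z.1))
  have hone : ∃ C, ∀ x : ℝ, ‖(fun _ => (1 : ℝ)) x‖ ≤ C := ⟨1, by simp⟩
  have step : ∀ ζ ∈ SmoothK, ∀ f : ℝ → ℝ, Measurable f → (∃ C, ∀ x, ‖f x‖ ≤ C) →
      ∫ z, f z.1 * ζ z.2 * G z ∂rectMeasure T = 0 := by
    intro ζ hζ f hf hfb
    have hζb := exists_bound_of_hasCompactSupport hζ.1.continuous hζ.2.1
    have h1 := hbdd _ ζ measurable_const hζ.1.continuous.measurable hone hζb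
    have h2 : ∀ᵐ t ∂timeMeasure T, ∫ x, 1 * ζ x * G (t, x) ∂spaceMeasure = 0 := by
      refine ae_eq_zero_of_integral_smooth h1.integral_prod_left fun θ t1 t2 t3 => ?_
      refine Eq.trans ?_ (h θ t1 t2 t3 ζ hζ)
      rw [integral_prod _ (hbdd θ ζ t1.continuous.measurable
        hζ.1.continuous.measurable (exists_bound_of_hasCompactSupport t1.continuous t2) hζb)]
      simp only [← integral_const_mul, one_mul, mul_assoc]
    rw [integral_prod _ (hbdd f ζ hf hζ.1.continuous.measurable hfb hζb)]
    refine integral_eq_zero_of_ae ?_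
    filter_upwards [h2] with t ht
    simp only [mul_assoc, integral_const_mul, one_mul] at ht ⊢
    rw [ht, mul_zero]; rfl
  refine ae_eq_zero_of_setIntegral_prod hG fun s t hs ht => ?_
  have hind : ∀ s : Set ℝ, ∃ C, ∀ x, ‖s.indicator (fun _ => (1 : ℝ)) x‖ ≤ C := fun s =>
    ⟨1, fun x => by by_cases hx : x ∈ s <;> simp [hx]⟩
  have hms : Measurable (s.indicator fun _ => (1 : ℝ)) := measurable_const.indicator hs
  have hmt : Measurable (t.indicator fun _ => (1 : ℝ)) := measurable_const.indicator ht
  have h1 := (hbdd _ _ hms measurable_const (hind s) hone).swap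
  have h2 : ∀ᵐ x ∂spaceMeasure, ∫ τ, s.indicator (fun _ => (1 : ℝ)) τ * 1 * G (τ, x) ∂timeMeasure T
      = 0 := by
    refine ae_eq_zero_of_integral_smooth h1.integral_prod_left fun ζ t1 t2 t3 => ?_
    rw [← step ζ ⟨t1, t2, t3⟩ _ hms (hind s), integral_prod_symm _ (hbdd _ ζ hms
      t1.continuous.measurable (hind s) (exists_bound_of_hasCompactSupport t1.continuous t2))]
    simp only [← integral_const_mul]
    congr! 4
    ring
  rw [← integral_indicator (hs.prod ht)]
  have h3 : (s ×ˢ t).indicator G = fun z => s.indicator (fun _ => (1 : ℝ)) z.1 *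
      t.indicator (fun _ => (1 : ℝ)) z.2 * G z := by
    ext z
    by_cases h1 : z.1 ∈ s <;> by_cases h2 : z.2 ∈ t <;> simp [indicator, h1, h2]
  rw [h3, integral_prod_symm _ (hbdd _ _ hms hmt (hind s) (hind t))]
  refine integral_eq_zero_of_ae ?_
  filter_upwards [h2] with x hx
  rw [Pi.zero_apply, ← mul_zero (t.indicator (fun _ => (1 : ℝ)) x), ← hx, ← integral_const_mul]
  congr! 2
  ring

theorem exists_tsupport_subset_Icc {φ : ℝ → ℝ} (hφ : φ ∈ SmoothK) :
    ∃ r, 0 < r ∧ r < 1 ∧ tsupport φ ⊆ Icc (-r) r := by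
  rcases (tsupport φ).eq_empty_or_nonempty with h0 | h0
  · exact ⟨1 / 2, by norm_num, by norm_num, by simp [h0]⟩
  obtain ⟨y, hy, hmax⟩ := IsCompact.exists_isMaxOn hφ.2.1 h0 continuous_abs.continuousOn
  have hy1 : |y| < 1 := abs_lt.2 (hφ.2.2 hy)
  refine ⟨max |y| (1 / 2), by positivity, max_lt hy1 (by norm_num), fun x hx => ?_⟩
  exact abs_le.1 ((hmax hx).trans (le_max_left _ _))

/-- A smooth compactly supported function of zero mean has a smooth compactly supported
primitive. -/
theorem exists_deriv_eq_of_integral_eq_zero {ζ : ℝ → ℝ} (hζ : ζ ∈ SmoothK)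
    (h0 : ∫ x in (-1 : ℝ)..1, ζ x = 0) : ∃ φ ∈ SmoothK, deriv φ = ζ := by
  have hc := hζ.1.continuous
  set φ : ℝ → ℝ := fun x => ∫ y in (-1 : ℝ)..x, ζ y with hφ
  have hd : ∀ x, HasDerivAt φ (ζ x) x := fun x =>
    intervalIntegral.integral_hasDerivAt_right (hc.intervalIntegrable _ _)
      (hc.stronglyMeasurableAtFilter _ _) hc.continuousAt
  have hd' : deriv φ = ζ := funext fun x => (hd x).deriv
  obtain ⟨r, hr0, hr1, hr⟩ := exists_tsupport_subset_Icc hζ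
  have hz : ∀ x, x ∉ Icc (-r) r → ζ x = 0 := fun x hx =>
    image_eq_zero_of_notMem_tsupport fun h => hx (hr h)
  have hs : Function.support φ ⊆ Icc (-r) r := by
    intro x hx
    by_contra hxr
    refine hx ?_
    rw [mem_Icc, not_and_or, not_le, not_le] at hxr
    rcases hxr with hxr | hxr
    · refine intervalIntegral.integral_zero_ae (Eventually.of_forall fun y hy => hz y fun hy' => ?_)
      rcases le_max_iff.1 hy.2 with h | h <;> linarith [hy'.1]
    · have h1 : ∫ y in (1 : ℝ)..x, ζ y = 0 := by
        refine intervalIntegral.integral_zero_ae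
          (Eventually.of_forall fun y hy => hz y fun hy' => ?_)
        rcases min_lt_iff.1 hy.1 with h | h <;> linarith [hy'.2]
      change ∫ y in (-1 : ℝ)..x, ζ y = 0
      rw [← intervalIntegral.integral_add_adjacent_intervals (hc.intervalIntegrable _ 1)
        (hc.intervalIntegrable _ _), h0, h1, add_zero]
  have hts : tsupport φ ⊆ Icc (-r) r := closure_minimal hs isClosed_Icc
  refine ⟨φ, ⟨?_, ?_, hts.trans (Icc_subset_Ioo (by linarith) hr1)⟩, hd'⟩
  · rw [contDiff_infty_iff_deriv]
    exact ⟨fun x => (hd x).differentiableAt, hd' ▸ hζ.1⟩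
  · exact HasCompactSupport.of_support_subset_isCompact isCompact_Icc hs

theorem exists_smoothK_integral_eq_one : ∃ η ∈ SmoothK, ∫ x in (-1 : ℝ)..1, η x = 1 := by
  let f : ContDiffBump (0 : ℝ) := ⟨1 / 4, 1 / 2, by norm_num, by norm_num⟩
  have hs : tsupport (f.normed volume) ⊆ Ioo (-1 : ℝ) 1 := by
    rw [f.tsupport_normed_eq]
    intro x hx
    have : |x| ≤ f.rOut := by simpa using hx
    exact abs_lt.1 (this.trans_lt (by norm_num [f]))
  refine ⟨f.normed volume, ⟨f.contDiff_normed, f.hasCompactSupport_normed, hs⟩, ?_⟩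
  rw [spaceIntegral_eq, setIntegral_eq_integral_of_forall_compl_eq_zero, f.integral_normed]
  exact fun x hx => image_eq_zero_of_notMem_tsupport fun h => hx (Ioo_subset_Ioc_self (hs h))

/-- A function on the rectangle that is orthogonal to all space derivatives depends only on
time. -/
theorem exists_eq_time_of_integral_deriv_eq_zero {T : ℝ} {K : ℝ × ℝ → ℝ} (hm : Measurable K)
    (hK : Integrable K (rectMeasure T))
    (h : ∀ θ : ℝ → ℝ, ContDiff ℝ ∞ θ → HasCompactSupport θ → tsupport θ ⊆ Ioo 0 T →
      ∀ φ ∈ SmoothK, ∫ z, θ z.1 * deriv φ z.2 * K z ∂rectMeasure T = 0) :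
    ∃ b : ℝ → ℝ, Measurable b ∧ ∀ᵐ z ∂rectMeasure T, K z = b z.1 := by
  obtain ⟨η, hη, hη1⟩ := exists_smoothK_integral_eq_one
  have hbdd : ∀ f g : ℝ → ℝ, Measurable f → Measurable g → (∃ C, ∀ x, ‖f x‖ ≤ C) →
      (∃ C, ∀ x, ‖g x‖ ≤ C) → Integrable (fun z => f z.1 * g z.2 * K z) (rectMeasure T) := by
    rintro f g hf hg ⟨C, hC⟩ ⟨D, hD⟩
    refine hK.bdd_mul (c := C * D) (by fun_prop) (Eventually.of_forall fun z => ?_)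
    rw [norm_mul]
    exact mul_le_mul (hC _) (hD _) (norm_nonneg _) ((norm_nonneg _).trans (hC z.1))
  -- As `η` has unit mass, this pairing returns the function itself if it depends on time only.
  set b : ℝ → ℝ := fun t => ∫ x, η x * K (t, x) ∂spaceMeasure with hb
  have hηm := hη.1.continuous.measurable
  have hηb := exists_bound_of_hasCompactSupport hη.1.continuous hη.2.1
  have hbm : Measurable b := by
    have : StronglyMeasurable fun z : ℝ × ℝ => η z.2 * K z := by
      exact Measurable.stronglyMeasurable (by fun_prop)
    exact this.integral_prod_right'.measurable
  have hbi : Integrable b (timeMeasure T) := by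
    have := (hbdd (fun _ => 1) η measurable_const hηm ⟨1, by simp⟩ hηb).integral_prod_left
    simpa only [one_mul] using this
  refine ⟨b, hbm, ?_⟩
  have hbr : Integrable (fun z : ℝ × ℝ => b z.1) (rectMeasure T) := hbi.comp_fst _
  have hfin : ∀ᵐ z ∂rectMeasure T, K z - b z.1 = 0 := by
    refine ae_eq_zero_of_integral_smooth_prod (hK.sub hbr) fun θ t1 t2 t3 ζ hζ => ?_
    have hθm := t1.continuous.measurable
    have hθb := exists_bound_of_hasCompactSupport t1.continuous t2
    have hζm := hζ.1.continuous.measurable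
    have hζb := exists_bound_of_hasCompactSupport hζ.1.continuous hζ.2.1
    set c := ∫ x in (-1 : ℝ)..1, ζ x with hc
    -- The correction by `c * η` makes the mean zero, so that the difference is the derivative of an
    -- admissible test function.
    have hmem : (fun x => ζ x - c * η x) ∈ SmoothK := by
      refine ⟨hζ.1.sub (contDiff_const.mul hη.1), hζ.2.1.sub (hη.2.1.mul_left (f := fun _ => c)), ?_⟩
      refine (closure_minimal (fun x hx => ?_)
        ((isClosed_tsupport ζ).union (isClosed_tsupport η))).trans (union_subset hζ.2.2 hη.2.2)
      by_contra hx'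
      rw [mem_union, not_or] at hx'
      exact hx (by simp [image_eq_zero_of_notMem_tsupport hx'.1,
        image_eq_zero_of_notMem_tsupport hx'.2])
    obtain ⟨φ, hφ, hd⟩ := exists_deriv_eq_of_integral_eq_zero hmem (by
      rw [intervalIntegral.integral_sub (hζ.1.continuous.intervalIntegrable _ _)
        ((hη.1.continuous.const_mul c).intervalIntegrable _ _),
        intervalIntegral.integral_const_mul, hη1, mul_one, sub_self])
    have h1 := h θ t1 t2 t3 φ hφ
    have i1 := hbdd θ ζ hθm hζm hθb hζb
    have i2 := hbdd θ η hθm hηm hθb hηb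
    have e1 : ∫ z, θ z.1 * η z.2 * K z ∂rectMeasure T = ∫ t, θ t * b t ∂timeMeasure T := by
      rw [integral_prod _ i2]
      simp only [hb, ← integral_const_mul, mul_assoc]
    have e2 : ∫ z, θ z.1 * ζ z.2 * b z.1 ∂rectMeasure T = c * ∫ t, θ t * b t ∂timeMeasure T := by
      rw [hc, spaceIntegral_eq, mul_comm, ← integral_prod_mul (fun t => θ t * b t) ζ]
      congr! 2
      ring
    have i3 : Integrable (fun z : ℝ × ℝ => θ z.1 * ζ z.2 * b z.1) (rectMeasure T) := by
      obtain ⟨C, hC⟩ := hθb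
      obtain ⟨D, hD⟩ := hζb
      refine hbr.bdd_mul (c := C * D) (by fun_prop) (Eventually.of_forall fun z => ?_)
      rw [norm_mul]
      exact mul_le_mul (hC _) (hD _) (norm_nonneg _) ((norm_nonneg _).trans (hC z.1))
    have e3 : ∫ z, θ z.1 * deriv φ z.2 * K z ∂rectMeasure T
        = ∫ z, θ z.1 * ζ z.2 * K z ∂rectMeasure T - c * ∫ z, θ z.1 * η z.2 * K z ∂rectMeasure T := by
      rw [← integral_const_mul, ← integral_sub i1 (i2.const_mul c), hd]
      congr! 2
      ring
    simp only [mul_sub]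
    rw [integral_sub i1 i3, e2, ← e1]
    linarith
  filter_upwards [hfin] with z hz
  linarith

/-! ### Time derivatives dominated by an Orlicz functional -/

/-- `α` is continuously differentiable on `[0,T]` with derivative `α'`. -/
def IsC1On (T : ℝ) (α α' : ℝ → ℝ) : Prop :=
  (∀ t ∈ Icc 0 T, HasDerivWithinAt α (α' t) (Icc 0 T) t) ∧ ContinuousOn α' (Icc 0 T)

/-- The linear form `∫ α dm`, after an integration by parts. -/
def timeForm (T : ℝ) (m α α' : ℝ → ℝ) : ℝ :=
  α T * m T - α 0 * m 0 - ∫ t in (0 : ℝ)..T, α' t * m t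

/-- The smooth ramp from `0` to `1` on `[0, 1 / (j + 1)]`. -/
def ramp (j : ℕ) (t : ℝ) : ℝ := Real.smoothTransition ((j + 1) * t)

theorem contDiff_ramp (j : ℕ) : ContDiff ℝ ∞ (ramp j) :=
  (Real.smoothTransition.contDiff (n := ⊤)).comp (contDiff_const.mul contDiff_id)

theorem ramp_of_nonpos (j : ℕ) {t : ℝ} (ht : t ≤ 0) : ramp j t = 0 :=
  Real.smoothTransition.zero_of_nonpos (mul_nonpos_of_nonneg_of_nonpos (by positivity) ht)

theorem ramp_of_ge (j : ℕ) {t : ℝ} (ht : 1 / ((j : ℝ) + 1) ≤ t) : ramp j t = 1 := by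
  refine Real.smoothTransition.one_of_one_le ?_
  rw [div_le_iff₀ (by positivity)] at ht
  linarith

theorem abs_ramp_le (j : ℕ) (t : ℝ) : |ramp j t| ≤ 1 := by
  rw [ramp, abs_of_nonneg (Real.smoothTransition.nonneg _)]
  exact Real.smoothTransition.le_one _

theorem monotone_ramp (j : ℕ) : Monotone (ramp j) := fun _ _ h =>
  Real.smoothTransition.monotone (mul_le_mul_of_nonneg_left h (by positivity))

theorem hasDerivAt_ramp (j : ℕ) (a t : ℝ) :
    HasDerivAt (fun s => ramp j (s - a)) (deriv (ramp j) (t - a)) t :=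
  (((contDiff_ramp j).differentiable (by simp)).differentiableAt.hasDerivAt).comp_sub_const t a

theorem continuous_deriv_ramp (j : ℕ) : Continuous (deriv (ramp j)) :=
  (contDiff_ramp j).continuous_deriv (by simp)

theorem deriv_ramp_eq_zero_of_neg (j : ℕ) {t : ℝ} (ht : t < 0) : deriv (ramp j) t = 0 := by
  have : ramp j =ᶠ[𝓝 t] fun _ => 0 := by
    filter_upwards [Iio_mem_nhds ht] with s hs using ramp_of_nonpos j (le_of_lt hs)
  rw [this.deriv_eq, deriv_const]

theorem deriv_ramp_eq_zero_of_gt (j : ℕ) {t : ℝ} (ht : 1 / ((j : ℝ) + 1) < t) :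
    deriv (ramp j) t = 0 := by
  have : ramp j =ᶠ[𝓝 t] fun _ => 1 := by
    filter_upwards [Ioi_mem_nhds ht] with s hs using ramp_of_ge j (le_of_lt hs)
  rw [this.deriv_eq, deriv_const]

theorem eventually_ramp_eq_one {t : ℝ} (ht : 0 < t) : ∀ᶠ j : ℕ in atTop, ramp j t = 1 := by
  filter_upwards [(tendsto_one_div_add_atTop_nhds_zero_nat (𝕜 := ℝ)).eventually
    (Iio_mem_nhds ht)] with j hj using ramp_of_ge j (le_of_lt hj)

theorem tendsto_ramp (t : ℝ) :
    Tendsto (fun j => ramp j t) atTop (𝓝 (if 0 < t then 1 else 0)) := by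
  split_ifs with h
  · exact tendsto_const_nhds.congr' ((eventually_ramp_eq_one h).mono fun j hj => hj.symm)
  · simp only [ramp_of_nonpos _ (not_lt.1 h)]
    exact tendsto_const_nhds

theorem intervalIntegrable_mul_of_bounded {T B : ℝ} (hT : 0 ≤ T) {f m : ℝ → ℝ}
    (hf : ContinuousOn f (Icc 0 T)) (hm : Measurable m) (hB : ∀ t ∈ Icc 0 T, |m t| ≤ B) :
    IntervalIntegrable (fun t => f t * m t) volume 0 T := by
  have h1 : IntervalIntegrable m volume 0 T := by
    rw [intervalIntegrable_iff_integrableOn_Ioc_of_le hT]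
    refine Measure.integrableOn_of_bounded (M := B) (by simp) hm.aestronglyMeasurable ?_
    rw [ae_restrict_iff' measurableSet_Ioc]
    exact Eventually.of_forall fun t ht => hB t (Ioc_subset_Icc_self ht)
  exact h1.continuousOn_mul (by rwa [uIcc_of_le hT])

/-- The derivative of the shifted ramp is an approximate identity carried by `[a, a + 1 / (j + 1)]`,
to the right of `a`, so right-continuity of `m` suffices. If `a = T` the ramp vanishes on all of
`[0, T]`, in agreement with the limit `0`. -/
theorem tendsto_timeForm_ramp {T B : ℝ} (hT : 0 < T) {m : ℝ → ℝ} (hm : Measurable m)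
    (hB : ∀ t ∈ Icc 0 T, |m t| ≤ B) {a : ℝ} (ha : a ∈ Icc 0 T)
    (hc : ContinuousWithinAt m (Icc a T) a) :
    Tendsto (fun j => timeForm T m (fun t => ramp j (t - a)) (fun t => deriv (ramp j) (t - a)))
      atTop (𝓝 (m T - m a)) := by
  have hd : ∀ j, IntervalIntegrable (fun t => deriv (ramp j) (t - a)) volume 0 T := fun j =>
    ((continuous_deriv_ramp j).comp (continuous_sub_right a)).intervalIntegrable _ _
  have hdm : ∀ j, IntervalIntegrable (fun t => deriv (ramp j) (t - a) * m t) volume 0 T := fun j =>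
    intervalIntegrable_mul_of_bounded hT.le
      ((continuous_deriv_ramp j).comp (continuous_sub_right a)).continuousOn hm hB
  have hint : ∀ j, ∫ t in (0 : ℝ)..T, deriv (ramp j) (t - a) = ramp j (T - a) := fun j => by
    rw [intervalIntegral.integral_eq_sub_of_hasDerivAt (fun t _ => hasDerivAt_ramp j a t) (hd j),
      ramp_of_nonpos j (by linarith [ha.1] : 0 - a ≤ 0), sub_zero]
  have key : ∀ j, timeForm T m (fun t => ramp j (t - a)) (fun t => deriv (ramp j) (t - a))
      = ramp j (T - a) * (m T - m a)
        - ∫ t in (0 : ℝ)..T, deriv (ramp j) (t - a) * (m t - m a) := by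
    intro j
    simp only [mul_sub]
    rw [intervalIntegral.integral_sub (hdm j) ((hd j).mul_const _),
      intervalIntegral.integral_mul_const, hint, timeForm,
      ramp_of_nonpos j (by linarith [ha.1] : 0 - a ≤ 0)]
    ring
  simp only [key]
  have h1 : Tendsto (fun j => ramp j (T - a) * (m T - m a)) atTop (𝓝 (m T - m a)) := by
    rcases ha.2.eq_or_lt with h | h
    · simp [h]
    · refine tendsto_const_nhds.congr' ?_
      filter_upwards [eventually_ramp_eq_one (sub_pos.2 h)] with j hj
      rw [hj, one_mul]
  have h2 : Tendsto (fun j => ∫ t in (0 : ℝ)..T, deriv (ramp j) (t - a) * (m t - m a)) atTop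
      (𝓝 0) := by
    rw [Metric.tendsto_nhds]
    intro ε hε
    obtain ⟨δ, hδ, hδm⟩ := Metric.continuousWithinAt_iff.1 hc (ε / 2) (by positivity)
    filter_upwards [(tendsto_one_div_add_atTop_nhds_zero_nat (𝕜 := ℝ)).eventually
      (Iio_mem_nhds hδ)] with j hj
    rw [dist_zero_right]
    have h3 : ∀ t ∈ Ioc 0 T,
        ‖deriv (ramp j) (t - a) * (m t - m a)‖ ≤ deriv (ramp j) (t - a) * (ε / 2) := by
      intro t ht
      have hnn : 0 ≤ deriv (ramp j) (t - a) := (monotone_ramp j).deriv_nonneg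
      rw [norm_mul, Real.norm_of_nonneg hnn]
      rcases lt_or_ge t a with h | h
      · rw [deriv_ramp_eq_zero_of_neg j (sub_neg.2 h), zero_mul, zero_mul]
      rcases lt_or_ge (1 / ((j : ℝ) + 1)) (t - a) with h' | h'
      · rw [deriv_ramp_eq_zero_of_gt j h', zero_mul, zero_mul]
      refine mul_le_mul_of_nonneg_left ?_ hnn
      have := hδm ⟨h, ht.2⟩ (by
        rw [Real.dist_eq, abs_of_nonneg (sub_nonneg.2 h)]
        exact h'.trans_lt hj)
      rw [Real.dist_eq] at this
      exact this.le
    have h4 := intervalIntegral.norm_integral_le_of_norm_le hT.le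
      (Eventually.of_forall h3) ((hd j).mul_const _)
    rw [intervalIntegral.integral_mul_const, hint] at h4
    have h5 := (le_abs_self _).trans (abs_ramp_le j (T - a))
    nlinarith
  simpa using h1.sub h2

/-- The integrand of the Orlicz bound. -/
def orliczBound (k : ℝ → ℝ) (c t x : ℝ) : ℝ := k t * |x| + c * x ^ 2 + 4 * (Real.exp |x| - 1)

theorem orliczBound_mono {k : ℝ → ℝ} {c t x y : ℝ} (hk : 0 ≤ k t) (hc : 0 ≤ c) (h : |x| ≤ y) :
    orliczBound k c t x ≤ k t * y + c * y ^ 2 + 4 * (Real.exp y - 1) := by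
  have h1 : x ^ 2 ≤ y ^ 2 := by
    rw [← sq_abs]
    exact pow_le_pow_left₀ (abs_nonneg x) h 2
  unfold orliczBound
  gcongr

theorem orliczBound_nonneg {k : ℝ → ℝ} {c t : ℝ} (hk : 0 ≤ k t) (hc : 0 ≤ c) (x : ℝ) :
    0 ≤ orliczBound k c t x := by
  have : 1 ≤ Real.exp |x| := Real.one_le_exp (abs_nonneg x)
  unfold orliczBound
  have := mul_nonneg hk (abs_nonneg x)
  nlinarith [mul_nonneg hc (sq_nonneg x)]

/-- The step function `∑ rᵢ (1_{t > aᵢ} - 1_{t > bᵢ})`. -/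
def stepFun (E : ℕ × (ℕ → ℝ × ℝ)) (r : ℕ → ℝ) (t : ℝ) : ℝ :=
  ∑ i ∈ Finset.range E.1, r i *
    ((if 0 < t - (E.2 i).1 then 1 else 0) - (if 0 < t - (E.2 i).2 then 1 else 0))

/-- The intervals are disjoint, so at most one summand is nonzero at each time. -/
theorem abs_stepFun_le {E : ℕ × (ℕ → ℝ × ℝ)} {r : ℕ → ℝ} {l : ℝ} (hr : ∀ i, |r i| ≤ l)
    (hE : Set.PairwiseDisjoint (Finset.range E.1) (fun i ↦ uIoc (E.2 i).1 (E.2 i).2)) (t : ℝ) :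
    |stepFun E r t| ≤
      (⋃ i ∈ Finset.range E.1, uIoc (E.2 i).1 (E.2 i).2).indicator (fun _ => l) t := by
  rw [Finset.indicator_biUnion _ _ hE]
  refine (Finset.abs_sum_le_sum_abs _ _).trans (Finset.sum_le_sum fun i _ => ?_)
  rw [abs_mul]
  have := hr i
  simp only [indicator, uIoc, mem_Ioc, inf_lt_iff, le_sup_iff, sub_pos]
  split_ifs <;> simp <;> grind

/-- The hypothesis is tested on smoothed step functions. As the ramps sharpen, the linear form
converges to the sum of increments, and the right side converges by domination, since the test
functions are uniformly bounded. -/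
theorem sum_mul_sub_le_of_timeForm_le {T B c C : ℝ} (hT : 0 < T) {m k : ℝ → ℝ} (hm : Measurable m)
    (hB : ∀ t ∈ Icc 0 T, |m t| ≤ B) (hrc : ∀ a ∈ Icc 0 T, ContinuousWithinAt m (Icc a T) a)
    (hk : IntegrableOn k (Ioc 0 T)) (hk0 : ∀ t, 0 ≤ k t) (hc : 0 ≤ c)
    (h : ∀ α α', IsC1On T α α' →
      timeForm T m α α' ≤ C + ∫ t in (0 : ℝ)..T, orliczBound k c t (α t))
    {E : ℕ × (ℕ → ℝ × ℝ)}
    (hE : ∀ i ∈ Finset.range E.1, (E.2 i).1 ∈ Icc 0 T ∧ (E.2 i).2 ∈ Icc 0 T) {r : ℕ → ℝ} :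
    ∑ i ∈ Finset.range E.1, r i * (m (E.2 i).2 - m (E.2 i).1)
      ≤ C + ∫ t in (0 : ℝ)..T, orliczBound k c t (stepFun E r t) := by
  set α : ℕ → ℝ → ℝ := fun j t => ∑ i ∈ Finset.range E.1,
    r i * (ramp j (t - (E.2 i).1) - ramp j (t - (E.2 i).2)) with hα
  set α' : ℕ → ℝ → ℝ := fun j t => ∑ i ∈ Finset.range E.1,
    r i * (deriv (ramp j) (t - (E.2 i).1) - deriv (ramp j) (t - (E.2 i).2)) with hα'
  have hC1 : ∀ j, IsC1On T (α j) (α' j) := fun j =>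
    ⟨fun t _ => (HasDerivAt.fun_sum fun i _ =>
      ((hasDerivAt_ramp j _ t).sub (hasDerivAt_ramp j _ t)).const_mul (r i)).hasDerivWithinAt,
    (continuous_finsetSum _ fun i _ => continuous_const.mul
      (((continuous_deriv_ramp j).comp (continuous_sub_right _)).sub
        ((continuous_deriv_ramp j).comp (continuous_sub_right _)))).continuousOn⟩
  have hform : ∀ j, timeForm T m (α j) (α' j) = ∑ i ∈ Finset.range E.1, r i *
      (timeForm T m (fun t => ramp j (t - (E.2 i).1)) (fun t => deriv (ramp j) (t - (E.2 i).1))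
      - timeForm T m (fun t => ramp j (t - (E.2 i).2)) (fun t => deriv (ramp j) (t - (E.2 i).2))) := by
    intro j
    have hi : ∀ a, IntervalIntegrable (fun t => deriv (ramp j) (t - a) * m t) volume 0 T := fun a =>
      intervalIntegrable_mul_of_bounded hT.le
        ((continuous_deriv_ramp j).comp (continuous_sub_right a)).continuousOn hm hB
    have : ∫ t in (0 : ℝ)..T, α' j t * m t = ∑ i ∈ Finset.range E.1, r i *
        ((∫ t in (0 : ℝ)..T, deriv (ramp j) (t - (E.2 i).1) * m t)
          - ∫ t in (0 : ℝ)..T, deriv (ramp j) (t - (E.2 i).2) * m t) := by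
      simp only [hα', Finset.sum_mul, mul_assoc, sub_mul]
      rw [intervalIntegral.integral_finsetSum fun i _ => ((hi _).sub (hi _)).const_mul _]
      refine Finset.sum_congr rfl fun i _ => ?_
      rw [intervalIntegral.integral_const_mul, intervalIntegral.integral_sub (hi _) (hi _)]
    simp only [timeForm, this, hα, Finset.sum_mul, ← Finset.sum_sub_distrib]
    refine Finset.sum_congr rfl fun i _ => ?_
    ring
  have hlim1 : Tendsto (fun j => timeForm T m (α j) (α' j)) atTop
      (𝓝 (∑ i ∈ Finset.range E.1, r i * (m (E.2 i).2 - m (E.2 i).1))) := by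
    simp only [hform]
    refine tendsto_finsetSum _ fun i hi => Tendsto.const_mul _ ?_
    have := (tendsto_timeForm_ramp hT hm hB (hE i hi).1 (hrc _ (hE i hi).1)).sub
      (tendsto_timeForm_ramp hT hm hB (hE i hi).2 (hrc _ (hE i hi).2))
    simpa using this
  have hαlim : ∀ t, Tendsto (fun j => α j t) atTop (𝓝 (stepFun E r t)) := fun t =>
    tendsto_finsetSum _ fun i _ => ((tendsto_ramp _).sub (tendsto_ramp _)).const_mul _
  set R := ∑ i ∈ Finset.range E.1, |r i| * 2 with hR
  have hαb : ∀ j t, |α j t| ≤ R := by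
    intro j t
    refine (Finset.abs_sum_le_sum_abs _ _).trans (Finset.sum_le_sum fun i _ => ?_)
    rw [abs_mul]
    refine mul_le_mul_of_nonneg_left ((abs_sub _ _).trans ?_) (abs_nonneg _)
    linarith [abs_ramp_le j (t - (E.2 i).1), abs_ramp_le j (t - (E.2 i).2)]
  have hlim2 : Tendsto (fun j => ∫ t in (0 : ℝ)..T, orliczBound k c t (α j t)) atTop
      (𝓝 (∫ t in (0 : ℝ)..T, orliczBound k c t (stepFun E r t))) := by
    refine intervalIntegral.tendsto_integral_filter_of_dominated_convergence
      (fun t => k t * R + c * R ^ 2 + 4 * (Real.exp R - 1)) (Eventually.of_forall fun j => ?_)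
      (Eventually.of_forall fun j => Eventually.of_forall fun t _ => ?_) ?_
      (Eventually.of_forall fun t _ => ?_)
    · rw [uIoc_of_le hT.le]
      have hcont : Continuous (α j) := continuous_finsetSum _ fun i _ => continuous_const.mul
        (((contDiff_ramp j).continuous.comp (continuous_sub_right _)).sub
        ((contDiff_ramp j).continuous.comp (continuous_sub_right _)))
      exact ((hk.aestronglyMeasurable.mul hcont.abs.aestronglyMeasurable).add
        (continuous_const.mul (hcont.pow 2)).aestronglyMeasurable).add
        (by fun_prop : Continuous fun t => 4 * (Real.exp |α j t| - 1)).aestronglyMeasurable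
    · rw [Real.norm_of_nonneg (orliczBound_nonneg (hk0 t) hc _)]
      exact orliczBound_mono (hk0 t) hc (hαb j t)
    · have : IntervalIntegrable k volume 0 T :=
        (intervalIntegrable_iff_integrableOn_Ioc_of_le hT.le).2 hk
      exact ((this.mul_const _).add intervalIntegrable_const).add intervalIntegrable_const
    · have : Continuous fun x => orliczBound k c t x := by unfold orliczBound; fun_prop
      exact (this.tendsto _).comp (hαlim t)
  exact le_of_tendsto_of_tendsto' hlim1 (tendsto_const_nhds.add hlim2) fun j => h _ _ (hC1 j)

/-- Step functions of height `± l`, with signs matching the increments, give `l ∑ |Δm| ≤ C + ∫ κ`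
over the union of the intervals, with `κ` integrable. Taking `l` large absorbs `C`; a small total
length then absorbs the integral. -/
theorem absolutelyContinuous_of_timeForm_le {T B c C : ℝ} (hT : 0 < T) {m k : ℝ → ℝ}
    (hm : Measurable m)
    (hB : ∀ t ∈ Icc 0 T, |m t| ≤ B) (hrc : ∀ a ∈ Icc 0 T, ContinuousWithinAt m (Icc a T) a)
    (hk : IntegrableOn k (Ioc 0 T)) (hk0 : ∀ t, 0 ≤ k t) (hc : 0 ≤ c)
    (h : ∀ α α', IsC1On T α α' →
      timeForm T m α α' ≤ C + ∫ t in (0 : ℝ)..T, orliczBound k c t (α t)) :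
    AbsolutelyContinuousOnInterval m 0 T := by
  have hC : 0 ≤ C := by
    have := h (fun _ => 0) (fun _ => 0) ⟨fun t _ => hasDerivWithinAt_const _ _ _, continuousOn_const⟩
    simpa [timeForm, orliczBound] using this
  rw [AbsolutelyContinuousOnInterval, Metric.tendsto_nhds]
  intro ε hε
  -- With this height `l * (ε / 2) = C + 1` exceeds `C`, which leaves the other half of `l * ε` for
  -- the integral of `κ`.
  set l := 2 * (C + 1) / ε with hl
  have hl0 : 0 < l := by positivity
  set κ : ℝ → ℝ := fun t => k t * l + c * l ^ 2 + 4 * (Real.exp l - 1) with hκ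
  have hκi : Integrable κ (volume.restrict (uIoc 0 T)) := by
    rw [uIoc_of_le hT.le]
    exact ((hk.mul_const l).add (integrable_const _)).add (integrable_const _)
  have hsmall := hκi.tendsto_setIntegral_nhds_zero
    (AbsolutelyContinuousOnInterval.tendsto_volume_restrict_totalLengthFilter_disjWithin_nhds_zero
      0 T)
  have hev : ∀ᶠ E in AbsolutelyContinuousOnInterval.totalLengthFilter ⊓
      𝓟 (AbsolutelyContinuousOnInterval.disjWithin 0 T),
      E ∈ AbsolutelyContinuousOnInterval.disjWithin 0 T :=
    eventually_inf_principal.mpr (by simp)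
  filter_upwards [hsmall.eventually (Iio_mem_nhds (by positivity : (0 : ℝ) < l * (ε / 2))), hev]
    with E hE1 hE2
  obtain ⟨hE3, hE4⟩ := hE2
  rw [uIcc_of_le hT.le] at hE3
  rw [dist_zero_right, Real.norm_of_nonneg (Finset.sum_nonneg fun _ _ => dist_nonneg)]
  set r : ℕ → ℝ := fun i => l * (if m (E.2 i).1 ≤ m (E.2 i).2 then 1 else -1) with hr
  have hrl : ∀ i, |r i| ≤ l := fun i => by
    rw [hr, abs_mul, abs_of_pos hl0]
    split_ifs <;> simp
  have hsum : ∑ i ∈ Finset.range E.1, r i * (m (E.2 i).2 - m (E.2 i).1)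
      = l * ∑ i ∈ Finset.range E.1, dist (m (E.2 i).1) (m (E.2 i).2) := by
    rw [Finset.mul_sum]
    refine Finset.sum_congr rfl fun i _ => ?_
    rw [hr, mul_assoc, Real.dist_eq, abs_sub_comm]
    split_ifs with h1
    · rw [abs_of_nonneg (sub_nonneg.2 h1), one_mul]
    · rw [abs_of_neg (sub_neg.2 (not_le.1 h1)), neg_one_mul]
  have hmain := sum_mul_sub_le_of_timeForm_le hT hm hB hrc hk hk0 hc h hE3 (r := r)
  set s := ⋃ i ∈ Finset.range E.1, uIoc (E.2 i).1 (E.2 i).2 with hs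
  have hsm : MeasurableSet s := Finset.measurableSet_biUnion _ fun i _ => measurableSet_uIoc
  have hint : ∫ t in (0 : ℝ)..T, orliczBound k c t (stepFun E r t)
      ≤ ∫ t in s, κ t ∂volume.restrict (uIoc 0 T) := by
    rw [intervalIntegral.integral_of_le hT.le, ← integral_indicator hsm, uIoc_of_le hT.le]
    rw [uIoc_of_le hT.le] at hκi
    refine integral_mono_of_nonneg (Eventually.of_forall fun t => orliczBound_nonneg (hk0 t) hc _)
      (hκi.indicator hsm) (Eventually.of_forall fun t => ?_)
    have h1 := abs_stepFun_le hrl hE4 t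
    rw [← hs] at h1
    by_cases ht : t ∈ s
    · rw [indicator_of_mem ht] at h1
      simp only [indicator_of_mem ht]
      exact orliczBound_mono (hk0 t) hc h1
    · rw [indicator_of_notMem ht] at h1
      simp [indicator_of_notMem ht, orliczBound, abs_nonpos_iff.1 h1]
  rw [hsum] at hmain
  have h3 : l * (ε / 2) = C + 1 := by rw [hl]; field_simp
  have h4 : l * ∑ i ∈ Finset.range E.1, dist (m (E.2 i).1) (m (E.2 i).2) < l * ε := by
    have : ∫ t in s, κ t ∂volume.restrict (uIoc 0 T) < l * (ε / 2) := hE1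
    have h5 : l * ε = l * (ε / 2) + l * (ε / 2) := by ring
    linarith
  exact lt_of_mul_lt_mul_left h4 hl0.le

theorem IsC1On.contDiffOn {T : ℝ} (hT : 0 < T) {α α' : ℝ → ℝ} (h : IsC1On T α α') :
    ContDiffOn ℝ 1 α (Icc 0 T) := by
  rw [contDiffOn_one_iff_derivWithin (uniqueDiffOn_Icc hT)]
  exact ⟨fun t ht => (h.1 t ht).differentiableWithinAt, h.2.congr fun t ht =>
    (h.1 t ht).derivWithin (uniqueDiffOn_Icc hT t ht)⟩

theorem isC1On_of_contDiffOn {T : ℝ} (hT : 0 < T) {α : ℝ → ℝ} (h : ContDiffOn ℝ 1 α (Icc 0 T)) :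
    IsC1On T α (derivWithin α (Icc 0 T)) :=
  ⟨fun t ht => ((h.differentiableOn one_ne_zero) t ht).hasDerivWithinAt,
    h.continuousOn_derivWithin (uniqueDiffOn_Icc hT) le_rfl⟩

theorem IsC1On.continuousOn {T : ℝ} {α α' : ℝ → ℝ} (h : IsC1On T α α') :
    ContinuousOn α (Icc 0 T) := fun t ht => (h.1 t ht).continuousWithinAt

/-- A linear form dominated by an Orlicz functional has an integrable density. -/
theorem exists_density_of_timeForm_le {T B c C : ℝ} (hT : 0 < T) {m k : ℝ → ℝ}
    (hm : Measurable m)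
    (hB : ∀ t ∈ Icc 0 T, |m t| ≤ B) (hrc : ∀ a ∈ Icc 0 T, ContinuousWithinAt m (Icc a T) a)
    (hk : IntegrableOn k (Ioc 0 T)) (hk0 : ∀ t, 0 ≤ k t) (hc : 0 ≤ c)
    (h : ∀ α α', IsC1On T α α' →
      timeForm T m α α' ≤ C + ∫ t in (0 : ℝ)..T, orliczBound k c t (α t)) :
    ∃ p : ℝ → ℝ, IntervalIntegrable p volume 0 T ∧
      ∀ α α', IsC1On T α α' → timeForm T m α α' = ∫ t in (0 : ℝ)..T, α t * p t := by
  have hac := absolutelyContinuous_of_timeForm_le hT hm hB hrc hk hk0 hc h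
  -- An absolutely continuous function has an integrable derivative and obeys integration by parts,
  -- so its derivative is the density.
  refine ⟨deriv m, hac.intervalIntegrable_deriv, fun α α' hα => ?_⟩
  have hac' : AbsolutelyContinuousOnInterval α 0 T :=
    ContDiffOn.absolutelyContinuousOnInterval (by rw [uIcc_of_le hT.le]; exact hα.contDiffOn hT)
  rw [hac'.integral_mul_deriv_eq_deriv_mul hac, timeForm]
  congr 1
  refine intervalIntegral.integral_congr_Ioo_of_le hT.le fun t ht => ?_
  rw [((hα.1 t (Ioo_subset_Icc_self ht)).hasDerivAt (Icc_mem_nhds ht.1 ht.2)).deriv]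

/-! ### Profiles of a trajectory -/

theorem lintegral_rect_eq (T : ℝ) {f : ℝ × ℝ → ENNReal} (hf : Measurable f) :
    ∫⁻ t in Icc 0 T, ∫⁻ x in Icc (-1) 1, f (t, x) = ∫⁻ z, f z ∂rectMeasure T := by
  rw [restrict_Icc_eq_timeMeasure, restrict_Icc_eq_spaceMeasure, lintegral_prod _ hf.aemeasurable]

theorem ae_mem_rect (T : ℝ) : ∀ᵐ z ∂rectMeasure T, z.1 ∈ Icc 0 T ∧ z.2 ∈ Icc (-1 : ℝ) 1 := by
  rw [rectMeasure_eq]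
  filter_upwards [ae_restrict_mem (measurableSet_Ioc.prod measurableSet_Ioc)] with z hz
  exact ⟨Ioc_subset_Icc_self hz.1, Ioc_subset_Icc_self hz.2⟩

theorem ae_mem_time (T : ℝ) : ∀ᵐ t ∂timeMeasure T, t ∈ Icc 0 T := by
  filter_upwards [ae_restrict_mem measurableSet_Ioc] with t ht using Ioc_subset_Icc_self ht

theorem ae_mem_space : ∀ᵐ x ∂spaceMeasure, x ∈ Icc (-1 : ℝ) 1 := by
  filter_upwards [ae_restrict_mem measurableSet_Ioc] with t ht using Ioc_subset_Icc_self ht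

theorem integrable_of_lintegral_ofReal {α : Type*} [MeasurableSpace α] {μ : Measure α} {f : α → ℝ}
    (hf : AEStronglyMeasurable f μ) (h0 : ∀ᵐ x ∂μ, 0 ≤ f x)
    (h : ∫⁻ x, ENNReal.ofReal (f x) ∂μ < ⊤) : Integrable f μ :=
  ⟨hf, (hasFiniteIntegral_iff_ofReal h0).2 h⟩

section Profile

variable {T : ℝ} {π : Trajectory T} {u du v dv : ℝ → ℝ → ℝ}

theorem IsProfile.memLp_du (h : IsProfile T π u du) :
    MemLp (Function.uncurry du) 2 (rectMeasure T) := by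
  have hm := h.measurable_du
  rw [memLp_two_iff_integrable_sq hm.aestronglyMeasurable]
  refine integrable_of_lintegral_ofReal (hm.pow_const 2).aestronglyMeasurable
    (Eventually.of_forall fun z => sq_nonneg _) ?_
  rw [← lintegral_rect_eq T (hm.pow_const 2).ennreal_ofReal]
  exact h.sq_integrable

theorem IsProfile.measurable_slice (h : IsProfile T π u du) (t : ℝ) : Measurable (u t) :=
  h.measurable_u.comp measurable_prodMk_left

theorem IsProfile.integrable_slice (h : IsProfile T π u du) {t : ℝ} (ht : t ∈ Icc 0 T) :
    Integrable (u t) spaceMeasure := by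
  refine Integrable.of_bound (C := 1) (h.measurable_slice t).aestronglyMeasurable ?_
  filter_upwards [ae_mem_space] with x hx
  have := h.range_u t ht x hx
  rw [Real.norm_of_nonneg this.1]
  exact this.2

theorem IsProfile.ae_eq (hu : IsProfile T π u du) (hv : IsProfile T π v dv) {t : ℝ}
    (ht : t ∈ Icc 0 T) : u t =ᵐ[spaceMeasure] v t := by
  have h1 := (hu.density ⟨t, ht⟩).symm.trans (hv.density ⟨t, ht⟩)
  have hfin : ∫⁻ x : Omega, ENNReal.ofReal (u t x)
      ∂((volume : Measure ℝ).comap (Subtype.val : Omega → ℝ)) ≠ ⊤ := by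
    have h2 := hu.density ⟨t, ht⟩
    rw [← setLIntegral_univ, ← withDensity_apply _ MeasurableSet.univ, ← h2]
    exact measure_ne_top _ _
  replace h1 := (withDensity_eq_iff
    ((hu.measurable_slice t).comp measurable_subtype_coe).ennreal_ofReal.aemeasurable
    ((hv.measurable_slice t).comp measurable_subtype_coe).ennreal_ofReal.aemeasurable hfin).1 h1
  have h3 := (ae_restrict_iff_subtype (μ := (volume : Measure ℝ)) measurableSet_Ioo
    (p := fun x => ENNReal.ofReal (u t x) = ENNReal.ofReal (v t x))).2 h1
  rw [Measure.restrict_congr_set Ioo_ae_eq_Ioc] at h3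
  filter_upwards [h3, ae_mem_space] with x hx hx'
  exact (ENNReal.ofReal_eq_ofReal_iff (hu.range_u t ht x hx').1 (hv.range_u t ht x hx').1).1 hx

/-- Both slices are continuous for almost every time, so equality almost everywhere extends to the
endpoints: the traces `u_t(±1)` depend only on the trajectory. -/
theorem IsProfile.ae_eqOn (hu : IsProfile T π u du) (hv : IsProfile T π v dv) :
    ∀ᵐ t ∂timeMeasure T, EqOn (u t) (v t) (Icc (-1) 1) := by
  have h1 := hu.continuous_u
  have h2 := hv.continuous_u
  rw [restrict_Icc_eq_timeMeasure] at h1 h2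
  filter_upwards [h1, h2, ae_mem_time T] with t c1 c2 ht
  have := hu.ae_eq hv ht
  rw [spaceMeasure, Measure.restrict_congr_set Ioc_ae_eq_Icc] at this
  exact Measure.eqOn_Icc_of_ae_eq volume (by norm_num) this c1 c2

theorem IsProfile.ae_eq_du (hu : IsProfile T π u du) (hv : IsProfile T π v dv) :
    ∀ᵐ t ∂timeMeasure T, du t =ᵐ[spaceMeasure] dv t := by
  have h1 := hu.weak_deriv
  have h2 := hv.weak_deriv
  rw [restrict_Icc_eq_timeMeasure] at h1 h2
  have i1 := (hu.memLp_du.integrable (by norm_num)).prod_right_ae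
  have i2 := (hv.memLp_du.integrable (by norm_num)).prod_right_ae
  filter_upwards [h1, h2, i1, i2, hu.ae_eqOn hv] with t w1 w2 j1 j2 he
  have : ∀ᵐ x ∂spaceMeasure, du t x - dv t x = 0 := by
    refine ae_eq_zero_of_integral_smooth (j1.sub j2) fun θ t1 t2 t3 => ?_
    have e1 := w1 θ ⟨t1, t2, t3⟩
    have e2 := w2 θ ⟨t1, t2, t3⟩
    have e3 : ∫ x in (-1 : ℝ)..1, u t x * deriv θ x = ∫ x in (-1 : ℝ)..1, v t x * deriv θ x := by
      refine intervalIntegral.integral_congr fun x hx => ?_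
      rw [uIcc_of_le (by norm_num)] at hx
      simp only [he hx]
    obtain ⟨C, hC⟩ := exists_bound_of_hasCompactSupport t1.continuous t2
    have b1 : Integrable (fun x => du t x * θ x) spaceMeasure :=
      j1.mul_bdd (c := C) t1.continuous.aestronglyMeasurable (Eventually.of_forall hC)
    have b2 : Integrable (fun x => dv t x * θ x) spaceMeasure :=
      j2.mul_bdd (c := C) t1.continuous.aestronglyMeasurable (Eventually.of_forall hC)
    rw [spaceIntegral_eq, spaceIntegral_eq] at e1 e2
    rw [spaceIntegral_eq, spaceIntegral_eq] at e3
    have : ∀ x, θ x * (du t x - dv t x) = du t x * θ x - dv t x * θ x := fun x => by ring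
    simp only [this]
    rw [integral_sub b1 b2]
    linarith
  filter_upwards [this] with x hx
  linarith

theorem timeIntegral_congr {f g : ℝ → ℝ} (hT : 0 ≤ T) (h : f =ᵐ[timeMeasure T] g) :
    ∫ t in (0 : ℝ)..T, f t = ∫ t in (0 : ℝ)..T, g t := by
  rw [timeIntegral_eq hT, timeIntegral_eq hT]
  exact integral_congr_ae h

theorem spaceIntegral_congr {f g : ℝ → ℝ} (h : f =ᵐ[spaceMeasure] g) :
    ∫ x in (-1 : ℝ)..1, f x = ∫ x in (-1 : ℝ)..1, g x := by
  rw [spaceIntegral_eq, spaceIntegral_eq]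
  exact integral_congr_ae h

theorem IsProfile.energy_eq (hT : 0 ≤ T) (hu : IsProfile T π u du) (hv : IsProfile T π v dv) :
    energy T u = energy T v := by
  unfold energy
  refine iSup_congr fun G => ?_
  congr 2
  · congr 1
    refine timeIntegral_congr hT ?_
    filter_upwards [hu.ae_eqOn hv] with t he
    refine spaceIntegral_congr ?_
    filter_upwards [ae_mem_space] with x hx
    rw [he hx]
  · refine timeIntegral_congr hT ?_
    filter_upwards [hu.ae_eqOn hv] with t he
    refine spaceIntegral_congr ?_
    filter_upwards [ae_mem_space] with x hx
    rw [he hx]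

/-- `J` evaluates the functional at a profile obtained by choice; this permits replacing it by any
other. -/
theorem IsProfile.Jhat_eq {a ρl ρr : ℝ} (hT : 0 ≤ T) (hu : IsProfile T π u du)
    (hv : IsProfile T π v dv) (H : C11 T) :
    Jhat T a ρl ρr u du H = Jhat T a ρl ρr v dv H := by
  -- The density identity holds at every time, which is needed for the two terms of `L0` at the
  -- single times `0` and `T`.
  have hsp : ∀ t ∈ Icc 0 T, ∀ f : ℝ → ℝ,
      ∫ x in (-1 : ℝ)..1, u t x * f x = ∫ x in (-1 : ℝ)..1, v t x * f x := by
    intro t ht f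
    refine spaceIntegral_congr ?_
    filter_upwards [hu.ae_eq hv ht] with x hx
    rw [hx]
  unfold Jhat L0
  congr 1
  · congr 1
    · congr 1
      · congr 1
        · rw [hsp T ⟨hT, le_rfl⟩, hsp 0 ⟨le_rfl, hT⟩]
        · refine timeIntegral_congr hT ?_
          filter_upwards [ae_mem_time T] with t ht
          exact hsp t ht _
      · refine timeIntegral_congr hT ?_
        filter_upwards [hu.ae_eqOn hv, hu.ae_eq_du hv] with t h1 h2
        refine spaceIntegral_congr ?_
        filter_upwards [ae_mem_space, h2] with x hx hx'
        rw [h1 hx, hx']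
    · refine timeIntegral_congr hT ?_
      filter_upwards [hu.ae_eqOn hv] with t h1
      refine spaceIntegral_congr ?_
      filter_upwards [ae_mem_space] with x hx
      rw [h1 hx]
  · refine timeIntegral_congr hT ?_
    filter_upwards [hu.ae_eqOn hv] with t h1
    rw [h1 (by norm_num), h1 (by norm_num)]

/-- `⟨u_t, f⟩`. -/
def moment (u : ℝ → ℝ → ℝ) (f : ℝ → ℝ) (t : ℝ) : ℝ := ∫ x in (-1 : ℝ)..1, u t x * f x

theorem IsProfile.measurable_moment (hu : IsProfile T π u du) {f : ℝ → ℝ} (hf : Measurable f) :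
    Measurable (moment u f) := by
  have h1 : StronglyMeasurable fun z : ℝ × ℝ => u z.1 z.2 * f z.2 :=
    (hu.measurable_u.mul (hf.comp measurable_snd)).stronglyMeasurable
  unfold moment
  simp only [spaceIntegral_eq]
  exact h1.integral_prod_right'.measurable

theorem IsProfile.abs_moment_le (hu : IsProfile T π u du) {f : ℝ → ℝ} {C : ℝ}
    (hC : ∀ x ∈ Icc (-1 : ℝ) 1, |f x| ≤ C) {t : ℝ} (ht : t ∈ Icc 0 T) :
    |moment u f t| ≤ C * 2 := by
  have := intervalIntegral.norm_integral_le_of_norm_le_const (a := (-1 : ℝ)) (b := 1) (C := C)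
    (f := fun x => u t x * f x) fun x hx => by
      rw [uIoc_of_le (by norm_num)] at hx
      have hx' := Ioc_subset_Icc_self hx
      have h1 := hu.range_u t ht x hx'
      rw [norm_mul, Real.norm_of_nonneg h1.1, Real.norm_eq_abs]
      nlinarith [hC x hx', abs_nonneg (f x), h1.1, h1.2]
  rw [Real.norm_eq_abs] at this
  rw [sub_neg_eq_add, one_add_one_eq_two, abs_two] at this
  exact this

theorem IsProfile.integral_eq_moment (hu : IsProfile T π u du) (f : ℝ → ℝ) (t : Icc (0 : ℝ) T) :
    ∫ x : Omega, f x ∂(((π.toFun t : FiniteMeasure Omega)) : Measure Omega) = moment u f t := by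
  have hm : Measurable fun x : Omega => Real.toNNReal (u t x) :=
    ((hu.measurable_slice t).comp measurable_subtype_coe).real_toNNReal
  rw [hu.density t]
  have h1 := integral_withDensity_eq_integral_smul
    (μ := (volume : Measure ℝ).comap (Subtype.val : Omega → ℝ)) hm fun x : Omega => f x
  have h2 := integral_subtype_comap (μ := (volume : Measure ℝ)) (s := Ioo (-1 : ℝ) 1)
    measurableSet_Ioo fun x => Real.toNNReal (u t x) • f x
  rw [moment, spaceIntegral_eq, spaceMeasure, ← Measure.restrict_congr_set Ioo_ae_eq_Ioc]
  refine (h1.trans h2).trans ?_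
  refine setIntegral_congr_fun measurableSet_Ioo fun x hx => ?_
  simp only [NNReal.smul_def, smul_eq_mul]
  rw [Real.coe_toNNReal _ (hu.range_u t t.2 x (Ioo_subset_Icc_self hx)).1]

/-- Restricted to `]-1,1[`, `f` is bounded and continuous, hence a test function for the weak
topology in which the trajectory is right-continuous. -/
theorem IsProfile.continuousWithinAt_moment (hT : 0 ≤ T) (hu : IsProfile T π u du) {f : ℝ → ℝ}
    (hf : Continuous f) {a : ℝ} (ha : a ∈ Icc 0 T) :
    ContinuousWithinAt (moment u f) (Icc a T) a := by
  obtain ⟨C, hC⟩ := isCompact_Icc.exists_bound_of_continuousOn (hf.continuousOn (s := Icc (-1) 1))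
  let F : BoundedContinuousFunction Omega ℝ :=
    BoundedContinuousFunction.ofNormedAddCommGroup (fun x : Omega => f x)
      (hf.comp continuous_subtype_val) C fun x => hC x (Ioo_subset_Icc_self x.2)
  have h1 : Tendsto (fun t => (π.toFun t : FiniteMeasure Omega)) (𝓝[Ici ⟨a, ha⟩] ⟨a, ha⟩)
      (𝓝 (π.toFun ⟨a, ha⟩ : FiniteMeasure Omega)) :=
    (continuous_subtype_val.tendsto _).comp (π.right_continuous ⟨a, ha⟩)
  have h2 := FiniteMeasure.tendsto_iff_forall_integral_tendsto.1 h1 F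
  have h3 : ∀ t : Icc (0 : ℝ) T, ∫ x : Omega, F x
      ∂(((π.toFun t : FiniteMeasure Omega)) : Measure Omega) = moment u f t :=
    hu.integral_eq_moment f
  simp only [h3] at h2
  have h4 : Tendsto (projIcc 0 T hT) (𝓝[Icc a T] a) (𝓝[Ici ⟨a, ha⟩] ⟨a, ha⟩) := by
    refine tendsto_nhdsWithin_iff.2 ⟨?_, ?_⟩
    · have := (continuous_projIcc (h := hT)).tendsto a
      rw [projIcc_of_mem hT ha] at this
      exact this.mono_left nhdsWithin_le_nhds
    · filter_upwards [self_mem_nhdsWithin] with t ht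
      rw [projIcc_of_mem hT ⟨ha.1.trans ht.1, ht.2⟩]
      exact ht.1
  refine (h2.comp h4).congr' ?_
  filter_upwards [self_mem_nhdsWithin] with t ht
  simp [projIcc_of_mem hT ⟨ha.1.trans ht.1, ht.2⟩]

end Profile

/-! ### Test functions -/

theorem measurableSet_rect (T : ℝ) : MeasurableSet (rect T) := measurableSet_Icc.prod measurableSet_Icc

theorem aestronglyMeasurable_of_continuousOn_rect {T : ℝ} {f : ℝ × ℝ → ℝ}
    (hf : ContinuousOn f (rect T)) : AEStronglyMeasurable f (rectMeasure T) := by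
  rw [rectMeasure_eq]
  exact (hf.aestronglyMeasurable (measurableSet_rect T)).mono_measure
    (Measure.restrict_mono_set _ (prod_mono Ioc_subset_Icc_self Ioc_subset_Icc_self))

theorem exists_ae_bound_of_continuousOn_rect {T : ℝ} {f : ℝ × ℝ → ℝ}
    (hf : ContinuousOn f (rect T)) : ∃ C, ∀ᵐ z ∂rectMeasure T, ‖f z‖ ≤ C := by
  obtain ⟨C, hC⟩ := (isCompact_Icc.prod isCompact_Icc).exists_bound_of_continuousOn hf
  exact ⟨C, (ae_mem_rect T).mono fun z hz => hC z hz⟩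

theorem Integrable.mul_continuousOn_rect {T : ℝ} {f g : ℝ × ℝ → ℝ}
    (hg : Integrable g (rectMeasure T)) (hf : ContinuousOn f (rect T)) :
    Integrable (fun z => g z * f z) (rectMeasure T) := by
  obtain ⟨C, hC⟩ := exists_ae_bound_of_continuousOn_rect hf
  exact hg.mul_bdd (aestronglyMeasurable_of_continuousOn_rect hf) hC

theorem memLp_top_of_continuousOn_rect {T : ℝ} {f : ℝ × ℝ → ℝ}
    (hf : ContinuousOn f (rect T)) : MemLp f ⊤ (rectMeasure T) := by
  obtain ⟨C, hC⟩ := exists_ae_bound_of_continuousOn_rect hf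
  exact memLp_top_of_bound (aestronglyMeasurable_of_continuousOn_rect hf) C hC

/-- The defining property of `C11`. -/
structure IsC11 (T : ℝ) (v dt dx : ℝ → ℝ → ℝ) : Prop where
  hasDeriv_dt : ∀ t ∈ Set.Icc 0 T, ∀ x ∈ Set.Icc (-1 : ℝ) 1,
    HasDerivWithinAt (fun s => v s x) (dt t x) (Set.Icc 0 T) t
  hasDeriv_dx : ∀ t ∈ Set.Icc 0 T, ∀ x ∈ Set.Icc (-1 : ℝ) 1,
    HasDerivWithinAt (v t) (dx t x) (Set.Icc (-1) 1) x
  continuous_val : ContinuousOn (Function.uncurry v) (rect T)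
  continuous_dt : ContinuousOn (Function.uncurry dt) (rect T)
  continuous_dx : ContinuousOn (Function.uncurry dx) (rect T)

/-- The bundled version. -/
def IsC11.toC11 {T : ℝ} {v dt dx : ℝ → ℝ → ℝ} (h : IsC11 T v dt dx) : C11 T :=
  ⟨v, dt, dx, h.1, h.2, h.3, h.4, h.5⟩

theorem C11.isC11 {T : ℝ} (H : C11 T) : IsC11 T H.val H.dt H.dx :=
  ⟨H.hasDeriv_dt, H.hasDeriv_dx, H.continuous_val, H.continuous_dt, H.continuous_dx⟩

theorem IsC11.continuous_dt' {T : ℝ} {v dt dx : ℝ → ℝ → ℝ} (h : IsC11 T v dt dx) :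
    ContinuousOn (fun z : ℝ × ℝ => dt z.1 z.2) (rect T) := h.continuous_dt

theorem IsC11.continuous_dx' {T : ℝ} {v dt dx : ℝ → ℝ → ℝ} (h : IsC11 T v dt dx) :
    ContinuousOn (fun z : ℝ × ℝ => dx z.1 z.2) (rect T) := h.continuous_dx

theorem IsC11.add {T : ℝ} {v dt dx w et ex : ℝ → ℝ → ℝ} (h : IsC11 T v dt dx) (k : IsC11 T w et ex) :
    IsC11 T (v + w) (dt + et) (dx + ex) :=
  ⟨fun t ht x hx => (h.1 t ht x hx).add (k.1 t ht x hx),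
    fun t ht x hx => (h.2 t ht x hx).add (k.2 t ht x hx),
    h.3.add k.3, h.4.add k.4, h.5.add k.5⟩

theorem IsC11.smul {T : ℝ} {v dt dx : ℝ → ℝ → ℝ} (c : ℝ) (h : IsC11 T v dt dx) :
    IsC11 T (c • v) (c • dt) (c • dx) :=
  ⟨fun t ht x hx => (h.1 t ht x hx).const_mul c,
    fun t ht x hx => (h.2 t ht x hx).const_mul c,
    h.3.const_smul c, h.4.const_smul c, h.5.const_smul c⟩

theorem isC11_zero (T : ℝ) : IsC11 T 0 0 0 :=
  ⟨fun _ _ _ _ => hasDerivWithinAt_const _ _ _, fun _ _ _ _ => hasDerivWithinAt_const _ _ _,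
    continuousOn_const, continuousOn_const, continuousOn_const⟩

/-- `C^{1,1}` functions, with their derivatives, that vanish at `x = -1` and `x = 1`. -/
def lateralSpace (T : ℝ) :
    Submodule ℝ ((ℝ → ℝ → ℝ) × (ℝ → ℝ → ℝ) × (ℝ → ℝ → ℝ)) where
  carrier := {p | IsC11 T p.1 p.2.1 p.2.2 ∧ ∀ t ∈ Icc 0 T, p.1 t (-1) = 0 ∧ p.1 t 1 = 0}
  add_mem' h k := ⟨h.1.add k.1, fun t ht => by simp [h.2 t ht, k.2 t ht]⟩
  zero_mem' := ⟨isC11_zero T, fun _ _ => ⟨rfl, rfl⟩⟩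
  smul_mem' c _ h := ⟨h.1.smul c, fun t ht => by simp [h.2 t ht]⟩

theorem lateral_isC11 {T : ℝ} (p : lateralSpace T) : IsC11 T p.1.1 p.1.2.1 p.1.2.2 := p.2.1

theorem lateral_vanish {T : ℝ} (p : lateralSpace T) {t : ℝ} (ht : t ∈ Icc 0 T) :
    p.1.1 t (-1) = 0 ∧ p.1.1 t 1 = 0 := p.2.2 t ht

/-- The space derivative, as a function on the plane. -/
def lateralGrad (T : ℝ) : lateralSpace T →ₗ[ℝ] (ℝ × ℝ → ℝ) where
  toFun p z := p.1.2.2 z.1 z.2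
  map_add' _ _ := rfl
  map_smul' _ _ := rfl

theorem continuousOn_lateralGrad {T : ℝ} (p : lateralSpace T) :
    ContinuousOn (lateralGrad T p) (rect T) := p.2.1.continuous_dx

/-- The time derivative of a function on the plane. -/
def partialT (H : ℝ × ℝ → ℝ) (z : ℝ × ℝ) : ℝ := fderiv ℝ H z (1, 0)

/-- The space derivative of a function on the plane. -/
def partialX (H : ℝ × ℝ → ℝ) (z : ℝ × ℝ) : ℝ := fderiv ℝ H z (0, 1)

/-! ### Smooth test functions with compact support in the open rectangle -/

section Smooth

variable {H : ℝ × ℝ → ℝ}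

theorem contDiff_partialT (h : ContDiff ℝ ∞ H) : ContDiff ℝ ∞ (partialT H) :=
  (h.fderiv_right (m := ∞) (by simp)).clm_apply contDiff_const

theorem contDiff_partialX (h : ContDiff ℝ ∞ H) : ContDiff ℝ ∞ (partialX H) :=
  (h.fderiv_right (m := ∞) (by simp)).clm_apply contDiff_const

theorem hasDerivAt_partialT (h : ContDiff ℝ ∞ H) (t x : ℝ) :
    HasDerivAt (fun s => H (s, x)) (partialT H (t, x)) t := by
  have h1 : HasDerivAt (fun s : ℝ => (s, x)) ((1 : ℝ), (0 : ℝ)) t :=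
    (hasDerivAt_id t).prodMk (hasDerivAt_const t x)
  exact ((h.differentiable (by simp)) (t, x)).hasFDerivAt.comp_hasDerivAt t h1

theorem hasDerivAt_partialX (h : ContDiff ℝ ∞ H) (t x : ℝ) :
    HasDerivAt (fun y => H (t, y)) (partialX H (t, x)) x := by
  have h1 : HasDerivAt (fun y : ℝ => (t, y)) ((0 : ℝ), (1 : ℝ)) x :=
    (hasDerivAt_const x t).prodMk (hasDerivAt_id x)
  exact ((h.differentiable (by simp)) (t, x)).hasFDerivAt.comp_hasDerivAt x h1

theorem isC11_of_contDiff (T : ℝ) (h : ContDiff ℝ ∞ H) :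
    IsC11 T (fun t x => H (t, x)) (fun t x => partialT H (t, x)) (fun t x => partialX H (t, x)) :=
  ⟨fun t _ x _ => (hasDerivAt_partialT h t x).hasDerivWithinAt,
    fun t _ x _ => (hasDerivAt_partialX h t x).hasDerivWithinAt,
    h.continuous.continuousOn, (contDiff_partialT h).continuous.continuousOn,
    (contDiff_partialX h).continuous.continuousOn⟩

variable {T : ℝ}

theorem SmoothKT.eq_zero (h : H ∈ SmoothKT T) {z : ℝ × ℝ} (hz : z ∉ Ioo 0 T ×ˢ Ioo (-1 : ℝ) 1) :
    H z = 0 :=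
  image_eq_zero_of_notMem_tsupport fun h' => hz (h.2.2 h')

/-- A smooth function with compact support in the open rectangle, as an element of
`lateralSpace`. -/
theorem SmoothKT.mem_lateralSpace (h : H ∈ SmoothKT T) :
    ((fun t x => H (t, x)), (fun t x => partialT H (t, x)), (fun t x => partialX H (t, x)))
      ∈ lateralSpace T :=
  ⟨isC11_of_contDiff T h.1, fun _ _ => ⟨SmoothKT.eq_zero h (by simp), SmoothKT.eq_zero h (by simp)⟩⟩

/-- A smooth function with compact support in the open rectangle, as an element of `C12Zero`. -/
def SmoothKT.toC12Zero (h : H ∈ SmoothKT T) : C12Zero T where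
  toC11 := (isC11_of_contDiff T h.1).toC11
  dxx t x := partialX (partialX H) (t, x)
  hasDeriv_dxx t _ x _ := (hasDerivAt_partialX (contDiff_partialX h.1) t x).hasDerivWithinAt
  continuous_dxx := (contDiff_partialX (contDiff_partialX h.1)).continuous.continuousOn
  vanish_left _ _ := SmoothKT.eq_zero h (by simp)
  vanish_right _ _ := SmoothKT.eq_zero h (by simp)

theorem SmoothKT.slice_mem (h : H ∈ SmoothKT T) (t : ℝ) : (fun x => H (t, x)) ∈ SmoothK := by
  have hs : Function.support (fun x => H (t, x)) ⊆ Prod.snd '' tsupport H := fun x hx =>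
    ⟨(t, x), subset_tsupport _ hx, rfl⟩
  have hc : IsCompact (Prod.snd '' tsupport H) := IsCompact.image h.2.1 continuous_snd
  refine ⟨h.1.comp (contDiff_const.prodMk contDiff_id),
    HasCompactSupport.of_support_subset_isCompact hc hs, (closure_minimal hs hc.isClosed).trans ?_⟩
  rintro _ ⟨z, hz, rfl⟩
  exact (h.2.2 hz).2

theorem smoothKT_mul_mem {θ ζ : ℝ → ℝ} (h1 : ContDiff ℝ ∞ θ) (h2 : HasCompactSupport θ)
    (h3 : tsupport θ ⊆ Ioo 0 T) (hζ : ζ ∈ SmoothK) : (fun z => θ z.1 * ζ z.2) ∈ SmoothKT T := by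
  have hs : Function.support (fun z : ℝ × ℝ => θ z.1 * ζ z.2) ⊆ tsupport θ ×ˢ tsupport ζ := by
    intro z hz
    exact ⟨subset_tsupport _ (left_ne_zero_of_mul hz), subset_tsupport _ (right_ne_zero_of_mul hz)⟩
  have hc : IsCompact (tsupport θ ×ˢ tsupport ζ) := IsCompact.prod h2 hζ.2.1
  exact ⟨(h1.comp contDiff_fst).mul (hζ.1.comp contDiff_snd),
    HasCompactSupport.of_support_subset_isCompact hc hs,
    (closure_minimal hs hc.isClosed).trans (prod_mono h3 hζ.2.2)⟩

theorem partialX_mul {θ ζ : ℝ → ℝ} (h1 : ContDiff ℝ ∞ θ) (hζ : ContDiff ℝ ∞ ζ) (z : ℝ × ℝ) :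
    partialX (fun z => θ z.1 * ζ z.2) z = θ z.1 * deriv ζ z.2 := by
  have h := (hasDerivAt_partialX ((h1.comp contDiff_fst).mul (hζ.comp contDiff_snd)) z.1 z.2).deriv
  rw [← Prod.mk.eta (p := z)]
  refine Eq.trans h.symm ?_
  exact ((((hζ.differentiable (by simp)) z.2).hasDerivAt).const_mul (θ z.1)).deriv

/-- `SmoothKT` as a vector space. -/
def smoothKTSubmodule (T : ℝ) : Submodule ℝ (ℝ × ℝ → ℝ) where
  carrier := SmoothKT T
  add_mem' h k := ⟨h.1.add k.1, h.2.1.add k.2.1,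
    (tsupport_add _ _).trans (union_subset h.2.2 k.2.2)⟩
  zero_mem' := ⟨contDiff_const, HasCompactSupport.zero, by simp [tsupport]⟩
  smul_mem' c f h := ⟨contDiff_const.mul h.1, h.2.1.mul_left (f := fun _ => c),
    (tsupport_smul_subset_right (fun _ => c) f).trans h.2.2⟩

/-- A function whose pairing with all space derivatives vanishes depends only on time. -/
theorem exists_eq_time_of_integral_partialX_eq_zero {K : ℝ × ℝ → ℝ} (hm : Measurable K)
    (hK : Integrable K (rectMeasure T))
    (h : ∀ H ∈ SmoothKT T, ∫ z, partialX H z * K z ∂rectMeasure T = 0) :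
    ∃ b : ℝ → ℝ, Measurable b ∧ ∀ᵐ z ∂rectMeasure T, K z = b z.1 := by
  refine exists_eq_time_of_integral_deriv_eq_zero hm hK fun θ t1 t2 t3 φ hφ => ?_
  rw [← h _ (smoothKT_mul_mem t1 t2 t3 hφ)]
  simp only [partialX_mul t1 hφ.1]

end Smooth

/-! ### The energy estimate -/

theorem chi_nonneg {r : ℝ} (hr : r ∈ Icc (0 : ℝ) 1) : 0 ≤ chi r :=
  mul_nonneg hr.1 (sub_nonneg.2 hr.2)

theorem chi_le_one {r : ℝ} (hr : r ∈ Icc (0 : ℝ) 1) : chi r ≤ 1 := by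
  unfold chi; nlinarith [hr.1, hr.2]

theorem measurable_chi : Measurable chi := by unfold chi; fun_prop

section Energy

variable {T : ℝ} {π : Trajectory T} {u du : ℝ → ℝ → ℝ}

theorem IsProfile.ae_range (hu : IsProfile T π u du) :
    ∀ᵐ z ∂rectMeasure T, u z.1 z.2 ∈ Icc (0 : ℝ) 1 :=
  (ae_mem_rect T).mono fun z hz => hu.range_u z.1 hz.1 z.2 hz.2

theorem IsProfile.measurable_u' (hu : IsProfile T π u du) :
    Measurable fun z : ℝ × ℝ => u z.1 z.2 := hu.measurable_u

theorem IsProfile.measurable_du' (hu : IsProfile T π u du) :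
    Measurable fun z : ℝ × ℝ => du z.1 z.2 := hu.measurable_du

theorem IsProfile.integrable_u (hu : IsProfile T π u du) :
    Integrable (fun z => u z.1 z.2) (rectMeasure T) := by
  refine Integrable.of_bound (C := 1) hu.measurable_u.aestronglyMeasurable ?_
  filter_upwards [hu.ae_range] with z hz
  rw [Real.norm_of_nonneg hz.1]
  exact hz.2

theorem IsProfile.integrable_du (hu : IsProfile T π u du) :
    Integrable (fun z => du z.1 z.2) (rectMeasure T) := hu.memLp_du.integrable (by norm_num)

theorem IsProfile.integral_partialX (hT : 0 ≤ T) (hu : IsProfile T π u du) {H : ℝ × ℝ → ℝ}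
    (hH : H ∈ SmoothKT T) :
    ∫ z, u z.1 z.2 * partialX H z ∂rectMeasure T = -∫ z, du z.1 z.2 * H z ∂rectMeasure T := by
  have i1 : Integrable (fun z : ℝ × ℝ => u z.1 z.2 * partialX H z) (rectMeasure T) :=
    Integrable.mul_continuousOn_rect hu.integrable_u (contDiff_partialX hH.1).continuous.continuousOn
  have i2 : Integrable (fun z : ℝ × ℝ => du z.1 z.2 * H z) (rectMeasure T) :=
    Integrable.mul_continuousOn_rect hu.integrable_du hH.1.continuous.continuousOn
  rw [← iteratedIntegral_eq hT i1, ← iteratedIntegral_eq hT i2, ← intervalIntegral.integral_neg]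
  refine timeIntegral_congr hT ?_
  have h1 := hu.weak_deriv
  rw [restrict_Icc_eq_timeMeasure] at h1
  filter_upwards [h1] with t ht
  rw [← ht _ (SmoothKT.slice_mem hH t)]
  refine intervalIntegral.integral_congr fun x _ => ?_
  rw [(hasDerivAt_partialX hH.1 t x).deriv]

/-- Finite energy: `∇u` is square integrable with respect to `χ(u)⁻¹`. -/
theorem IsProfile.exists_du_eq (hT : 0 ≤ T) (hu : IsProfile T π u du) (hE : energy T u < ⊤) :
    ∃ k : ℝ × ℝ → ℝ, Measurable k ∧ MemLp k 2 (rectMeasure T) ∧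
      ∀ᵐ z ∂rectMeasure T, du z.1 z.2 = Real.sqrt (chi (u z.1 z.2)) * k z := by
  have hχm : Measurable fun z : ℝ × ℝ => Real.sqrt (chi (u z.1 z.2)) :=
    (measurable_chi.comp hu.measurable_u').sqrt
  have hχb : ∀ᵐ z ∂rectMeasure T, ‖Real.sqrt (chi (u z.1 z.2))‖ ≤ 1 := by
    filter_upwards [hu.ae_range] with z hz
    rw [Real.norm_of_nonneg (Real.sqrt_nonneg _), Real.sqrt_le_one]
    exact chi_le_one hz
  let S : smoothKTSubmodule T →ₗ[ℝ] (ℝ × ℝ → ℝ) :=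
    { toFun := fun G z => Real.sqrt (chi (u z.1 z.2)) * G.1 z
      map_add' := fun G G' => by ext z; simp [mul_add]
      map_smul' := fun c G => by ext z; simp [mul_left_comm] }
  have hGtop : ∀ G : smoothKTSubmodule T, MemLp G.1 ⊤ (rectMeasure T) := fun G =>
    memLp_top_of_continuousOn_rect G.2.1.continuous.continuousOn
  have hS : ∀ G, MemLp (S G) 2 (rectMeasure T) := fun G =>
    (MemLp.mul (p := ⊤) (q := ⊤) (r := ⊤) (hGtop G)
      (memLp_top_of_bound hχm.aestronglyMeasurable 1 hχb)).mono_exponent le_top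
  -- By the definition of the weak gradient this is `2 ∫ u ∂ₓG`, so finite energy is the hypothesis
  -- of the Riesz lemma with quadratic form `∫ χ(u) G²`.
  let l : smoothKTSubmodule T →ₗ[ℝ] ℝ :=
    { toFun := fun G => -2 * ∫ z, du z.1 z.2 * G.1 z ∂rectMeasure T
      map_add' := fun G G' => by
        have i1 := fun G : smoothKTSubmodule T => Integrable.mul_continuousOn_rect hu.integrable_du
          (f := G.1) G.2.1.continuous.continuousOn
        rw [← mul_add, ← integral_add (i1 G) (i1 G')]
        simp [mul_add]
      map_smul' := fun c G => by
        simp only [Submodule.coe_smul, Pi.smul_apply, smul_eq_mul, RingHom.id_apply,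
          mul_left_comm _ c, integral_const_mul] }
  obtain ⟨k, hkm, hk, hkl⟩ := exists_riesz_of_sub_sq_le S hS l (energy T u).toReal (by
    intro G
    have h1 := (le_iSup (fun G : C12Zero T =>
      (((2 * ∫ t in (0 : ℝ)..T, ∫ x in (-1 : ℝ)..1, u t x * G.dx t x)
      - ∫ t in (0 : ℝ)..T, ∫ x in (-1 : ℝ)..1, chi (u t x) * (G.val t x) ^ 2 : ℝ) : EReal))
      (SmoothKT.toC12Zero G.2)).trans (EReal.le_coe_toReal hE.ne)
    rw [EReal.coe_le_coe_iff] at h1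
    refine le_trans (le_of_eq ?_) h1
    congr 1
    · have i1 : Integrable (fun z : ℝ × ℝ => u z.1 z.2 * partialX G.1 z) (rectMeasure T) :=
        Integrable.mul_continuousOn_rect hu.integrable_u
          (contDiff_partialX G.2.1).continuous.continuousOn
      change -2 * ∫ z, du z.1 z.2 * G.1 z ∂rectMeasure T =
        2 * ∫ t in (0 : ℝ)..T, ∫ x in (-1 : ℝ)..1, u t x * partialX G.1 (t, x)
      rw [iteratedIntegral_eq hT i1, hu.integral_partialX hT G.2]
      ring
    · have e1 : (fun z => (S G z) ^ 2) =ᵐ[rectMeasure T]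
          fun z : ℝ × ℝ => chi (u z.1 z.2) * (G.1 z) ^ 2 := by
        filter_upwards [hu.ae_range] with z hz
        change (Real.sqrt (chi (u z.1 z.2)) * G.1 z) ^ 2 = _
        rw [mul_pow, Real.sq_sqrt (chi_nonneg hz)]
      rw [integral_congr_ae e1]
      exact (iteratedIntegral_eq hT
        (f := fun z => chi (u z.1 z.2) * (G.1 z) ^ 2) ((hS G).integrable_sq.congr e1)).symm)
  have hks : Integrable (fun z => Real.sqrt (chi (u z.1 z.2)) * k z) (rectMeasure T) :=
    (hk.integrable (by norm_num)).bdd_mul hχm.aestronglyMeasurable hχb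
  have hzero : ∀ᵐ z ∂rectMeasure T, 2 * du z.1 z.2 + Real.sqrt (chi (u z.1 z.2)) * k z = 0 := by
    refine ae_eq_zero_of_integral_smooth_prod ((hu.integrable_du.const_mul 2).add hks)
      fun θ t1 t2 t3 ζ hζ => ?_
    have hmem := smoothKT_mul_mem t1 t2 t3 hζ
    have h1 : -2 * ∫ z, du z.1 z.2 * (θ z.1 * ζ z.2) ∂rectMeasure T
        = ∫ z, k z * (Real.sqrt (chi (u z.1 z.2)) * (θ z.1 * ζ z.2)) ∂rectMeasure T :=
      hkl ⟨_, hmem⟩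
    have i1 := Integrable.mul_continuousOn_rect hu.integrable_du hmem.1.continuous.continuousOn
    have i2 := Integrable.mul_continuousOn_rect hks hmem.1.continuous.continuousOn
    have e : ∀ z : ℝ × ℝ, θ z.1 * ζ z.2 * (2 * du z.1 z.2 + Real.sqrt (chi (u z.1 z.2)) * k z)
        = 2 * (du z.1 z.2 * (θ z.1 * ζ z.2))
          + Real.sqrt (chi (u z.1 z.2)) * k z * (θ z.1 * ζ z.2) := fun z => by ring
    simp only [e]
    rw [integral_add (i1.const_mul 2) i2, integral_const_mul]
    have e2 : ∀ z : ℝ × ℝ, k z * (Real.sqrt (chi (u z.1 z.2)) * (θ z.1 * ζ z.2))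
        = Real.sqrt (chi (u z.1 z.2)) * k z * (θ z.1 * ζ z.2) := fun z => by ring
    simp only [e2] at h1
    linarith
  refine ⟨fun z => (-1 / 2) * k z, hkm.const_mul _, hk.const_mul _, ?_⟩
  filter_upwards [hzero] with z hz
  linarith

end Energy

/-! ### Coefficients -/

section Coeff

variable {a r : ℝ}

theorem diffusivity_pos (ha : -1 / 2 < a) (hr : r ∈ Icc (0 : ℝ) 1) : 0 < diffusivity a r := by
  unfold diffusivity
  rcases hr.1.eq_or_lt with h | h
  · simp [← h]
  · nlinarith [hr.2, mul_pos h (by linarith : 0 < 1 + 2 * a)]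

theorem diffusivity_le (hr : r ∈ Icc (0 : ℝ) 1) : diffusivity a r ≤ 1 + 2 * |a| := by
  unfold diffusivity
  nlinarith [hr.1, hr.2, le_abs_self a, abs_nonneg a]

theorem sigma_nonneg (ha : -1 / 2 < a) (hr : r ∈ Icc (0 : ℝ) 1) : 0 ≤ sigma a r :=
  mul_nonneg (chi_nonneg hr) (diffusivity_pos ha hr).le

theorem sigma_le (ha : -1 / 2 < a) (hr : r ∈ Icc (0 : ℝ) 1) : sigma a r ≤ 1 + 2 * |a| :=
  (mul_le_of_le_one_left (diffusivity_pos ha hr).le (chi_le_one hr)).trans (diffusivity_le hr)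

theorem measurable_diffusivity : Measurable (diffusivity a) := by unfold diffusivity; fun_prop

theorem measurable_sigma : Measurable (sigma a) := measurable_chi.mul measurable_diffusivity

end Coeff

theorem MemLp.top_mul {α : Type*} [MeasurableSpace α] {μ : Measure α} {f g : α → ℝ}
    (hf : MemLp f ⊤ μ) (hg : MemLp g 2 μ) : MemLp (fun x => f x * g x) 2 μ :=
  MemLp.mul (p := ⊤) (q := 2) (r := 2) hg hf

/-! ### The weighted space `L²(σ(u)⁻¹)` -/

section Flux

variable {T a : ℝ} {π : Trajectory T} {u du P : ℝ → ℝ → ℝ}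

/-- `√σ(u)`. -/
def sqrtSigma (a : ℝ) (u : ℝ → ℝ → ℝ) (z : ℝ × ℝ) : ℝ := Real.sqrt (sigma a (u z.1 z.2))

theorem IsProfile.measurable_sigma (hu : IsProfile T π u du) :
    Measurable fun z : ℝ × ℝ => sigma a (u z.1 z.2) := RobinLD.measurable_sigma.comp hu.measurable_u'

theorem IsProfile.measurable_sqrtSigma (hu : IsProfile T π u du) : Measurable (sqrtSigma a u) :=
  hu.measurable_sigma.sqrt

theorem IsProfile.measurable_diffusivity (hu : IsProfile T π u du) :
    Measurable fun z : ℝ × ℝ => diffusivity a (u z.1 z.2) :=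
  RobinLD.measurable_diffusivity.comp hu.measurable_u'

theorem IsProfile.sqrtSigma_sq (ha : -1 / 2 < a) (hu : IsProfile T π u du) :
    ∀ᵐ z ∂rectMeasure T, sqrtSigma a u z ^ 2 = sigma a (u z.1 z.2) := by
  filter_upwards [hu.ae_range] with z hz
  exact Real.sq_sqrt (sigma_nonneg ha hz)

theorem IsProfile.memLp_sqrtSigma (ha : -1 / 2 < a) (hu : IsProfile T π u du) :
    MemLp (sqrtSigma a u) ⊤ (rectMeasure T) := by
  refine memLp_top_of_bound hu.measurable_sqrtSigma.aestronglyMeasurable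
    (Real.sqrt (1 + 2 * |a|)) ?_
  filter_upwards [hu.ae_range] with z hz
  rw [sqrtSigma, Real.norm_of_nonneg (Real.sqrt_nonneg _)]
  exact Real.sqrt_le_sqrt (sigma_le ha hz)

theorem IsProfile.memLp_diffusivity (ha : -1 / 2 < a) (hu : IsProfile T π u du) :
    MemLp (fun z => diffusivity a (u z.1 z.2)) ⊤ (rectMeasure T) := by
  refine memLp_top_of_bound hu.measurable_diffusivity.aestronglyMeasurable (1 + 2 * |a|) ?_
  filter_upwards [hu.ae_range] with z hz
  rw [Real.norm_of_nonneg (diffusivity_pos ha hz).le]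
  exact diffusivity_le hz

theorem IsProfile.memLp_diffusivity_mul_du (ha : -1 / 2 < a) (hu : IsProfile T π u du) :
    MemLp (fun z => diffusivity a (u z.1 z.2) * du z.1 z.2) 2 (rectMeasure T) :=
  MemLp.top_mul (hu.memLp_diffusivity ha) hu.memLp_du

/-- `F / √σ(u)`. -/
def ratio (a : ℝ) (u F : ℝ → ℝ → ℝ) (z : ℝ × ℝ) : ℝ := F z.1 z.2 / sqrtSigma a u z

theorem MemL2SigmaInv.lintegral_lt_top (hu : IsProfile T π u du) {F : ℝ → ℝ → ℝ}
    (hF : MemL2SigmaInv T a u F) :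
    Measurable (fun z : ℝ × ℝ =>
      ENNReal.ofReal (F z.1 z.2 ^ 2) / ENNReal.ofReal (sigma a (u z.1 z.2))) ∧
    ∫⁻ z, ENNReal.ofReal (F z.1 z.2 ^ 2) / ENNReal.ofReal (sigma a (u z.1 z.2))
      ∂rectMeasure T < ⊤ := by
  have hFm : Measurable fun z : ℝ × ℝ => F z.1 z.2 := hF.1
  have hm : Measurable fun z : ℝ × ℝ =>
      ENNReal.ofReal (F z.1 z.2 ^ 2) / ENNReal.ofReal (sigma a (u z.1 z.2)) :=
    (hFm.pow_const 2).ennreal_ofReal.div hu.measurable_sigma.ennreal_ofReal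
  refine ⟨hm, ?_⟩
  rw [← lintegral_rect_eq T hm]
  exact hF.2

theorem MemL2SigmaInv.measurable_ratio (hu : IsProfile T π u du) {F : ℝ → ℝ → ℝ}
    (hF : MemL2SigmaInv T a u F) : Measurable (ratio a u F) :=
  Measurable.div hF.1 hu.measurable_sqrtSigma

theorem MemL2SigmaInv.memLp_ratio (ha : -1 / 2 < a) (hu : IsProfile T π u du) {F : ℝ → ℝ → ℝ}
    (hF : MemL2SigmaInv T a u F) : MemLp (ratio a u F) 2 (rectMeasure T) := by
  have hkm := hF.measurable_ratio hu
  rw [memLp_two_iff_integrable_sq hkm.aestronglyMeasurable]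
  refine integrable_of_lintegral_ofReal (hkm.pow_const 2).aestronglyMeasurable
    (Eventually.of_forall fun z => sq_nonneg _)
    (lt_of_le_of_lt (lintegral_mono_ae ?_) (hF.lintegral_lt_top hu).2)
  filter_upwards [hu.sqrtSigma_sq ha, hu.ae_range] with z hz hz'
  rw [ratio, div_pow, hz]
  rcases (sigma_nonneg ha hz').eq_or_lt with h0 | h0
  · simp [← h0]
  · rw [ENNReal.ofReal_div_of_pos h0]

/-- Elements of `L²(σ⁻¹)` vanish where `σ` does. -/
theorem MemL2SigmaInv.ae_eq_mul_ratio (hu : IsProfile T π u du) {F : ℝ → ℝ → ℝ}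
    (hF : MemL2SigmaInv T a u F) :
    ∀ᵐ z ∂rectMeasure T, F z.1 z.2 = sqrtSigma a u z * ratio a u F z := by
  obtain ⟨hm, hfin⟩ := hF.lintegral_lt_top hu
  filter_upwards [ae_lt_top hm hfin.ne] with z hz
  by_cases h0 : sqrtSigma a u z = 0
  · rw [h0, zero_mul]
    have h1 : ENNReal.ofReal (sigma a (u z.1 z.2)) = 0 :=
      ENNReal.ofReal_eq_zero.2 (Real.sqrt_eq_zero'.1 h0)
    rw [h1] at hz
    by_contra hne
    rw [ENNReal.div_zero] at hz
    · exact lt_irrefl _ hz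
    · exact (ENNReal.ofReal_pos.2 (by positivity)).ne'
  · rw [ratio, mul_div_cancel₀ _ h0]

/-- Together with `ae_eq_mul_ratio` and `memLp_ratio`, this turns the weighted space into `√σ · L²`.
Where `σ = 0` the function vanishes and the extended quotient `0 / 0` is `0`. -/
theorem memL2SigmaInv_of_eq (ha : -1 / 2 < a) (hu : IsProfile T π u du) {F : ℝ → ℝ → ℝ}
    (hF : Measurable (Function.uncurry F)) {k : ℝ × ℝ → ℝ} (hk : MemLp k 2 (rectMeasure T))
    (h : ∀ᵐ z ∂rectMeasure T, F z.1 z.2 = sqrtSigma a u z * k z) : MemL2SigmaInv T a u F := by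
  have hFm : Measurable fun z : ℝ × ℝ => F z.1 z.2 := hF
  have hm : Measurable fun z : ℝ × ℝ =>
      ENNReal.ofReal (F z.1 z.2 ^ 2) / ENNReal.ofReal (sigma a (u z.1 z.2)) :=
    (hFm.pow_const 2).ennreal_ofReal.div hu.measurable_sigma.ennreal_ofReal
  refine ⟨hF, ?_⟩
  have hfin : ∫⁻ z, ENNReal.ofReal (k z ^ 2) ∂rectMeasure T < ⊤ :=
    (hasFiniteIntegral_iff_ofReal (Eventually.of_forall fun z => sq_nonneg (k z))).1
      hk.integrable_sq.hasFiniteIntegral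
  rw [lintegral_rect_eq T hm]
  refine lt_of_le_of_lt (lintegral_mono_ae ?_) hfin
  filter_upwards [hu.sqrtSigma_sq ha, hu.ae_range, h] with z hz hz' hF
  rw [hF, mul_pow, hz]
  rcases (sigma_nonneg ha hz').eq_or_lt with h0 | h0
  · simp [← h0]
  · rw [← ENNReal.ofReal_div_of_pos h0, mul_div_cancel_left₀ _ h0.ne']

/-- Finite energy gives `∇u = √χ k` with `k` in `L²`; as `σ = χ D`, this is `D ∇u = √σ (√D k)` with
`√D` bounded. -/
theorem IsProfile.exists_diffusivity_mul_du_eq (hT : 0 ≤ T) (ha : -1 / 2 < a)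
    (hu : IsProfile T π u du) (hE : energy T u < ⊤) :
    ∃ k : ℝ × ℝ → ℝ, Measurable k ∧ MemLp k 2 (rectMeasure T) ∧
      ∀ᵐ z ∂rectMeasure T, diffusivity a (u z.1 z.2) * du z.1 z.2 = sqrtSigma a u z * k z := by
  obtain ⟨k, hkm, hk, hke⟩ := hu.exists_du_eq hT hE
  have hDm := (hu.measurable_diffusivity (a := a)).sqrt
  have hD : MemLp (fun z : ℝ × ℝ => Real.sqrt (diffusivity a (u z.1 z.2))) ⊤ (rectMeasure T) := by
    refine memLp_top_of_bound hDm.aestronglyMeasurable (Real.sqrt (1 + 2 * |a|)) ?_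
    filter_upwards [hu.ae_range] with z hz
    rw [Real.norm_of_nonneg (Real.sqrt_nonneg _)]
    exact Real.sqrt_le_sqrt (diffusivity_le hz)
  refine ⟨_, hDm.mul hkm, MemLp.top_mul hD hk, ?_⟩
  filter_upwards [hke, hu.ae_range] with z hz hz'
  have h1 := Real.mul_self_sqrt (diffusivity_pos ha hz').le
  rw [hz, sqrtSigma, sigma, Real.sqrt_mul (chi_nonneg hz')]
  nth_rewrite 1 [← h1]
  simp only [Pi.mul_apply]
  ring

/-! ### The linear part of the rate functional -/

theorem IsC11.continuousOn_slice {v dt dx : ℝ → ℝ → ℝ} (h : IsC11 T v dt dx) {t : ℝ}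
    (ht : t ∈ Icc 0 T) : ContinuousOn (v t) (Icc (-1) 1) :=
  fun x hx => (h.hasDeriv_dx t ht x hx).continuousWithinAt

theorem IsProfile.intervalIntegrable_slice_mul (hu : IsProfile T π u du) {t : ℝ} (ht : t ∈ Icc 0 T)
    {f : ℝ → ℝ} (hf : ContinuousOn f (Icc (-1) 1)) :
    IntervalIntegrable (fun x => u t x * f x) volume (-1) 1 := by
  have h1 : IntervalIntegrable (u t) volume (-1) 1 :=
    (intervalIntegrable_iff_integrableOn_Ioc_of_le (by norm_num)).2 (hu.integrable_slice ht)
  exact h1.mul_continuousOn (by rwa [uIcc_of_le (by norm_num)])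

theorem IsProfile.L0_eq (hT : 0 ≤ T) (hu : IsProfile T π u du) (H : C11 T) :
    L0 T u H = (∫ x in (-1 : ℝ)..1, u T x * H.val T x) - (∫ x in (-1 : ℝ)..1, u 0 x * H.val 0 x)
      - ∫ z, u z.1 z.2 * H.dt z.1 z.2 ∂rectMeasure T := by
  rw [L0, ← iteratedIntegral_eq hT
    (Integrable.mul_continuousOn_rect hu.integrable_u H.isC11.continuous_dt')]

theorem IsProfile.L0_add (hT : 0 ≤ T) (hu : IsProfile T π u du) {v dt dx w et ex : ℝ → ℝ → ℝ}
    (h : IsC11 T v dt dx) (k : IsC11 T w et ex) :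
    L0 T u (h.add k).toC11 = L0 T u h.toC11 + L0 T u k.toC11 := by
  have hTm : T ∈ Icc 0 T := ⟨hT, le_rfl⟩
  have h0m : (0 : ℝ) ∈ Icc 0 T := ⟨le_rfl, hT⟩
  have i1 := Integrable.mul_continuousOn_rect hu.integrable_u h.continuous_dt'
  have i2 := Integrable.mul_continuousOn_rect hu.integrable_u k.continuous_dt'
  simp only [hu.L0_eq hT, IsC11.toC11, Pi.add_apply, mul_add]
  rw [intervalIntegral.integral_add (hu.intervalIntegrable_slice_mul hTm (h.continuousOn_slice hTm))
    (hu.intervalIntegrable_slice_mul hTm (k.continuousOn_slice hTm)),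
    intervalIntegral.integral_add (hu.intervalIntegrable_slice_mul h0m (h.continuousOn_slice h0m))
    (hu.intervalIntegrable_slice_mul h0m (k.continuousOn_slice h0m))]
  have := integral_add i1 i2
  rw [this]
  ring

theorem L0_smul (c : ℝ) {v dt dx : ℝ → ℝ → ℝ} (h : IsC11 T v dt dx) :
    L0 T u (h.smul c).toC11 = c * L0 T u h.toC11 := by
  simp only [L0, IsC11.toC11, Pi.smul_apply, smul_eq_mul, mul_left_comm _ c,
    intervalIntegral.integral_const_mul]
  ring

theorem IsProfile.Jhat_rect (hT : 0 ≤ T) (ha : -1 / 2 < a) (hu : IsProfile T π u du) {ρl ρr : ℝ}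
    (H : C11 T) :
    Jhat T a ρl ρr u du H = L0 T u H
      + (∫ z, diffusivity a (u z.1 z.2) * du z.1 z.2 * H.dx z.1 z.2 ∂rectMeasure T)
      - (∫ z, (sqrtSigma a u z * H.dx z.1 z.2) ^ 2 ∂rectMeasure T)
      - ∫ t in (0 : ℝ)..T, boundaryB ρl ρr (u t (-1)) (u t 1) (H.val t (-1)) (H.val t 1) := by
  have i1 := Integrable.mul_continuousOn_rect
    ((hu.memLp_diffusivity_mul_du ha).integrable (by norm_num)) H.isC11.continuous_dx'
  have i2 : Integrable (fun z => (sqrtSigma a u z * H.dx z.1 z.2) ^ 2) (rectMeasure T) :=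
    (MemLp.top_mul (hu.memLp_sqrtSigma ha)
      ((memLp_top_of_continuousOn_rect H.continuous_dx).mono_exponent le_top)).integrable_sq
  have e : (fun z => (sqrtSigma a u z * H.dx z.1 z.2) ^ 2) =ᵐ[rectMeasure T]
      fun z => sigma a (u z.1 z.2) * H.dx z.1 z.2 ^ 2 := by
    filter_upwards [hu.sqrtSigma_sq ha] with z hz
    rw [mul_pow, hz]
  rw [Jhat, ← iteratedIntegral_eq hT i1, integral_congr_ae e,
    ← iteratedIntegral_eq hT (i2.congr e)]

/-! ### Existence and uniqueness of the flux -/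

theorem IsC11.integral_dx {v dt dx : ℝ → ℝ → ℝ} (h : IsC11 T v dt dx) {t : ℝ} (ht : t ∈ Icc 0 T) :
    ∫ x in (-1 : ℝ)..1, dx t x = v t 1 - v t (-1) := by
  have hc : ContinuousOn (dx t) (Icc (-1) 1) :=
    h.continuous_dx.comp (continuousOn_const.prodMk continuousOn_id) fun x hx => ⟨ht, hx⟩
  exact intervalIntegral.integral_eq_sub_of_hasDerivAt_of_le (by norm_num)
    (h.continuousOn_slice ht) (fun x hx => (h.hasDeriv_dx t ht x
      (Ioo_subset_Icc_self hx)).hasDerivAt (Icc_mem_nhds hx.1 hx.2))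
    (hc.intervalIntegrable_of_Icc (by norm_num))

/-- The boundary term is zero for these test functions, so `L0 + ⟨⟨D ∇u, ∇H⟩⟩ - ‖√σ ∇H‖²` is bounded
above and its linear part is a pairing of `√σ ∇H` with some `k`. Hence `M = √σ k`, and `P = M - D
∇u`. -/
theorem exists_lateral_flux {ρl ρr C : ℝ} (hT : 0 ≤ T) (ha : -1 / 2 < a) (hu : IsProfile T π u du)
    (hE : energy T u < ⊤) (hC : ∀ H, Jhat T a ρl ρr u du H ≤ C) :
    ∃ P : ℝ → ℝ → ℝ, MemL2SigmaInv T a u P ∧ ∀ p : lateralSpace T,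
      L0 T u (lateral_isC11 p).toC11 = ∫ z, lateralGrad T p z * P z.1 z.2 ∂rectMeasure T := by
  have hDi : Integrable (fun z => diffusivity a (u z.1 z.2) * du z.1 z.2) (rectMeasure T) :=
    (hu.memLp_diffusivity_mul_du ha).integrable (by norm_num)
  let S : lateralSpace T →ₗ[ℝ] (ℝ × ℝ → ℝ) :=
    { toFun := fun p z => sqrtSigma a u z * lateralGrad T p z
      map_add' := fun G G' => by ext z; simp [mul_add]
      map_smul' := fun c G => by ext z; simp [mul_left_comm] }
  have hS : ∀ p, MemLp (S p) 2 (rectMeasure T) := fun p =>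
    MemLp.top_mul (hu.memLp_sqrtSigma ha)
      ((memLp_top_of_continuousOn_rect (continuousOn_lateralGrad p)).mono_exponent le_top)
  have hDp : ∀ p : lateralSpace T, Integrable (fun z => diffusivity a (u z.1 z.2) * du z.1 z.2 *
      lateralGrad T p z) (rectMeasure T) := fun p =>
    Integrable.mul_continuousOn_rect hDi (continuousOn_lateralGrad p)
  let l : lateralSpace T →ₗ[ℝ] ℝ :=
    { toFun := fun p => L0 T u (lateral_isC11 p).toC11
        + ∫ z, diffusivity a (u z.1 z.2) * du z.1 z.2 * lateralGrad T p z ∂rectMeasure T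
      map_add' := fun p q => by
        have h1 := hu.L0_add hT (lateral_isC11 p) (lateral_isC11 q)
        have h2 := integral_add (hDp p) (hDp q)
        simp only [map_add, Pi.add_apply, mul_add]
        rw [h2]
        refine Eq.trans (congrArg (· + _) h1) ?_
        ring
      map_smul' := fun c p => by
        have h1 := L0_smul (u := u) c (lateral_isC11 p)
        simp only [map_smul, Pi.smul_apply, smul_eq_mul, RingHom.id_apply, mul_left_comm _ c,
          integral_const_mul, mul_add]
        exact congrArg (· + _) h1 }
  obtain ⟨k, hkm, hk, hkl⟩ := exists_riesz_of_sub_sq_le S hS l C fun p => by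
    have h1 := hC (lateral_isC11 p).toC11
    rw [hu.Jhat_rect hT ha] at h1
    have h2 : ∫ t in (0 : ℝ)..T, boundaryB ρl ρr (u t (-1)) (u t 1) ((lateral_isC11 p).toC11.val t (-1))
        ((lateral_isC11 p).toC11.val t 1) = 0 := by
      refine (timeIntegral_congr (g := fun _ => 0) hT ?_).trans intervalIntegral.integral_zero
      filter_upwards [ae_mem_time T] with t ht
      have h3 := lateral_vanish p ht
      simp only [IsC11.toC11, h3.1, h3.2]
      simp [boundaryB]
    rw [h2, sub_zero] at h1
    exact h1
  obtain ⟨k', hkm', hk', hke'⟩ := hu.exists_diffusivity_mul_du_eq hT ha hE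
  have hPm : Measurable fun z : ℝ × ℝ =>
      sqrtSigma a u z * k z - diffusivity a (u z.1 z.2) * du z.1 z.2 :=
    (hu.measurable_sqrtSigma.mul hkm).sub (hu.measurable_diffusivity.mul hu.measurable_du')
  refine ⟨fun t x => sqrtSigma a u (t, x) * k (t, x) - diffusivity a (u t x) * du t x,
    memL2SigmaInv_of_eq ha hu hPm (hk.sub hk') ?_, fun p => ?_⟩
  · filter_upwards [hke'] with z hz
    simp only [hz, Pi.sub_apply, mul_sub]
  · have h1 : L0 T u (lateral_isC11 p).toC11
        + ∫ z, diffusivity a (u z.1 z.2) * du z.1 z.2 * lateralGrad T p z ∂rectMeasure T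
        = ∫ z, k z * (sqrtSigma a u z * lateralGrad T p z) ∂rectMeasure T := hkl p
    have i1 : Integrable (fun z => k z * (sqrtSigma a u z * lateralGrad T p z)) (rectMeasure T) :=
      hk.integrable_mul (hS p)
    rw [eq_sub_of_add_eq h1, ← integral_sub i1 (hDp p)]
    congr! 2
    ring

theorem MemL2SigmaInv.memLp (ha : -1 / 2 < a) (hu : IsProfile T π u du) {F : ℝ → ℝ → ℝ}
    (hF : MemL2SigmaInv T a u F) : MemLp (fun z => F z.1 z.2) 2 (rectMeasure T) := by
  exact (memLp_congr_ae (hF.ae_eq_mul_ratio hu)).2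
    (MemLp.top_mul (hu.memLp_sqrtSigma ha) (hF.memLp_ratio ha hu))

theorem isFlux_iff (hT : 0 ≤ T) (ha : -1 / 2 < a) (hu : IsProfile T π u du) :
    IsFlux T a u P ↔ MemL2SigmaInv T a u P ∧ ∀ H ∈ SmoothKT T,
      -∫ z, u z.1 z.2 * partialT H z ∂rectMeasure T
        = ∫ z, partialX H z * P z.1 z.2 ∂rectMeasure T := by
  refine and_congr_right fun hP => forall₂_congr fun H hH => ?_
  have i1 : Integrable (fun z : ℝ × ℝ => u z.1 z.2 * partialT H z) (rectMeasure T) :=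
    Integrable.mul_continuousOn_rect hu.integrable_u (contDiff_partialT hH.1).continuous.continuousOn
  have i2 : Integrable (fun z : ℝ × ℝ => P z.1 z.2 * partialX H z) (rectMeasure T) :=
    Integrable.mul_continuousOn_rect ((hP.memLp ha hu).integrable (by norm_num))
      (contDiff_partialX hH.1).continuous.continuousOn
  simp only [mul_comm (P _ _)] at i2
  rw [← iteratedIntegral_eq hT i1, ← iteratedIntegral_eq hT i2]
  simp only [(hasDerivAt_partialX hH.1 _ _).deriv, (hasDerivAt_partialT hH.1 _ _).deriv]

theorem isFlux_of_lateral (hT : 0 ≤ T) (ha : -1 / 2 < a) (hu : IsProfile T π u du)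
    (hP : MemL2SigmaInv T a u P) (h : ∀ p : lateralSpace T,
      L0 T u (lateral_isC11 p).toC11 = ∫ z, lateralGrad T p z * P z.1 z.2 ∂rectMeasure T) :
    IsFlux T a u P := by
  refine (isFlux_iff hT ha hu).2 ⟨hP, fun H hH => ?_⟩
  have h1 := h ⟨_, SmoothKT.mem_lateralSpace hH⟩
  rw [hu.L0_eq hT] at h1
  have h2 : ∀ x, H (T, x) = 0 := fun x => SmoothKT.eq_zero hH (by simp)
  have h3 : ∀ x, H (0, x) = 0 := fun x => SmoothKT.eq_zero hH (by simp)
  simpa [IsC11.toC11, h2, h3, lateralGrad] using h1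

/-- A flux is only tested against functions with compact support, whereas functions not vanishing at
times `0` and `T` are needed. The flux differs from the one built by Riesz by a function of time,
which is invisible to gradients of functions vanishing at `x = ±1`. -/
theorem IsFlux.lateral {ρl ρr C : ℝ} (hT : 0 ≤ T) (ha : -1 / 2 < a) (hu : IsProfile T π u du)
    (hE : energy T u < ⊤) (hC : ∀ H, Jhat T a ρl ρr u du H ≤ C) (hP : IsFlux T a u P)
    (p : lateralSpace T) :
    L0 T u (lateral_isC11 p).toC11 = ∫ z, lateralGrad T p z * P z.1 z.2 ∂rectMeasure T := by
  obtain ⟨Q, hQ, hQl⟩ := exists_lateral_flux hT ha hu hE hC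
  have hQf := isFlux_of_lateral hT ha hu hQ hQl
  have hPi := (hP.1.memLp ha hu).integrable (by norm_num)
  have hQi := (hQ.memLp ha hu).integrable (by norm_num)
  have hint : ∀ {R : ℝ → ℝ → ℝ}, Integrable (fun z => R z.1 z.2) (rectMeasure T) →
      ∀ {f : ℝ × ℝ → ℝ}, ContinuousOn f (rect T) →
      Integrable (fun z => f z * R z.1 z.2) (rectMeasure T) := fun hR f hf => by
    have := Integrable.mul_continuousOn_rect hR hf
    simpa only [mul_comm] using this
  have hKm : Measurable fun z : ℝ × ℝ => P z.1 z.2 - Q z.1 z.2 := hP.1.1.sub hQ.1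
  obtain ⟨b, -, hb⟩ := exists_eq_time_of_integral_partialX_eq_zero hKm (hPi.sub hQi)
    fun H hH => by
      have hc := (contDiff_partialX hH.1).continuous.continuousOn (s := rect T)
      simp only [mul_sub]
      rw [integral_sub (hint hPi hc) (hint hQi hc), ← ((isFlux_iff hT ha hu).1 hP).2 H hH,
        ← ((isFlux_iff hT ha hu).1 hQf).2 H hH, sub_self]
  rw [hQl p, eq_comm, ← sub_eq_zero, ← integral_sub (hint hPi (continuousOn_lateralGrad p))
    (hint hQi (continuousOn_lateralGrad p))]
  have e : (fun z => lateralGrad T p z * P z.1 z.2 - lateralGrad T p z * Q z.1 z.2)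
      =ᵐ[rectMeasure T] fun z => lateralGrad T p z * b z.1 := by
    filter_upwards [hb] with z hz
    rw [← hz, mul_sub]
  have i : Integrable (fun z => lateralGrad T p z * b z.1) (rectMeasure T) :=
    ((hint hPi (continuousOn_lateralGrad p)).sub (hint hQi (continuousOn_lateralGrad p))).congr e
  refine (integral_congr_ae e).trans ?_
  rw [← iteratedIntegral_eq hT i]
  refine (timeIntegral_congr (g := fun _ => 0) hT ?_).trans intervalIntegral.integral_zero
  filter_upwards [ae_mem_time T] with t ht
  rw [intervalIntegral.integral_mul_const]
  have h1 := (lateral_isC11 p).integral_dx ht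
  rw [(lateral_vanish p ht).1, (lateral_vanish p ht).2, sub_zero] at h1
  exact mul_eq_zero_of_left h1 _

end Flux

/-! ### Time derivatives of the moments -/

section Moments

variable {T a : ℝ} {π : Trajectory T} {u du : ℝ → ℝ → ℝ}

theorem isC11_mul {α α' f f' : ℝ → ℝ} (hα : IsC1On T α α') (hf : ∀ x, HasDerivAt f (f' x) x)
    (hf' : Continuous f') :
    IsC11 T (fun t x => α t * f x) (fun t x => α' t * f x) (fun t x => α t * f' x) := by
  have c1 : ∀ {β : ℝ → ℝ}, ContinuousOn β (Icc 0 T) →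
      ContinuousOn (fun z : ℝ × ℝ => β z.1) (rect T) := fun h =>
    h.comp continuousOn_fst fun z hz => hz.1
  have c2 : ∀ {g : ℝ → ℝ}, Continuous g → ContinuousOn (fun z : ℝ × ℝ => g z.2) (rect T) :=
    fun h => (h.comp continuous_snd).continuousOn
  have hfc : Continuous f := continuous_iff_continuousAt.2 fun x => (hf x).continuousAt
  exact ⟨fun t ht x _ => (hα.1 t ht).mul_const _, fun t _ x _ =>
    ((hf x).const_mul _).hasDerivWithinAt, (c1 hα.continuousOn).mul (c2 hfc),
    (c1 hα.2).mul (c2 hfc), (c1 hα.continuousOn).mul (c2 hf')⟩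

theorem L0_mul {α α' f f' : ℝ → ℝ} (hα : IsC1On T α α') (hf : ∀ x, HasDerivAt f (f' x) x)
    (hf' : Continuous f') :
    L0 T u (isC11_mul hα hf hf').toC11 = timeForm T (moment u f) α α' := by
  simp only [L0, IsC11.toC11, timeForm, moment, mul_left_comm (u _ _),
    intervalIntegral.integral_const_mul]

theorem IsProfile.measurable_boundary (hu : IsProfile T π u du) (x : ℝ) :
    Measurable fun t => u t x :=
  hu.measurable_u.comp (measurable_id.prodMk measurable_const)

theorem integrable_mul_of_bounded (hT : 0 ≤ T) {f m : ℝ → ℝ} {B : ℝ}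
    (hf : ContinuousOn f (Icc 0 T)) (hm : Measurable m) (hB : ∀ t ∈ Icc 0 T, |m t| ≤ B) :
    Integrable (fun t => m t * f t) (timeMeasure T) := by
  have := intervalIntegrable_mul_of_bounded hT hf hm hB
  rw [intervalIntegrable_iff_integrableOn_Ioc_of_le hT] at this
  rw [funext fun t => mul_comm (m t) (f t)]
  exact this

theorem IsProfile.integrable_boundaryB {ρl ρr : ℝ} (hT : 0 ≤ T) (hu : IsProfile T π u du)
    {p q : ℝ → ℝ} (hp : ContinuousOn p (Icc 0 T)) (hq : ContinuousOn q (Icc 0 T)) :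
    Integrable (fun t => boundaryB ρl ρr (u t (-1)) (u t 1) (p t) (q t)) (timeMeasure T) := by
  have hr : ∀ t ∈ Icc 0 T, |u t 1| ≤ 1 ∧ |1 - u t 1| ≤ 1 ∧ |u t (-1)| ≤ 1 ∧ |1 - u t (-1)| ≤ 1 := by
    intro t ht
    have h1 := hu.range_u t ht 1 (by norm_num)
    have h2 := hu.range_u t ht (-1) (by norm_num)
    refine ⟨?_, ?_, ?_, ?_⟩ <;> rw [abs_le] <;> constructor <;> linarith [h1.1, h1.2, h2.1, h2.2]
  have m1 := hu.measurable_boundary 1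
  have m2 := hu.measurable_boundary (-1)
  have i1 := integrable_mul_of_bounded hT ((hq.neg.rexp.sub continuousOn_const).const_mul (1 - ρr))
    m1 (fun t ht => (hr t ht).1) (f := fun t => (1 - ρr) * (Real.exp (-q t) - 1))
  have i2 := integrable_mul_of_bounded hT ((hq.rexp.sub continuousOn_const).const_mul ρr)
    (measurable_const.sub m1) (fun t ht => (hr t ht).2.1) (f := fun t => ρr * (Real.exp (q t) - 1))
  have i3 := integrable_mul_of_bounded hT ((hp.neg.rexp.sub continuousOn_const).const_mul (1 - ρl))
    m2 (fun t ht => (hr t ht).2.2.1) (f := fun t => (1 - ρl) * (Real.exp (-p t) - 1))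
  have i4 := integrable_mul_of_bounded hT ((hp.rexp.sub continuousOn_const).const_mul ρl)
    (measurable_const.sub m2) (fun t ht => (hr t ht).2.2.2)
    (f := fun t => ρl * (Real.exp (p t) - 1))
  refine (((i1.add i2).add i3).add i4).congr (Eventually.of_forall fun t => ?_)
  simp only [boundaryB, Pi.add_apply, Pi.sub_apply]
  ring

/-- Each of the four exponential terms carries a coefficient in `[0, 1]`; this is the origin of the
constant `4` in `orliczBound`. -/
theorem boundaryB_le {ρl ρr r s p q y : ℝ} (hl : ρl ∈ Icc (0 : ℝ) 1) (hr : ρr ∈ Icc (0 : ℝ) 1)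
    (h1 : r ∈ Icc (0 : ℝ) 1) (h2 : s ∈ Icc (0 : ℝ) 1) (hp : |p| ≤ y) (hq : |q| ≤ y) :
    boundaryB ρl ρr r s p q ≤ 4 * (Real.exp y - 1) := by
  have hy : 0 ≤ Real.exp y - 1 := by
    have := Real.one_le_exp ((abs_nonneg p).trans hp)
    linarith
  have key : ∀ c x : ℝ, 0 ≤ c → c ≤ 1 → x ≤ y → c * (Real.exp x - 1) ≤ Real.exp y - 1 := by
    intro c x c0 c1 hx
    have := Real.exp_le_exp.2 hx
    calc c * (Real.exp x - 1) ≤ c * (Real.exp y - 1) := by gcongr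
      _ ≤ 1 * (Real.exp y - 1) := by gcongr
      _ = _ := one_mul _
  have k1 := key (s * (1 - ρr)) (-q) (mul_nonneg h2.1 (by linarith [hr.2]))
    (by nlinarith [h2.1, h2.2, hr.1, hr.2]) ((neg_le_abs q).trans hq)
  have k2 := key (ρr * (1 - s)) q (mul_nonneg hr.1 (by linarith [h2.2]))
    (by nlinarith [h2.1, h2.2, hr.1, hr.2]) ((le_abs_self q).trans hq)
  have k3 := key (r * (1 - ρl)) (-p) (mul_nonneg h1.1 (by linarith [hl.2]))
    (by nlinarith [h1.1, h1.2, hl.1, hl.2]) ((neg_le_abs p).trans hp)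
  have k4 := key (ρl * (1 - r)) p (mul_nonneg hl.1 (by linarith [h1.2]))
    (by nlinarith [h1.1, h1.2, hl.1, hl.2]) ((le_abs_self p).trans hp)
  unfold boundaryB
  linarith

/-- The moments of affine functions have a time derivative in `L¹`. -/
theorem exists_moment_density {ρl ρr C : ℝ} (hT : 0 < T) (ha : -1 / 2 < a)
    (hl : ρl ∈ Icc (0 : ℝ) 1) (hr : ρr ∈ Icc (0 : ℝ) 1) (hu : IsProfile T π u du)
    (hC : ∀ H, Jhat T a ρl ρr u du H ≤ C) {f : ℝ → ℝ} {κ : ℝ} (hκ : |κ| ≤ 1)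
    (hf : ∀ x, HasDerivAt f κ x) (hf1 : ∀ x ∈ Icc (-1 : ℝ) 1, |f x| ≤ 1) :
    ∃ p : ℝ → ℝ, IntervalIntegrable p volume 0 T ∧ ∀ α α', IsC1On T α α' →
      timeForm T (moment u f) α α' = ∫ t in (0 : ℝ)..T, α t * p t := by
  have hfc : Continuous f := continuous_iff_continuousAt.2 fun x => (hf x).continuousAt
  have hDi : Integrable (fun z => diffusivity a (u z.1 z.2) * du z.1 z.2) (rectMeasure T) :=
    (hu.memLp_diffusivity_mul_du ha).integrable (by norm_num)
  set k : ℝ → ℝ := fun t => |∫ x, diffusivity a (u t x) * du t x ∂spaceMeasure| with hk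
  have hki : Integrable k (timeMeasure T) := hDi.integral_prod_left.abs
  -- The bound `1 + 2 * |a|` on `σ` times the length `2` of the interval.
  set c : ℝ := 2 * (1 + 2 * |a|) with hc
  have hc0 : 0 ≤ c := by positivity
  refine exists_density_of_timeForm_le (k := k) (c := c) (C := C) hT
    (hu.measurable_moment hfc.measurable)
    (fun t ht => hu.abs_moment_le hf1 ht) (fun t ht => hu.continuousWithinAt_moment hT.le hfc ht)
    hki (fun t => abs_nonneg _) hc0 fun α α' hα => ?_
  -- The test function is `α(t) f(x)` with `f` affine of slope `κ`: `L0` becomes the form `timeForm`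
  -- of the moment, and the other three terms match the three terms of `orliczBound`.
  have h1 := hC (isC11_mul hα hf continuous_const).toC11
  rw [hu.Jhat_rect hT.le ha, L0_mul hα hf continuous_const] at h1
  have hαc := hα.continuousOn
  have j1 : Integrable (fun t => k t * |α t|) (timeMeasure T) := by
    have : IntervalIntegrable k volume 0 T :=
      (intervalIntegrable_iff_integrableOn_Ioc_of_le hT.le).2 hki
    exact (intervalIntegrable_iff_integrableOn_Ioc_of_le hT.le).1
      (this.mul_continuousOn (by rw [uIcc_of_le hT.le]; exact hαc.abs))
  have hcont : ∀ {g : ℝ → ℝ}, ContinuousOn g (Icc 0 T) → Integrable g (timeMeasure T) := fun hg =>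
    (hg.integrableOn_Icc).mono_set Ioc_subset_Icc_self
  have j2 : Integrable (fun t => c * α t ^ 2) (timeMeasure T) := hcont ((hαc.pow 2).const_mul c)
  have j3 : Integrable (fun t => 4 * (Real.exp |α t| - 1)) (timeMeasure T) :=
    hcont ((hαc.abs.rexp.sub continuousOn_const).const_mul 4)
  have b1 : -∫ z, diffusivity a (u z.1 z.2) * du z.1 z.2 * (α z.1 * κ) ∂rectMeasure T
      ≤ ∫ t, k t * |α t| ∂timeMeasure T := by
    have i1 := Integrable.mul_continuousOn_rect hDi
      (isC11_mul hα hf continuous_const).continuous_dx'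
    rw [integral_prod _ i1, ← integral_neg]
    refine integral_mono i1.integral_prod_left.neg j1 fun t => ?_
    simp only [integral_mul_const]
    refine (neg_le_abs _).trans ?_
    rw [abs_mul, abs_mul]
    refine mul_le_mul_of_nonneg_left ?_ (abs_nonneg _)
    nlinarith [abs_nonneg (α t)]
  have b2 : ∫ z, (sqrtSigma a u z * (α z.1 * κ)) ^ 2 ∂rectMeasure T
      ≤ ∫ t, c * α t ^ 2 ∂timeMeasure T := by
    have i2 : Integrable (fun z => (sqrtSigma a u z * (α z.1 * κ)) ^ 2) (rectMeasure T) :=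
      (MemLp.top_mul (hu.memLp_sqrtSigma ha) ((memLp_top_of_continuousOn_rect
        (isC11_mul hα hf continuous_const).continuous_dx').mono_exponent le_top)).integrable_sq
    have i3 : Integrable (fun z : ℝ × ℝ => (1 + 2 * |a|) * α z.1 ^ 2) (rectMeasure T) :=
      ((hcont (hαc.pow 2)).const_mul _).comp_fst _
    have e : ∫ z : ℝ × ℝ, (1 + 2 * |a|) * α z.1 ^ 2 ∂rectMeasure T
        = ∫ t, c * α t ^ 2 ∂timeMeasure T := by
      rw [integral_prod _ i3]
      refine integral_congr_ae (Eventually.of_forall fun t => ?_)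
      simp only [integral_const, hc, smul_eq_mul]
      simp [Measure.real]
      norm_num
      ring
    rw [← e]
    refine integral_mono_ae i2 i3 ?_
    filter_upwards [hu.sqrtSigma_sq ha, hu.ae_range] with z hz hz'
    rw [mul_pow, hz, mul_pow]
    have h3 : κ ^ 2 ≤ 1 := by rw [← sq_abs]; exact pow_le_one₀ (abs_nonneg _) hκ
    have h4 := sigma_le ha hz'
    have h5 := sigma_nonneg ha hz'
    calc sigma a (u z.1 z.2) * (α z.1 ^ 2 * κ ^ 2) ≤ (1 + 2 * |a|) * (α z.1 ^ 2 * 1) := by gcongr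
      _ = _ := by ring
  have b3 : ∫ t in (0 : ℝ)..T, boundaryB ρl ρr (u t (-1)) (u t 1) (α t * f (-1)) (α t * f 1)
      ≤ ∫ t, 4 * (Real.exp |α t| - 1) ∂timeMeasure T := by
    rw [timeIntegral_eq hT.le]
    refine integral_mono_ae (hu.integrable_boundaryB hT.le (hαc.mul continuousOn_const)
      (hαc.mul continuousOn_const)) j3 ?_
    filter_upwards [ae_mem_time T] with t ht
    refine boundaryB_le hl hr (hu.range_u t ht _ (by norm_num)) (hu.range_u t ht _ (by norm_num))
      ?_ ?_ <;> rw [abs_mul] <;> refine mul_le_of_le_one_right (abs_nonneg _) (hf1 _ (by norm_num))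
  have e : ∫ t in (0 : ℝ)..T, orliczBound k c t (α t) = (∫ t, k t * |α t| ∂timeMeasure T)
      + (∫ t, c * α t ^ 2 ∂timeMeasure T) + ∫ t, 4 * (Real.exp |α t| - 1) ∂timeMeasure T := by
    rw [timeIntegral_eq hT.le, ← integral_add j1 j2]
    exact integral_add (j1.add j2) j3
  rw [e]
  simp only [IsC11.toC11] at h1
  linarith

theorem timeForm_of_mem_C10 {m α : ℝ → ℝ} (hα : α ∈ C10 T) :
    timeForm T m α (derivWithin α (Icc 0 T))
      = -∫ t in (0 : ℝ)..T, derivWithin α (Icc 0 T) t * m t := by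
  rw [timeForm, hα.2.1, hα.2.2]
  ring

theorem isTimeDerivative_of_timeForm {f p : ℝ → ℝ} (hT : 0 < T) (hp : IntervalIntegrable p volume 0 T)
    (h : ∀ α α', IsC1On T α α' → timeForm T (moment u f) α α' = ∫ t in (0 : ℝ)..T, α t * p t) :
    IsTimeDerivative T u f p :=
  ⟨hp, fun _ hα => (timeForm_of_mem_C10 hα).symm.trans (h _ _ (isC1On_of_contDiffOn hT hα.1))⟩

theorem IsTimeDerivative.ae_eq {f p q : ℝ → ℝ} (hT : 0 ≤ T) (hp : IsTimeDerivative T u f p)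
    (hq : IsTimeDerivative T u f q) : p =ᵐ[timeMeasure T] q := by
  have ip := (intervalIntegrable_iff_integrableOn_Ioc_of_le hT).1 hp.1
  have iq := (intervalIntegrable_iff_integrableOn_Ioc_of_le hT).1 hq.1
  have : ∀ᵐ t ∂timeMeasure T, p t - q t = 0 := by
    refine ae_eq_zero_of_integral_smooth (ip.sub iq) fun θ t1 t2 t3 => ?_
    have hθ : θ ∈ C10 T := ⟨(t1.of_le (by simp)).contDiffOn,
      image_eq_zero_of_notMem_tsupport fun h => lt_irrefl _ (t3 h).1,
      image_eq_zero_of_notMem_tsupport fun h => lt_irrefl _ (t3 h).2⟩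
    have h1 := (hp.2 θ hθ).symm.trans (hq.2 θ hθ)
    rw [timeIntegral_eq hT, timeIntegral_eq hT] at h1
    obtain ⟨C, hC⟩ := exists_bound_of_hasCompactSupport t1.continuous t2
    simp only [mul_sub]
    rw [integral_sub (ip.bdd_mul t1.continuous.aestronglyMeasurable (Eventually.of_forall hC))
      (iq.bdd_mul t1.continuous.aestronglyMeasurable (Eventually.of_forall hC)), h1, sub_self]
  filter_upwards [this] with t ht
  linarith

/-- The definition only tests `α` vanishing at both end times. By uniqueness such a density agrees
with the one constructed above, which is valid for every `α`. -/
theorem IsTimeDerivative.timeForm_eq {ρl ρr C : ℝ} (hT : 0 < T) (ha : -1 / 2 < a)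
    (hl : ρl ∈ Icc (0 : ℝ) 1) (hr : ρr ∈ Icc (0 : ℝ) 1) (hu : IsProfile T π u du)
    (hC : ∀ H, Jhat T a ρl ρr u du H ≤ C) {f : ℝ → ℝ} {κ : ℝ} (hκ : |κ| ≤ 1)
    (hf : ∀ x, HasDerivAt f κ x) (hf1 : ∀ x ∈ Icc (-1 : ℝ) 1, |f x| ≤ 1) {p : ℝ → ℝ}
    (hp : IsTimeDerivative T u f p) {α α' : ℝ → ℝ} (hα : IsC1On T α α') :
    timeForm T (moment u f) α α' = ∫ t in (0 : ℝ)..T, α t * p t := by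
  obtain ⟨q, hq, hqf⟩ := exists_moment_density hT ha hl hr hu hC hκ hf hf1
  rw [hqf α α' hα]
  refine timeIntegral_congr hT.le ?_
  filter_upwards [hp.ae_eq hT.le (isTimeDerivative_of_timeForm hT hq hqf)] with t ht
  rw [ht]

end Moments

/-! ### Completing the square at a fixed time -/

/-- `S` is the inverse of `∫ s⁻²`, with the convention `1 / ∞ = 0`. -/
def IsHarmonicMean {α : Type*} [MeasurableSpace α] (μ : Measure α) (s : α → ℝ) (S : ℝ) : Prop :=
  S = 0 ∨ 0 < S ∧ (∀ᵐ x ∂μ, s x ≠ 0) ∧ MemLp (fun x => (s x)⁻¹) 2 μ ∧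
    ∫ x, ((s x)⁻¹) ^ 2 ∂μ = S⁻¹

/-- Write `b = ∫ k / s` and `c = ∫ w`. If `S > 0`, then `1/s` is in `L²`, has squared norm `1/S`,
and pairs with `s w` to `c`. The coefficient `ν = (b/2 - c) S` makes `k/2 - ν/s - s w` orthogonal to
`1/s`, so by Pythagoras `‖k/2 - s w‖² = (b/2 - c)² S` plus the square of that remainder. If `S = 0`,
this is the plain expansion of a square. -/
theorem IsHarmonicMean.complete_square {α : Type*} [MeasurableSpace α] {μ : Measure α}
    {s k w : α → ℝ} {S : ℝ} (hS : IsHarmonicMean μ s S) (hk : MemLp k 2 μ)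
    (hsw : MemLp (fun x => s x * w x) 2 μ) (hw : Integrable w μ) :
    ∫ x, k x * (s x * w x) ∂μ - ∫ x, (s x * w x) ^ 2 ∂μ
      = 1 / 4 * (∫ x, k x ^ 2 ∂μ - (∫ x, k x / s x ∂μ) ^ 2 * S)
        + ((∫ x, w x ∂μ) * (∫ x, k x / s x ∂μ) * S - (∫ x, w x ∂μ) ^ 2 * S)
        - ∫ x, (k x / 2 - ((∫ x, k x / s x ∂μ) / 2 - ∫ x, w x ∂μ) * S / s x - s x * w x) ^ 2 ∂μ := by
  set b := ∫ x, k x / s x ∂μ with hb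
  set c := ∫ x, w x ∂μ with hc
  have i1 := hk.integrable_sq
  have i2 := hsw.integrable_sq
  have i3 : Integrable (fun x => k x * (s x * w x)) μ := hk.integrable_mul hsw
  have i4 : Integrable (fun x => 1 / 4 * k x ^ 2 - k x * (s x * w x)) μ := (i1.const_mul _).sub i3
  have i5 : Integrable (fun x => 1 / 4 * k x ^ 2 - k x * (s x * w x) + (s x * w x) ^ 2) μ :=
    i4.add i2
  have base : ∫ x, (1 / 4 * k x ^ 2 - k x * (s x * w x) + (s x * w x) ^ 2) ∂μ
      = 1 / 4 * ∫ x, k x ^ 2 ∂μ - ∫ x, k x * (s x * w x) ∂μ + ∫ x, (s x * w x) ^ 2 ∂μ := by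
    rw [integral_add i4 i2, integral_sub (i1.const_mul _) i3, integral_const_mul]
  rcases hS with h0 | ⟨hpos, hne, hr, hrS⟩
  · have e : ∀ x, (k x / 2 - (b / 2 - c) * S / s x - s x * w x) ^ 2
        = 1 / 4 * k x ^ 2 - k x * (s x * w x) + (s x * w x) ^ 2 := fun x => by
      rw [h0]; ring
    rw [integral_congr_ae (Eventually.of_forall e), base, h0]
    ring
  · set ν := (b / 2 - c) * S with hν
    have j1 : Integrable (fun x => k x / s x) μ := hk.integrable_mul hr
    have j2 := hr.integrable_sq
    have j3 : Integrable (fun x => ν * (k x / s x) - 2 * ν * w x) μ :=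
      (j1.const_mul _).sub (hw.const_mul _)
    have j4 : Integrable (fun x => ν ^ 2 * ((s x)⁻¹) ^ 2 - (ν * (k x / s x) - 2 * ν * w x)) μ :=
      (j2.const_mul _).sub j3
    have e : (fun x => (k x / 2 - ν / s x - s x * w x) ^ 2) =ᵐ[μ] fun x =>
        (1 / 4 * k x ^ 2 - k x * (s x * w x) + (s x * w x) ^ 2)
          + (ν ^ 2 * ((s x)⁻¹) ^ 2 - (ν * (k x / s x) - 2 * ν * w x)) := by
      filter_upwards [hne] with x hx
      field_simp
      ring
    rw [integral_congr_ae e, integral_add i5 j4, base, integral_sub (j2.const_mul _) j3,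
      integral_sub (j1.const_mul _) (hw.const_mul _), integral_const_mul, integral_const_mul,
      integral_const_mul, hrS, ← hb, ← hc, hν]
    field_simp
    ring

/-- A Cauchy–Schwarz inequality, obtained from the completed square at `w = 0`. -/
theorem IsHarmonicMean.sq_integral_div_mul_le {α : Type*} [MeasurableSpace α] {μ : Measure α}
    {s k : α → ℝ} {S : ℝ} (hS : IsHarmonicMean μ s S) (hk : MemLp k 2 μ) :
    (∫ x, k x / s x ∂μ) ^ 2 * S ≤ ∫ x, k x ^ 2 ∂μ := by
  have h := hS.complete_square hk (w := fun _ => 0) (by simp) (integrable_zero _ _ _)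
  have h1 : 0 ≤ ∫ x, (k x / 2 - ((∫ x, k x / s x ∂μ) / 2 - ∫ x, (0 : ℝ) ∂μ) * S / s x
      - s x * 0) ^ 2 ∂μ := integral_nonneg fun x => sq_nonneg _
  simp only [mul_zero, integral_zero, sub_zero, zero_pow two_ne_zero, zero_mul, add_zero] at h h1
  linarith

/-! ### The harmonic mean of `σ(u_t)` and the slices at fixed time -/

section Slices

variable {T a : ℝ} {π : Trajectory T} {u du F : ℝ → ℝ → ℝ}

theorem IsProfile.measurable_calS (hu : IsProfile T π u du) : Measurable (calS a u) := by
  have h1 : Measurable fun z : ℝ × ℝ => (ENNReal.ofReal (sigma a (u z.1 z.2)))⁻¹ :=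
    hu.measurable_sigma.ennreal_ofReal.inv
  have h2 : Measurable fun t => ∫⁻ x in Icc (-1 : ℝ) 1, (ENNReal.ofReal (sigma a (u t x)))⁻¹ :=
    h1.lintegral_prod_right'
  exact h2.inv.ennreal_toReal

theorem calS_nonneg (t : ℝ) : 0 ≤ calS a u t := ENNReal.toReal_nonneg

theorem IsProfile.calS_le (ha : -1 / 2 < a) (hu : IsProfile T π u du) {t : ℝ} (ht : t ∈ Icc 0 T) :
    calS a u t ≤ 1 + 2 * |a| := by
  refine ENNReal.toReal_le_of_le_ofReal (by positivity) ?_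
  rw [ENNReal.inv_le_iff_inv_le]
  have h1 : ∫⁻ _ in Icc (-1 : ℝ) 1, (ENNReal.ofReal (1 + 2 * |a|))⁻¹
      ≤ ∫⁻ x in Icc (-1 : ℝ) 1, (ENNReal.ofReal (sigma a (u t x)))⁻¹ :=
    setLIntegral_mono' measurableSet_Icc fun x hx =>
      ENNReal.inv_le_inv.2 (ENNReal.ofReal_le_ofReal (sigma_le ha (hu.range_u t ht x hx)))
  refine le_trans ?_ h1
  rw [setLIntegral_const, Real.volume_Icc]
  refine le_mul_of_one_le_right (by positivity) ?_
  rw [ENNReal.one_le_ofReal]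
  norm_num

theorem IsProfile.sqrtSigma_sq_slice (ha : -1 / 2 < a) (hu : IsProfile T π u du) {t : ℝ}
    (ht : t ∈ Icc 0 T) {x : ℝ} (hx : x ∈ Icc (-1 : ℝ) 1) :
    sqrtSigma a u (t, x) ^ 2 = sigma a (u t x) :=
  Real.sq_sqrt (sigma_nonneg ha (hu.range_u t ht x hx))

/-- If `S_t ≠ 0` then `∫ σ⁻¹` is finite, so `σ > 0` almost everywhere and the extended inverse is
the real one. -/
theorem IsProfile.isHarmonicMean (ha : -1 / 2 < a) (hu : IsProfile T π u du) {t : ℝ}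
    (ht : t ∈ Icc 0 T) :
    IsHarmonicMean spaceMeasure (fun x => sqrtSigma a u (t, x)) (calS a u t) := by
  rw [IsHarmonicMean, or_iff_not_imp_left]
  intro h0
  have hsm : Measurable fun x => sqrtSigma a u (t, x) :=
    hu.measurable_sqrtSigma.comp measurable_prodMk_left
  have hσm : Measurable fun x => (ENNReal.ofReal (sigma a (u t x)))⁻¹ :=
    (hu.measurable_sigma.comp measurable_prodMk_left).ennreal_ofReal.inv
  set I := ∫⁻ x, (ENNReal.ofReal (sigma a (u t x)))⁻¹ ∂spaceMeasure with hI
  have hcal : calS a u t = I⁻¹.toReal := by rw [calS, restrict_Icc_eq_spaceMeasure]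
  have hItop : I ≠ ⊤ := fun h => h0 (by rw [hcal, h]; simp)
  have hσ : ∀ᵐ x ∂spaceMeasure, 0 < sigma a (u t x) := by
    filter_upwards [ae_lt_top hσm hItop] with x hx
    by_contra! h
    rw [ENNReal.ofReal_eq_zero.2 h, ENNReal.inv_zero] at hx
    exact lt_irrefl _ hx
  have e : ∀ᵐ x ∂spaceMeasure, (ENNReal.ofReal (sigma a (u t x)))⁻¹
      = ENNReal.ofReal ((sqrtSigma a u (t, x))⁻¹ ^ 2) := by
    filter_upwards [hσ, ae_mem_space] with x hx hx'
    rw [inv_pow, hu.sqrtSigma_sq_slice ha ht hx', ENNReal.ofReal_inv_of_pos hx]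
  have hnn : ∀ x, 0 ≤ (sqrtSigma a u (t, x))⁻¹ ^ 2 := fun x => sq_nonneg _
  have hint : Integrable (fun x => (sqrtSigma a u (t, x))⁻¹ ^ 2) spaceMeasure := by
    refine integrable_of_lintegral_ofReal (hsm.inv.pow_const 2).aestronglyMeasurable
      (Eventually.of_forall hnn) ?_
    rw [← lintegral_congr_ae e]
    exact lt_top_iff_ne_top.2 hItop
  refine ⟨lt_of_le_of_ne (calS_nonneg t) (Ne.symm h0), ?_, ?_, ?_⟩
  · filter_upwards [hσ] with x hx
    exact (Real.sqrt_pos.2 hx).ne'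
  · exact (memLp_two_iff_integrable_sq hsm.inv.aestronglyMeasurable).2 hint
  · rw [integral_eq_lintegral_of_nonneg_ae (Eventually.of_forall hnn) hint.aestronglyMeasurable,
      ← lintegral_congr_ae e, hcal, ENNReal.toReal_inv, inv_inv]

/-- `⟨F_t σ(u_t)⁻¹⟩`. -/
theorem IsProfile.integral_ratio_div (ha : -1 / 2 < a) (hu : IsProfile T π u du) {t : ℝ}
    (ht : t ∈ Icc 0 T) :
    ∫ x in (-1 : ℝ)..1, F t x / sigma a (u t x)
      = ∫ x, ratio a u F (t, x) / sqrtSigma a u (t, x) ∂spaceMeasure := by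
  rw [spaceIntegral_eq]
  refine integral_congr_ae ?_
  filter_upwards [ae_mem_space] with x hx
  rw [← hu.sqrtSigma_sq_slice ha ht hx, ratio, div_div, pow_two]

theorem IsProfile.integral_ratio_sq (ha : -1 / 2 < a) (hu : IsProfile T π u du) {t : ℝ}
    (ht : t ∈ Icc 0 T) :
    ∫ x in (-1 : ℝ)..1, F t x ^ 2 / sigma a (u t x)
      = ∫ x, ratio a u F (t, x) ^ 2 ∂spaceMeasure := by
  rw [spaceIntegral_eq]
  refine integral_congr_ae ?_
  filter_upwards [ae_mem_space] with x hx
  rw [← hu.sqrtSigma_sq_slice ha ht hx, ratio, div_pow]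

theorem memLp_slice {f : ℝ × ℝ → ℝ} (hfm : Measurable f) (hf : MemLp f 2 (rectMeasure T)) :
    ∀ᵐ t ∂timeMeasure T, MemLp (fun x => f (t, x)) 2 spaceMeasure := by
  filter_upwards [hf.integrable_sq.prod_right_ae] with t ht
  exact (memLp_two_iff_integrable_sq (hfm.comp measurable_prodMk_left).aestronglyMeasurable).2 ht

end Slices

/-! ### The rate functional as a square -/

/-- A profile of finite energy and finite rate, with its flux and the time derivatives of its
first two moments. -/
structure FluxSetting (T a ρl ρr : ℝ) (π : Trajectory T) (u du P : ℝ → ℝ → ℝ) (P1 PX : ℝ → ℝ) :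
    Prop where
  time_pos : 0 < T
  lt_a : -1 / 2 < a
  left_mem : ρl ∈ Icc (0 : ℝ) 1
  right_mem : ρr ∈ Icc (0 : ℝ) 1
  profile : IsProfile T π u du
  energy_lt : energy T u < ⊤
  bounded : ∃ C, ∀ H, Jhat T a ρl ρr u du H ≤ C
  flux : IsFlux T a u P
  deriv_one : IsTimeDerivative T u (fun _ => 1) P1
  deriv_X : IsTimeDerivative T u (fun x => x) PX

/-- The functional of the boundary values in `I^{(2)}`. -/
def boundaryAction (T a ρl ρr : ℝ) (u du P : ℝ → ℝ → ℝ) (P1 PX α β : ℝ → ℝ) : ℝ :=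
  ∫ t in (0 : ℝ)..T, (α t * gFun a ρl u du P P1 PX t + β t * hFun a ρr u du P P1 PX t
    - Upsilon a ρl ρr u t (u t (-1)) (u t 1) (α t) (β t))

/-- The component of `M / (2 √σ)` that is not a gradient, when the jump of the boundary values
is `c`. -/
def nonGradient (a : ℝ) (u du P : ℝ → ℝ → ℝ) (c : ℝ → ℝ) (z : ℝ × ℝ) : ℝ :=
  (meanMSigmaInv a u du P z.1 / 2 - c z.1) * calS a u z.1 / sqrtSigma a u z

theorem IsC11.isC1On_trace {T : ℝ} {v dt dx : ℝ → ℝ → ℝ} (h : IsC11 T v dt dx) {x : ℝ}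
    (hx : x ∈ Icc (-1 : ℝ) 1) : IsC1On T (fun t => v t x) (fun t => dt t x) :=
  ⟨fun t ht => h.hasDeriv_dt t ht x hx,
    h.continuous_dt.comp (continuousOn_id.prodMk continuousOn_const) fun _ ht => ⟨ht, hx⟩⟩

theorem IsC1On.add {T : ℝ} {α α' β β' : ℝ → ℝ} (h : IsC1On T α α') (k : IsC1On T β β') :
    IsC1On T (fun t => α t + β t) (fun t => α' t + β' t) :=
  ⟨fun t ht => (h.1 t ht).add (k.1 t ht), h.2.add k.2⟩

theorem IsC1On.sub {T : ℝ} {α α' β β' : ℝ → ℝ} (h : IsC1On T α α') (k : IsC1On T β β') :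
    IsC1On T (fun t => α t - β t) (fun t => α' t - β' t) :=
  ⟨fun t ht => (h.1 t ht).sub (k.1 t ht), h.2.sub k.2⟩

theorem IsC1On.div_const {T : ℝ} {α α' : ℝ → ℝ} (h : IsC1On T α α') (c : ℝ) :
    IsC1On T (fun t => α t / c) (fun t => α' t / c) :=
  ⟨fun t ht => (h.1 t ht).div_const c, h.2.div_const c⟩

/-- The affine interpolation of two boundary values. -/
theorem isC11_interpolation {T : ℝ} {p p' q q' : ℝ → ℝ} (hp : IsC1On T p p') (hq : IsC1On T q q') :
    IsC11 T ((fun t _ => (p t + q t) / 2 * 1) + fun t x => (q t - p t) / 2 * x)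
      ((fun t _ => (p' t + q' t) / 2 * 1) + fun t x => (q' t - p' t) / 2 * x)
      ((fun t _ => (p t + q t) / 2 * 0) + fun t _ => (q t - p t) / 2 * 1) :=
  (isC11_mul ((hp.add hq).div_const 2) (fun _ => hasDerivAt_const _ 1) continuous_const).add
    (isC11_mul ((hq.sub hp).div_const 2) hasDerivAt_id' continuous_const)

theorem integrable_of_continuousOn_time {T : ℝ} {g : ℝ → ℝ} (hg : ContinuousOn g (Icc 0 T)) :
    Integrable g (timeMeasure T) :=
  hg.integrableOn_Icc.mono_set Ioc_subset_Icc_self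

theorem integrable_mul_of_continuousOn_time {T : ℝ} {f g : ℝ → ℝ}
    (hf : ContinuousOn f (Icc 0 T)) (hg : Integrable g (timeMeasure T)) :
    Integrable (fun t => f t * g t) (timeMeasure T) := by
  obtain ⟨C, hC⟩ := isCompact_Icc.exists_bound_of_continuousOn hf
  exact hg.bdd_mul (integrable_of_continuousOn_time hf).aestronglyMeasurable
    ((ae_mem_time T).mono fun t ht => hC t ht)

/-! ### Integrability of the ingredients and the formula for the linear part -/

section Setting

variable {T a ρl ρr : ℝ} {π : Trajectory T} {u du P : ℝ → ℝ → ℝ} {P1 PX : ℝ → ℝ}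

theorem FluxSetting.memL2_fluxM (h : FluxSetting T a ρl ρr π u du P P1 PX) :
    MemL2SigmaInv T a u (fluxM a u du P) := by
  have hu := h.profile
  obtain ⟨k, -, hk, hke⟩ := hu.exists_diffusivity_mul_du_eq h.time_pos.le h.lt_a h.energy_lt
  have hm : Measurable fun z : ℝ × ℝ => P z.1 z.2 + diffusivity a (u z.1 z.2) * du z.1 z.2 :=
    Measurable.add h.flux.1.1 (hu.measurable_diffusivity.mul hu.measurable_du')
  refine memL2SigmaInv_of_eq h.lt_a hu hm ((h.flux.1.memLp_ratio h.lt_a hu).add hk) ?_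
  filter_upwards [hke, h.flux.1.ae_eq_mul_ratio hu] with z h1 h2
  rw [fluxM, h1, h2, Pi.add_apply, mul_add]

theorem FluxSetting.memLp_ratio (h : FluxSetting T a ρl ρr π u du P P1 PX) :
    MemLp (ratio a u (fluxM a u du P)) 2 (rectMeasure T) :=
  h.memL2_fluxM.memLp_ratio h.lt_a h.profile

theorem FluxSetting.memLp_ratio_slice (h : FluxSetting T a ρl ρr π u du P P1 PX) :
    ∀ᵐ t ∂timeMeasure T, MemLp (fun x => ratio a u (fluxM a u du P) (t, x)) 2 spaceMeasure :=
  memLp_slice (h.memL2_fluxM.measurable_ratio h.profile) h.memLp_ratio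

theorem FluxSetting.measurable_mean (h : FluxSetting T a ρl ρr π u du P P1 PX) :
    Measurable (meanMSigmaInv a u du P) := by
  have h1 : Measurable fun z : ℝ × ℝ => fluxM a u du P z.1 z.2 / sigma a (u z.1 z.2) :=
    Measurable.div h.memL2_fluxM.1 h.profile.measurable_sigma
  unfold meanMSigmaInv
  simp only [spaceIntegral_eq]
  exact h1.stronglyMeasurable.integral_prod_right'.measurable

theorem FluxSetting.integrable_sq_ratio (h : FluxSetting T a ρl ρr π u du P P1 PX) :
    Integrable (fun t => ∫ x, ratio a u (fluxM a u du P) (t, x) ^ 2 ∂spaceMeasure)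
      (timeMeasure T) :=
  h.memLp_ratio.integrable_sq.integral_prod_left

theorem FluxSetting.mean_eq (h : FluxSetting T a ρl ρr π u du P P1 PX) {t : ℝ} (ht : t ∈ Icc 0 T) :
    meanMSigmaInv a u du P t
      = ∫ x, ratio a u (fluxM a u du P) (t, x) / sqrtSigma a u (t, x) ∂spaceMeasure :=
  h.profile.integral_ratio_div h.lt_a ht

theorem FluxSetting.bulk_eq (h : FluxSetting T a ρl ρr π u du P P1 PX) {t : ℝ} (ht : t ∈ Icc 0 T) :
    bulkIntegrand a u du P t = ∫ x, ratio a u (fluxM a u du P) (t, x) ^ 2 ∂spaceMeasure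
      - meanMSigmaInv a u du P t ^ 2 * calS a u t := by
  rw [bulkIntegrand, h.profile.integral_ratio_sq h.lt_a ht]

theorem FluxSetting.mean_sq_mul_le (h : FluxSetting T a ρl ρr π u du P P1 PX) :
    ∀ᵐ t ∂timeMeasure T, meanMSigmaInv a u du P t ^ 2 * calS a u t
      ≤ ∫ x, ratio a u (fluxM a u du P) (t, x) ^ 2 ∂spaceMeasure := by
  filter_upwards [h.memLp_ratio_slice, ae_mem_time T] with t hk ht
  rw [h.mean_eq ht]
  exact (h.profile.isHarmonicMean h.lt_a ht).sq_integral_div_mul_le hk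

/-- The Cauchy–Schwarz bound dominates the subtracted term by the other one, so the integrand of
`I1` is a difference of integrable functions. -/
theorem FluxSetting.integrable_mean_sq_mul (h : FluxSetting T a ρl ρr π u du P P1 PX) :
    Integrable (fun t => meanMSigmaInv a u du P t ^ 2 * calS a u t) (timeMeasure T) := by
  refine h.integrable_sq_ratio.mono'
    ((h.measurable_mean.pow_const 2).mul h.profile.measurable_calS).aestronglyMeasurable ?_
  filter_upwards [h.mean_sq_mul_le] with t ht
  rwa [Real.norm_of_nonneg (mul_nonneg (sq_nonneg _) (calS_nonneg t))]

theorem FluxSetting.integrable_calS (h : FluxSetting T a ρl ρr π u du P P1 PX) :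
    Integrable (calS a u) (timeMeasure T) := by
  refine Integrable.of_bound (C := 1 + 2 * |a|) h.profile.measurable_calS.aestronglyMeasurable ?_
  filter_upwards [ae_mem_time T] with t ht
  rw [Real.norm_of_nonneg (calS_nonneg t)]
  exact h.profile.calS_le h.lt_a ht

theorem FluxSetting.integrable_mean_mul (h : FluxSetting T a ρl ρr π u du P P1 PX) :
    Integrable (fun t => meanMSigmaInv a u du P t * calS a u t) (timeMeasure T) := by
  refine (h.integrable_mean_sq_mul.add h.integrable_calS).mono'
    (h.measurable_mean.mul h.profile.measurable_calS).aestronglyMeasurable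
    (Eventually.of_forall fun t => ?_)
  rw [Real.norm_eq_abs, abs_mul, abs_of_nonneg (calS_nonneg t), Pi.add_apply]
  have h1 : |meanMSigmaInv a u du P t| ≤ meanMSigmaInv a u du P t ^ 2 + 1 := by
    rw [← sq_abs]
    nlinarith [sq_nonneg (|meanMSigmaInv a u du P t| - 1), abs_nonneg (meanMSigmaInv a u du P t)]
  calc _ ≤ (meanMSigmaInv a u du P t ^ 2 + 1) * calS a u t :=
        mul_le_mul_of_nonneg_right h1 (calS_nonneg t)
    _ = _ := by ring

theorem FluxSetting.integrable_bulk (h : FluxSetting T a ρl ρr π u du P P1 PX) :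
    Integrable (bulkIntegrand a u du P) (timeMeasure T) := by
  refine (h.integrable_sq_ratio.sub h.integrable_mean_sq_mul).congr ?_
  filter_upwards [ae_mem_time T] with t ht
  rw [h.bulk_eq ht, Pi.sub_apply]

theorem FluxSetting.integrable_fluxM (h : FluxSetting T a ρl ρr π u du P P1 PX) :
    Integrable (fun z => fluxM a u du P z.1 z.2) (rectMeasure T) :=
  (h.memL2_fluxM.memLp h.lt_a h.profile).integrable (by norm_num)

theorem FluxSetting.integrable_flux (h : FluxSetting T a ρl ρr π u du P P1 PX) :
    Integrable (fun z => P z.1 z.2) (rectMeasure T) :=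
  (h.flux.1.memLp h.lt_a h.profile).integrable (by norm_num)

theorem FluxSetting.integrable_diffusivity_mul (h : FluxSetting T a ρl ρr π u du P P1 PX) :
    Integrable (fun z => diffusivity a (u z.1 z.2) * du z.1 z.2) (rectMeasure T) :=
  (h.profile.memLp_diffusivity_mul_du h.lt_a).integrable (by norm_num)

theorem FluxSetting.integral_fluxM (h : FluxSetting T a ρl ρr π u du P P1 PX) :
    ∀ᵐ t ∂timeMeasure T, ∫ x in (-1 : ℝ)..1, fluxM a u du P t x
      = ∫ x, P t x ∂spaceMeasure + ∫ x in (-1 : ℝ)..1, diffusivity a (u t x) * du t x := by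
  filter_upwards [h.integrable_flux.prod_right_ae, h.integrable_diffusivity_mul.prod_right_ae]
    with t h1 h2
  rw [spaceIntegral_eq, spaceIntegral_eq]
  exact integral_add h1 h2

theorem FluxSetting.integrable_P1 (h : FluxSetting T a ρl ρr π u du P P1 PX) :
    Integrable P1 (timeMeasure T) :=
  (intervalIntegrable_iff_integrableOn_Ioc_of_le h.time_pos.le).1 h.deriv_one.1

theorem FluxSetting.integrable_PX (h : FluxSetting T a ρl ρr π u du P P1 PX) :
    Integrable PX (timeMeasure T) :=
  (intervalIntegrable_iff_integrableOn_Ioc_of_le h.time_pos.le).1 h.deriv_X.1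

theorem FluxSetting.integrable_boundary (h : FluxSetting T a ρl ρr π u du P P1 PX) {x : ℝ}
    (hx : x ∈ Icc (-1 : ℝ) 1) : Integrable (fun t => u t x) (timeMeasure T) := by
  refine Integrable.of_bound (C := 1) (h.profile.measurable_boundary x).aestronglyMeasurable ?_
  filter_upwards [ae_mem_time T] with t ht
  have := h.profile.range_u t ht x hx
  rw [Real.norm_of_nonneg this.1]
  exact this.2

theorem FluxSetting.integrable_space (h : FluxSetting T a ρl ρr π u du P P1 PX) :
    Integrable (fun t => ∫ x in (-1 : ℝ)..1, diffusivity a (u t x) * du t x) (timeMeasure T) ∧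
    Integrable (fun t => ∫ x in (-1 : ℝ)..1, fluxM a u du P t x) (timeMeasure T) := by
  simp only [spaceIntegral_eq]
  exact ⟨h.integrable_diffusivity_mul.integral_prod_left, h.integrable_fluxM.integral_prod_left⟩

theorem FluxSetting.integrable_gFun (h : FluxSetting T a ρl ρr π u du P P1 PX) :
    Integrable (gFun a ρl u du P P1 PX) (timeMeasure T) := by
  have i1 := h.integrable_mean_mul.const_mul 2
  have i2 := ((h.integrable_boundary (x := -1) (by norm_num)).sub (integrable_const ρl)).const_mul 2
  refine ((((((h.integrable_P1.sub h.integrable_PX).sub h.integrable_space.1).add i2).add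
    h.integrable_space.2).sub i1).const_mul 2).congr (Eventually.of_forall fun t => ?_)
  simp only [gFun, Pi.add_apply, Pi.sub_apply, mul_assoc]

theorem FluxSetting.integrable_hFun (h : FluxSetting T a ρl ρr π u du P P1 PX) :
    Integrable (hFun a ρr u du P P1 PX) (timeMeasure T) := by
  have i1 := h.integrable_mean_mul.const_mul 2
  have i2 := ((h.integrable_boundary (x := 1) (by norm_num)).sub (integrable_const ρr)).const_mul 2
  refine ((((((h.integrable_P1.add h.integrable_PX).add h.integrable_space.1).add i2).sub
    h.integrable_space.2).add i1).const_mul 2).congr (Eventually.of_forall fun t => ?_)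
  simp only [hFun, Pi.add_apply, Pi.sub_apply, mul_assoc]

/-- In the boundary action the linear terms on the right cancel against the `2 (u - ρ)` inside
`gFun` and `hFun`, which leaves `-4 B`. -/
theorem Psi_eq_boundaryB (r s α β : ℝ) :
    Psi ρl ρr r s α β = 4 * boundaryB ρl ρr r s α β + 4 * (α * (r - ρl)) + 4 * (β * (s - ρr)) := by
  unfold Psi boundaryB
  ring

theorem FluxSetting.integrable_Upsilon (h : FluxSetting T a ρl ρr π u du P P1 PX) {α β : ℝ → ℝ}
    (hα : ContinuousOn α (Icc 0 T)) (hβ : ContinuousOn β (Icc 0 T)) :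
    Integrable (fun t => Upsilon a ρl ρr u t (u t (-1)) (u t 1) (α t) (β t)) (timeMeasure T) := by
  have i1 := integrable_mul_of_continuousOn_time (((hα.sub hβ).pow 2).const_mul 4) h.integrable_calS
  have i2 := (h.profile.integrable_boundaryB (ρl := ρl) (ρr := ρr) h.time_pos.le hα hβ).const_mul 4
  have i3 := (integrable_mul_of_continuousOn_time hα ((h.integrable_boundary (x := -1)
    (by norm_num)).sub (integrable_const ρl))).const_mul 4
  have i4 := (integrable_mul_of_continuousOn_time hβ ((h.integrable_boundary (x := 1)
    (by norm_num)).sub (integrable_const ρr))).const_mul 4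
  refine (i1.add ((i2.add i3).add i4)).congr (Eventually.of_forall fun t => ?_)
  simp only [Upsilon, Psi_eq_boundaryB, Pi.add_apply, Pi.sub_apply, Pi.pow_apply]

theorem FluxSetting.integrable_action (h : FluxSetting T a ρl ρr π u du P P1 PX) {α β : ℝ → ℝ}
    (hα : ContinuousOn α (Icc 0 T)) (hβ : ContinuousOn β (Icc 0 T)) :
    Integrable (fun t => α t * gFun a ρl u du P P1 PX t + β t * hFun a ρr u du P P1 PX t
      - Upsilon a ρl ρr u t (u t (-1)) (u t 1) (α t) (β t)) (timeMeasure T) :=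
  ((integrable_mul_of_continuousOn_time hα h.integrable_gFun).add
    (integrable_mul_of_continuousOn_time hβ h.integrable_hFun)).sub (h.integrable_Upsilon hα hβ)

/-- At time `t` the square has space integral `(b/2 - c)² S`, where `b = ⟨M_t σ(u_t)⁻¹⟩`; the three
terms of its expansion are integrable in time. -/
theorem FluxSetting.memLp_nonGradient (h : FluxSetting T a ρl ρr π u du P P1 PX) {c : ℝ → ℝ}
    (hc : ContinuousOn c (Icc 0 T)) : MemLp (nonGradient a u du P c) 2 (rectMeasure T) := by
  have hcm : AEStronglyMeasurable (fun z : ℝ × ℝ => c z.1) (rectMeasure T) :=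
    (integrable_of_continuousOn_time hc).aestronglyMeasurable.comp_fst
  have hm : AEStronglyMeasurable (nonGradient a u du P c) (rectMeasure T) := by
    have h1 : Measurable fun z : ℝ × ℝ => meanMSigmaInv a u du P z.1 / 2 :=
      (h.measurable_mean.comp measurable_fst).div_const 2
    have h2 : Measurable fun z : ℝ × ℝ => calS a u z.1 := h.profile.measurable_calS.comp measurable_fst
    have h3 := (h.profile.measurable_sqrtSigma (a := a)).inv
    exact ((h1.aestronglyMeasurable.sub hcm).mul h2.aestronglyMeasurable).mul h3.aestronglyMeasurable
  refine (memLp_two_iff_integrable_sq hm).2 ((integrable_prod_iff (hm.pow 2)).2 ?_)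
  have key : ∀ t ∈ Icc 0 T,
      Integrable (fun x => nonGradient a u du P c (t, x) ^ 2) spaceMeasure ∧
      ∫ x, ‖nonGradient a u du P c (t, x) ^ 2‖ ∂spaceMeasure
        = (meanMSigmaInv a u du P t / 2 - c t) ^ 2 * calS a u t := by
    intro t ht
    have e : ∀ x, nonGradient a u du P c (t, x) ^ 2
        = ((meanMSigmaInv a u du P t / 2 - c t) * calS a u t) ^ 2
          * ((sqrtSigma a u (t, x))⁻¹) ^ 2 := fun x => by
      rw [nonGradient, div_pow, inv_pow, div_eq_mul_inv]
    have en : ∀ x, ‖nonGradient a u du P c (t, x) ^ 2‖ = nonGradient a u du P c (t, x) ^ 2 :=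
      fun x => Real.norm_of_nonneg (sq_nonneg _)
    simp only [en]
    simp only [e]
    rcases h.profile.isHarmonicMean h.lt_a ht with h0 | ⟨h0, -, h1, h2⟩
    · simp [h0]
    · refine ⟨h1.integrable_sq.const_mul _, ?_⟩
      rw [integral_const_mul, h2]
      field_simp
  refine ⟨(ae_mem_time T).mono fun t ht => (key t ht).1, ?_⟩
  have i1 := h.integrable_mean_sq_mul.const_mul (1 / 4)
  have i2 := integrable_mul_of_continuousOn_time hc h.integrable_mean_mul
  have i3 := integrable_mul_of_continuousOn_time (hc.pow 2) h.integrable_calS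
  refine ((i1.sub i2).add i3).congr ?_
  filter_upwards [ae_mem_time T] with t ht
  refine Eq.trans ?_ (key t ht).2.symm
  simp only [Pi.add_apply, Pi.sub_apply, Pi.pow_apply]
  ring

/-- The linear part of the rate functional, in terms of the flux and of the time derivatives of
the first two moments. -/
theorem FluxSetting.L0_eq (h : FluxSetting T a ρl ρr π u du P P1 PX) {v dt dx : ℝ → ℝ → ℝ}
    (H : IsC11 T v dt dx) :
    L0 T u H.toC11 = ∫ z, (dx z.1 z.2 - (v z.1 1 - v z.1 (-1)) / 2) * P z.1 z.2 ∂rectMeasure T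
      + ∫ t, ((v t (-1) + v t 1) / 2 * P1 t + (v t 1 - v t (-1)) / 2 * PX t) ∂timeMeasure T := by
  have hu := h.profile
  obtain ⟨C, hC⟩ := h.bounded
  have hp := H.isC1On_trace (x := -1) (by norm_num)
  have hq := H.isC1On_trace (x := 1) (by norm_num)
  have hs := (hp.add hq).div_const 2
  have hd := (hq.sub hp).div_const 2
  have A1 := isC11_mul (f := fun _ => 1) (f' := fun _ => 0) hs
    (fun x => hasDerivAt_const x 1) continuous_const
  have A2 := isC11_mul (f := fun x => x) (f' := fun _ => 1) hd
    (fun x => hasDerivAt_id' x) continuous_const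
  have e1 : L0 T u A1.toC11 = ∫ t in (0 : ℝ)..T, (v t (-1) + v t 1) / 2 * P1 t :=
    (L0_mul hs (fun x => hasDerivAt_const x 1) continuous_const).trans
      (h.deriv_one.timeForm_eq h.time_pos h.lt_a h.left_mem h.right_mem hu hC (κ := 0) (by simp)
        (fun x => hasDerivAt_const x 1) (by simp) hs)
  have e2 : L0 T u A2.toC11 = ∫ t in (0 : ℝ)..T, (v t 1 - v t (-1)) / 2 * PX t :=
    (L0_mul hd (fun x => hasDerivAt_id' x) continuous_const).trans
      (h.deriv_X.timeForm_eq h.time_pos h.lt_a h.left_mem h.right_mem hu hC (κ := 1) (by simp)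
        (fun x => hasDerivAt_id' x) (fun x hx => abs_le.2 hx) hd)
  -- Subtracting the affine interpolation of the traces leaves a function that vanishes at `x = ±1`,
  -- to which the flux applies.
  have A3 := (A1.add A2).smul (-1)
  let p : lateralSpace T := ⟨(_, _, _), H.add A3, fun t _ => by
    constructor
    · simp only [Pi.add_apply, Pi.smul_apply, smul_eq_mul]; ring
    · simp only [Pi.add_apply, Pi.smul_apply, smul_eq_mul]; ring⟩
  have e3 : L0 T u (H.add A3).toC11 = ∫ z, lateralGrad T p z * P z.1 z.2 ∂rectMeasure T :=
    h.flux.lateral h.time_pos.le h.lt_a hu h.energy_lt hC p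
  have e5 := hu.L0_add h.time_pos.le H A3
  have e6 := L0_smul (u := u) (-1) (A1.add A2)
  have e7 := hu.L0_add h.time_pos.le A1 A2
  rw [timeIntegral_eq h.time_pos.le] at e1 e2
  have e4 : ∀ z, lateralGrad T p z = dx z.1 z.2 - (v z.1 1 - v z.1 (-1)) / 2 := fun z => by
    change dx z.1 z.2 + (-1) * ((v z.1 (-1) + v z.1 1) / 2 * 0 + (v z.1 1 - v z.1 (-1)) / 2 * 1) = _
    ring
  simp only [e4] at e3
  rw [integral_add (integrable_mul_of_continuousOn_time hs.continuousOn h.integrable_P1)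
    (integrable_mul_of_continuousOn_time hd.continuousOn h.integrable_PX)]
  linarith

end Setting

theorem integral_sub_add {α : Type*} [MeasurableSpace α] {μ : Measure α} {f g k : α → ℝ}
    (hf : Integrable f μ) (hg : Integrable g μ) (hk : Integrable k μ) :
    ∫ x, (f x - g x + k x) ∂μ = ∫ x, f x ∂μ - ∫ x, g x ∂μ + ∫ x, k x ∂μ := by
  have h1 : Integrable (fun x => f x - g x) μ := hf.sub hg
  rw [integral_add h1 hk, integral_sub hf hg]

theorem integral_sub_add_sub {α : Type*} [MeasurableSpace α] {μ : Measure α} {f g k l : α → ℝ}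
    (hf : Integrable f μ) (hg : Integrable g μ) (hk : Integrable k μ) (hl : Integrable l μ) :
    ∫ x, (f x - g x + k x - l x) ∂μ
      = ∫ x, f x ∂μ - ∫ x, g x ∂μ + ∫ x, k x ∂μ - ∫ x, l x ∂μ := by
  have h1 : Integrable (fun x => f x - g x + k x) μ := (hf.sub hg).add hk
  rw [integral_sub h1 hl, integral_sub_add hf hg hk]

/-! ### The identity between `Ĵ_H`, the two parts of the rate and a square -/

section Identity

variable {T a ρl ρr : ℝ} {π : Trajectory T} {u du P : ℝ → ℝ → ℝ} {P1 PX : ℝ → ℝ}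

theorem IsProfile.memLp_sqrtSigma_mul (ha : -1 / 2 < a) (hu : IsProfile T π u du) {f : ℝ × ℝ → ℝ}
    (hf : ContinuousOn f (rect T)) : MemLp (fun z => sqrtSigma a u z * f z) 2 (rectMeasure T) :=
  MemLp.top_mul (hu.memLp_sqrtSigma ha) ((memLp_top_of_continuousOn_rect hf).mono_exponent le_top)

/-- What is left of `M / (2 √σ)` after subtraction of its component that is not a gradient and of
`√σ` times a function of mean `c`. -/
def residual (a : ℝ) (u du P : ℝ → ℝ → ℝ) (c : ℝ → ℝ) (w : ℝ × ℝ → ℝ) (z : ℝ × ℝ) : ℝ :=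
  ratio a u (fluxM a u du P) z / 2 - nonGradient a u du P c z - sqrtSigma a u z * w z

theorem FluxSetting.memLp_residual (h : FluxSetting T a ρl ρr π u du P P1 PX) {c : ℝ → ℝ}
    (hc : ContinuousOn c (Icc 0 T)) {w : ℝ × ℝ → ℝ} (hw : ContinuousOn w (rect T)) :
    MemLp (residual a u du P c w) 2 (rectMeasure T) := by
  have h1 : MemLp (fun z => ratio a u (fluxM a u du P) z / 2) 2 (rectMeasure T) :=
    by simpa only [div_eq_inv_mul] using MemLp.const_mul h.memLp_ratio (2 : ℝ)⁻¹
  exact (h1.sub (h.memLp_nonGradient hc)).sub (h.profile.memLp_sqrtSigma_mul h.lt_a hw)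

/-- The square is completed at almost every time. -/
theorem FluxSetting.complete_square_slice (h : FluxSetting T a ρl ρr π u du P P1 PX)
    {v dt dx : ℝ → ℝ → ℝ} (H : IsC11 T v dt dx) :
    ∀ᵐ t ∂timeMeasure T,
      ∫ x, ratio a u (fluxM a u du P) (t, x) * (sqrtSigma a u (t, x) * dx t x) ∂spaceMeasure
        - ∫ x, (sqrtSigma a u (t, x) * dx t x) ^ 2 ∂spaceMeasure
        + ∫ x, residual a u du P (fun t => v t 1 - v t (-1)) (fun z => dx z.1 z.2) (t, x) ^ 2
            ∂spaceMeasure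
      = 1 / 4 * bulkIntegrand a u du P t
        + ((v t 1 - v t (-1)) * meanMSigmaInv a u du P t * calS a u t
          - (v t 1 - v t (-1)) ^ 2 * calS a u t) := by
  have hsl : Measurable fun z => sqrtSigma a u z := h.profile.measurable_sqrtSigma
  have hsq := (h.profile.memLp_sqrtSigma_mul h.lt_a H.continuous_dx').integrable_sq.prod_right_ae
  filter_upwards [h.memLp_ratio_slice, ae_mem_time T, hsq] with t hk ht h2
  have hdx : ContinuousOn (dx t) (Icc (-1) 1) :=
    H.continuous_dx.comp (continuousOn_const.prodMk continuousOn_id) fun x hx => ⟨ht, hx⟩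
  have hdi : Integrable (dx t) spaceMeasure := hdx.integrableOn_Icc.mono_set Ioc_subset_Icc_self
  have hsw : MemLp (fun x => sqrtSigma a u (t, x) * dx t x) 2 spaceMeasure :=
    (memLp_two_iff_integrable_sq ((hsl.comp measurable_prodMk_left).aestronglyMeasurable.mul
      hdi.aestronglyMeasurable)).2 h2
  have key := (h.profile.isHarmonicMean h.lt_a ht).complete_square hk hsw hdi
  rw [← h.mean_eq ht, ← spaceIntegral_eq (dx t), H.integral_dx ht] at key
  rw [h.bulk_eq ht]
  simp only [residual, nonGradient]
  linarith

theorem FluxSetting.integrable_mul_flux (h : FluxSetting T a ρl ρr π u du P P1 PX)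
    {f : ℝ × ℝ → ℝ} (hf : ContinuousOn f (rect T)) :
    Integrable (fun z => f z * P z.1 z.2) (rectMeasure T) := by
  have := Integrable.mul_continuousOn_rect h.integrable_flux hf
  simpa only [mul_comm] using this

theorem continuousOn_fst_rect {c : ℝ → ℝ} (hc : ContinuousOn c (Icc 0 T)) :
    ContinuousOn (fun z : ℝ × ℝ => c z.1) (rect T) :=
  hc.comp continuousOn_fst fun _ hz => hz.1

/-- The rate functional, up to a square. -/
theorem FluxSetting.Jhat_eq_sub_square (h : FluxSetting T a ρl ρr π u du P P1 PX)
    {v dt dx : ℝ → ℝ → ℝ} (H : IsC11 T v dt dx) :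
    Jhat T a ρl ρr u du H.toC11 = I1 T a u du P
      + 1 / 4 * boundaryAction T a ρl ρr u du P P1 PX (fun t => v t (-1)) (fun t => v t 1)
      - ∫ z, residual a u du P (fun t => v t 1 - v t (-1)) (fun z => dx z.1 z.2) z ^ 2
          ∂rectMeasure T := by
  have hu := h.profile
  have hT := h.time_pos.le
  have hp := (H.isC1On_trace (x := -1) (by norm_num)).continuousOn
  have hq := (H.isC1On_trace (x := 1) (by norm_num)).continuousOn
  have hc : ContinuousOn (fun t => v t 1 - v t (-1)) (Icc 0 T) := hq.sub hp
  have i1 : Integrable (fun z => dx z.1 z.2 * P z.1 z.2) (rectMeasure T) :=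
    h.integrable_mul_flux H.continuous_dx'
  have i2 : Integrable (fun z => (v z.1 1 - v z.1 (-1)) / 2 * P z.1 z.2) (rectMeasure T) :=
    h.integrable_mul_flux (continuousOn_fst_rect (hc.div_const 2))
  have i3 : Integrable (fun z => diffusivity a (u z.1 z.2) * du z.1 z.2 * dx z.1 z.2)
      (rectMeasure T) := Integrable.mul_continuousOn_rect h.integrable_diffusivity_mul H.continuous_dx'
  have hsw := hu.memLp_sqrtSigma_mul h.lt_a H.continuous_dx'
  have i4 : Integrable (fun z => ratio a u (fluxM a u du P) z * (sqrtSigma a u z * dx z.1 z.2))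
      (rectMeasure T) := h.memLp_ratio.integrable_mul hsw
  have i5 := hsw.integrable_sq
  have i6 := (h.memLp_residual hc H.continuous_dx').integrable_sq
  have e1 : ∫ z, dx z.1 z.2 * P z.1 z.2 ∂rectMeasure T
      + ∫ z, diffusivity a (u z.1 z.2) * du z.1 z.2 * dx z.1 z.2 ∂rectMeasure T
      = ∫ z, ratio a u (fluxM a u du P) z * (sqrtSigma a u z * dx z.1 z.2) ∂rectMeasure T := by
    rw [← integral_add i1 i3]
    refine integral_congr_ae ?_
    filter_upwards [h.memL2_fluxM.ae_eq_mul_ratio hu] with z hz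
    have : P z.1 z.2 + diffusivity a (u z.1 z.2) * du z.1 z.2
      = sqrtSigma a u z * ratio a u (fluxM a u du P) z := hz
    linear_combination dx z.1 z.2 * this
  have e2 : ∫ z, (dx z.1 z.2 - (v z.1 1 - v z.1 (-1)) / 2) * P z.1 z.2 ∂rectMeasure T
      = ∫ z, dx z.1 z.2 * P z.1 z.2 ∂rectMeasure T
        - ∫ t, (v t 1 - v t (-1)) / 2 * ∫ x, P t x ∂spaceMeasure ∂timeMeasure T := by
    simp only [sub_mul (dx _ _)]
    rw [integral_sub i1 i2, integral_prod _ i2]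
    simp only [integral_const_mul]
  have e3 : ∫ z, ratio a u (fluxM a u du P) z * (sqrtSigma a u z * dx z.1 z.2) ∂rectMeasure T
      - ∫ z, (sqrtSigma a u z * dx z.1 z.2) ^ 2 ∂rectMeasure T
      + ∫ z, residual a u du P (fun t => v t 1 - v t (-1)) (fun z => dx z.1 z.2) z ^ 2
          ∂rectMeasure T
      = ∫ t, (1 / 4 * bulkIntegrand a u du P t
        + ((v t 1 - v t (-1)) * meanMSigmaInv a u du P t * calS a u t
          - (v t 1 - v t (-1)) ^ 2 * calS a u t)) ∂timeMeasure T := by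
    rw [integral_prod _ i4, integral_prod _ i5, integral_prod _ i6,
      ← integral_sub_add i4.integral_prod_left i5.integral_prod_left i6.integral_prod_left]
    exact integral_congr_ae (h.complete_square_slice H)
  have j1 : Integrable (fun t => (v t 1 - v t (-1)) / 2 * ∫ x, P t x ∂spaceMeasure)
      (timeMeasure T) := by
    have := i2.integral_prod_left
    simpa only [integral_const_mul] using this
  have j2 : Integrable (fun t => (v t (-1) + v t 1) / 2 * P1 t + (v t 1 - v t (-1)) / 2 * PX t)
      (timeMeasure T) :=
    (integrable_mul_of_continuousOn_time ((hp.add hq).div_const 2) h.integrable_P1).add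
      (integrable_mul_of_continuousOn_time (hc.div_const 2) h.integrable_PX)
  have j3 := hu.integrable_boundaryB (ρl := ρl) (ρr := ρr) hT hp hq
  have j4 : Integrable (fun t => 1 / 4 * bulkIntegrand a u du P t) (timeMeasure T) :=
    h.integrable_bulk.const_mul _
  have j5 : Integrable (fun t => (v t 1 - v t (-1)) * meanMSigmaInv a u du P t * calS a u t
      - (v t 1 - v t (-1)) ^ 2 * calS a u t) (timeMeasure T) := by
    have k1 := integrable_mul_of_continuousOn_time hc h.integrable_mean_mul
    have k2 := integrable_mul_of_continuousOn_time (hc.pow 2) h.integrable_calS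
    refine (k1.sub k2).congr (Eventually.of_forall fun t => ?_)
    simp only [Pi.sub_apply, Pi.pow_apply, mul_assoc]
  -- Here `⟨M⟩ - ⟨D ∇u⟩ = ⟨P⟩`, so `gFun` and `hFun` combine into half the sum of the traces against
  -- `P1`, half their jump against `PX - ⟨P⟩`, and the jump against `⟨M σ⁻¹⟩ S`.
  have e4 : 1 / 4 * boundaryAction T a ρl ρr u du P P1 PX (fun t => v t (-1)) (fun t => v t 1)
      = ∫ t, ((v t 1 - v t (-1)) * meanMSigmaInv a u du P t * calS a u t
          - (v t 1 - v t (-1)) ^ 2 * calS a u t) ∂timeMeasure T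
        - ∫ t, (v t 1 - v t (-1)) / 2 * ∫ x, P t x ∂spaceMeasure ∂timeMeasure T
        + ∫ t, ((v t (-1) + v t 1) / 2 * P1 t + (v t 1 - v t (-1)) / 2 * PX t) ∂timeMeasure T
        - ∫ t, boundaryB ρl ρr (u t (-1)) (u t 1) (v t (-1)) (v t 1) ∂timeMeasure T := by
    rw [boundaryAction, timeIntegral_eq hT, ← integral_const_mul, ← integral_sub_add_sub j5 j1 j2 j3]
    refine integral_congr_ae ?_
    filter_upwards [h.integral_fluxM] with t ht
    simp only [gFun, hFun, Upsilon, Psi_eq_boundaryB, ht]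
    ring
  rw [hu.Jhat_rect hT h.lt_a, h.L0_eq H, e2, e4, I1, timeIntegral_eq hT, timeIntegral_eq hT]
  rw [integral_add j4 j5, integral_const_mul] at e3
  change _ + ∫ z, diffusivity a (u z.1 z.2) * du z.1 z.2 * dx z.1 z.2 ∂rectMeasure T
    - ∫ z, (sqrtSigma a u z * dx z.1 z.2) ^ 2 ∂rectMeasure T
    - ∫ t, boundaryB ρl ρr (u t (-1)) (u t 1) (v t (-1)) (v t 1) ∂timeMeasure T = _
  linarith

end Identity

/-! ### Reduction to boundary values that vanish at the initial and final times -/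

theorem exp_mul_le {φ α : ℝ} (h0 : 0 ≤ φ) (h1 : φ ≤ 1) :
    Real.exp (φ * α) ≤ φ * Real.exp α + (1 - φ) := by
  have := convexOn_exp.2 (mem_univ α) (mem_univ 0) h0 (sub_nonneg.2 h1) (by ring)
  simpa using this

/-- Convexity of the exponential together with `Ψ = 0` at `α = β = 0`; the linear terms scale
exactly. -/
theorem Psi_mul_le {ρl ρr r s φ : ℝ} (hl : ρl ∈ Icc (0 : ℝ) 1) (hr : ρr ∈ Icc (0 : ℝ) 1)
    (hr' : r ∈ Icc (0 : ℝ) 1) (hs : s ∈ Icc (0 : ℝ) 1) (h0 : 0 ≤ φ) (h1 : φ ≤ 1) (α β : ℝ) :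
    Psi ρl ρr r s (φ * α) (φ * β) ≤ φ * Psi ρl ρr r s α β := by
  have e1 := mul_le_mul_of_nonneg_left (exp_mul_le (α := α) h0 h1)
    (mul_nonneg hl.1 (sub_nonneg.2 hr'.2))
  have e2 := mul_le_mul_of_nonneg_left (exp_mul_le (α := -α) h0 h1)
    (mul_nonneg hr'.1 (sub_nonneg.2 hl.2))
  have e3 := mul_le_mul_of_nonneg_left (exp_mul_le (α := β) h0 h1)
    (mul_nonneg hr.1 (sub_nonneg.2 hs.2))
  have e4 := mul_le_mul_of_nonneg_left (exp_mul_le (α := -β) h0 h1)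
    (mul_nonneg hs.1 (sub_nonneg.2 hr.2))
  unfold Psi
  simp only [← mul_neg]
  linarith

/-- A smooth function, equal to `0` at the endpoints of `[0, T]`, that increases to `1` with `n`. -/
def plateau (T : ℝ) (n : ℕ) (t : ℝ) : ℝ := 1 - (1 - 4 * t * (T - t) / T ^ 2) ^ n

theorem plateau_base_mem {T t : ℝ} (hT : 0 < T) (ht : t ∈ Icc 0 T) :
    1 - 4 * t * (T - t) / T ^ 2 ∈ Icc (0 : ℝ) 1 := by
  have h1 : 0 ≤ 4 * t * (T - t) := mul_nonneg (by linarith [ht.1]) (sub_nonneg.2 ht.2)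
  have h2 : 4 * t * (T - t) ≤ T ^ 2 := by nlinarith [sq_nonneg (2 * t - T)]
  exact ⟨sub_nonneg.2 (div_le_one_of_le₀ h2 (by positivity)), sub_le_self _ (by positivity)⟩

theorem plateau_mem {T t : ℝ} (hT : 0 < T) (ht : t ∈ Icc 0 T) (n : ℕ) :
    plateau T n t ∈ Icc (0 : ℝ) 1 := by
  have h := plateau_base_mem hT ht
  exact ⟨sub_nonneg.2 (pow_le_one₀ h.1 h.2), sub_le_self _ (pow_nonneg h.1 n)⟩

theorem tendsto_plateau {T t : ℝ} (hT : 0 < T) (ht : t ∈ Ioo 0 T) :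
    Tendsto (fun n => plateau T n t) atTop (𝓝 1) := by
  have h := plateau_base_mem hT (Ioo_subset_Icc_self ht)
  have h1 : 0 < 4 * t * (T - t) / T ^ 2 :=
    div_pos (mul_pos (by linarith [ht.1]) (sub_pos.2 ht.2)) (by positivity)
  simpa [plateau] using (tendsto_pow_atTop_nhds_zero_of_lt_one h.1 (by linarith)).const_sub 1

theorem plateau_mul_mem_C10 {T : ℝ} (hT : 0 < T) {p p' : ℝ → ℝ} (hp : IsC1On T p p') (n : ℕ) :
    (fun t => plateau T n t * p t) ∈ C10 T := by
  refine ⟨ContDiffOn.mul (ContDiff.contDiffOn ?_) (hp.contDiffOn hT), ?_, ?_⟩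
  · unfold plateau
    fun_prop
  · simp [plateau]
  · simp [plateau]

section Bounds

variable {T a ρl ρr : ℝ} {π : Trajectory T} {u du P : ℝ → ℝ → ℝ} {P1 PX : ℝ → ℝ}

/-- For `φ` in `[0, 1]` the terms in `gFun` and `hFun` scale by `φ` while `Υ(φp, φq) ≤ φ Υ(p, q)`.
So the integrand at `(φp, φq)` is at least `φ` times the one at `(p, q)`, and `φ` tends to `1` along
the plateaus. -/
theorem FluxSetting.boundaryAction_le (h : FluxSetting T a ρl ρr π u du P P1 PX) {B : ℝ}
    (hB : ∀ α ∈ C10 T, ∀ β ∈ C10 T, boundaryAction T a ρl ρr u du P P1 PX α β ≤ B)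
    {p p' q q' : ℝ → ℝ} (hp : IsC1On T p p') (hq : IsC1On T q q') :
    boundaryAction T a ρl ρr u du P P1 PX p q ≤ B := by
  have hT := h.time_pos
  have hi := h.integrable_action hp.continuousOn hq.continuousOn
  have hφ : ∀ n, ContinuousOn (plateau T n) (Icc 0 T) := fun n => by
    unfold plateau
    fun_prop
  have hlim : Tendsto (fun n => ∫ t, plateau T n t *
      (p t * gFun a ρl u du P P1 PX t + q t * hFun a ρr u du P P1 PX t
        - Upsilon a ρl ρr u t (u t (-1)) (u t 1) (p t) (q t)) ∂timeMeasure T) atTop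
      (𝓝 (boundaryAction T a ρl ρr u du P P1 PX p q)) := by
    rw [boundaryAction, timeIntegral_eq hT.le]
    refine tendsto_integral_of_dominated_convergence _
      (fun n => (integrable_mul_of_continuousOn_time (hφ n) hi).aestronglyMeasurable) hi.norm
      (fun n => ?_) ?_
    · filter_upwards [ae_mem_time T] with t ht
      have := plateau_mem hT ht n
      rw [norm_mul, Real.norm_of_nonneg this.1]
      exact mul_le_of_le_one_left (norm_nonneg _) this.2
    · have hne : ∀ᵐ t ∂timeMeasure T, t ∈ Ioo 0 T := by
        rw [timeMeasure, Measure.restrict_congr_set Ioo_ae_eq_Ioc.symm]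
        exact ae_restrict_mem measurableSet_Ioo
      filter_upwards [hne] with t ht
      simpa using (tendsto_plateau hT ht).mul_const _
  refine le_of_tendsto' hlim fun n => le_trans ?_
    (hB _ (plateau_mul_mem_C10 hT hp n) _ (plateau_mul_mem_C10 hT hq n))
  rw [boundaryAction, timeIntegral_eq hT.le]
  refine integral_mono_ae (integrable_mul_of_continuousOn_time (hφ n) hi)
    (h.integrable_action ((hφ n).mul hp.continuousOn) ((hφ n).mul hq.continuousOn)) ?_
  filter_upwards [ae_mem_time T] with t ht
  have hm := plateau_mem hT ht n
  have h1 := Psi_mul_le h.left_mem h.right_mem (h.profile.range_u t ht (-1) (by norm_num))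
    (h.profile.range_u t ht 1 (by norm_num)) hm.1 hm.2 (p t) (q t)
  have h2 : plateau T n t ^ 2 * (4 * (p t - q t) ^ 2 * calS a u t)
      ≤ plateau T n t * (4 * (p t - q t) ^ 2 * calS a u t) :=
    mul_le_mul_of_nonneg_right (by nlinarith [hm.1, hm.2])
      (mul_nonneg (by positivity) (calS_nonneg t))
  simp only [Upsilon]
  linarith

/-- The upper bound for the rate functional. -/
theorem FluxSetting.Jhat_le (h : FluxSetting T a ρl ρr π u du P P1 PX) {B : ℝ}
    (hB : ∀ α ∈ C10 T, ∀ β ∈ C10 T, boundaryAction T a ρl ρr u du P P1 PX α β ≤ B) (H : C11 T) :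
    Jhat T a ρl ρr u du H ≤ I1 T a u du P + 1 / 4 * B := by
  have h1 := h.Jhat_eq_sub_square H.isC11
  have h2 := h.boundaryAction_le hB (H.isC11.isC1On_trace (x := -1) (by norm_num))
    (H.isC11.isC1On_trace (x := 1) (by norm_num))
  have h3 : 0 ≤ ∫ z, residual a u du P (fun t => H.val t 1 - H.val t (-1))
      (fun z => H.dx z.1 z.2) z ^ 2 ∂rectMeasure T := integral_nonneg fun z => sq_nonneg _
  change Jhat T a ρl ρr u du H = _ at h1
  linarith

/-! ### The gradients are dense in the orthogonal complement of the residual component -/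

/-- The remainder of the completed square is orthogonal to `1/s` exactly when `w` has the prescribed
mean `c`. -/
theorem IsHarmonicMean.integral_residual {α : Type*} [MeasurableSpace α] {μ : Measure α}
    {s k w : α → ℝ} {S : ℝ} (hS : IsHarmonicMean μ s S) (h0 : S ≠ 0) (hk : MemLp k 2 μ)
    (hw : Integrable w μ) (c : ℝ) :
    ∫ x, (s x)⁻¹ * (k x / 2 - ((∫ x, k x / s x ∂μ) / 2 - c) * S / s x - s x * w x) ∂μ
      = c - ∫ x, w x ∂μ := by
  obtain ⟨-, hs, h1, h2⟩ := hS.resolve_left h0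
  have i1 : Integrable (fun x => k x / s x) μ := hk.integrable_mul h1
  have i2 := h1.integrable_sq
  have e : (fun x => (s x)⁻¹ * (k x / 2 - ((∫ x, k x / s x ∂μ) / 2 - c) * S / s x - s x * w x))
      =ᵐ[μ] fun x => 1 / 2 * (k x / s x) - ((∫ x, k x / s x ∂μ) / 2 - c) * S * (s x)⁻¹ ^ 2
        + (-1) * w x := by
    filter_upwards [hs] with x hx
    field_simp
    ring
  rw [integral_congr_ae e, integral_sub_add (i1.const_mul _) (i2.const_mul _) (hw.const_mul _),
    integral_const_mul, integral_const_mul, integral_const_mul, h2, mul_assoc, mul_inv_cancel₀ h0]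
  ring

theorem IsProfile.calS_ne_zero (ha : -1 / 2 < a) (hu : IsProfile T π u du) {t : ℝ}
    (ht : t ∈ Icc 0 T) (h0 : ∀ᵐ x ∂spaceMeasure, sqrtSigma a u (t, x) ≠ 0)
    (h1 : MemLp (fun x => (sqrtSigma a u (t, x))⁻¹) 2 spaceMeasure) : calS a u t ≠ 0 := by
  have e : ∫⁻ x in Icc (-1 : ℝ) 1, (ENNReal.ofReal (sigma a (u t x)))⁻¹
      = ∫⁻ x, ENNReal.ofReal ((sqrtSigma a u (t, x))⁻¹ ^ 2) ∂spaceMeasure := by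
    rw [restrict_Icc_eq_spaceMeasure]
    refine lintegral_congr_ae ?_
    filter_upwards [h0, ae_mem_space] with x hx hx'
    rw [inv_pow, hu.sqrtSigma_sq_slice ha ht hx', ENNReal.ofReal_inv_of_pos]
    rw [← hu.sqrtSigma_sq_slice ha ht hx']
    positivity
  have hlt : ∫⁻ x, ENNReal.ofReal ((sqrtSigma a u (t, x))⁻¹ ^ 2) ∂spaceMeasure < ⊤ :=
    (hasFiniteIntegral_iff_ofReal (Eventually.of_forall fun x => sq_nonneg _)).1
      h1.integrable_sq.hasFiniteIntegral
  have hne : ∫⁻ x, ENNReal.ofReal ((sqrtSigma a u (t, x))⁻¹ ^ 2) ∂spaceMeasure ≠ 0 := by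
    intro hz
    have hm : AEMeasurable (fun x => ENNReal.ofReal ((sqrtSigma a u (t, x))⁻¹ ^ 2)) spaceMeasure :=
      h1.integrable_sq.aestronglyMeasurable.aemeasurable.ennreal_ofReal
    have hz' : ∀ᵐ x ∂spaceMeasure, False := by
      filter_upwards [(lintegral_eq_zero_iff' hm).1 hz, h0] with x hx hx'
      have : 0 < (sqrtSigma a u (t, x))⁻¹ ^ 2 := by positivity
      exact absurd (ENNReal.ofReal_eq_zero.1 hx) (not_le.2 this)
    rw [eventually_false_iff_eq_bot, ae_eq_bot, spaceMeasure, Measure.restrict_eq_zero] at hz'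
    norm_num at hz'
  rw [calS, e]
  exact (ENNReal.toReal_pos (ENNReal.inv_ne_zero.2 hlt.ne) (ENNReal.inv_ne_top.2 hne)).ne'

theorem residual_eq_zero {c : ℝ → ℝ} {w : ℝ × ℝ → ℝ} {z : ℝ × ℝ} (h : sqrtSigma a u z = 0) :
    residual a u du P c w z = 0 := by
  simp [residual, ratio, nonGradient, h]

/-- At times with `b t = 0`, either `k = 0` or `√σ = 0`, and there the residual is `0` because
division by zero gives `0`. At times with `b t ≠ 0`, `k` is a multiple of `1/√σ`, so `1/√σ` is in
`L²` and `S_t > 0`. The residual is then orthogonal to it, since the constant `c/2` has integral `c`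
over `[-1,1]`. -/
theorem FluxSetting.integral_mul_residual (h : FluxSetting T a ρl ρr π u du P P1 PX) {c : ℝ → ℝ}
    (hc : ContinuousOn c (Icc 0 T)) {k : ℝ × ℝ → ℝ} (hkm : Measurable k)
    (hk : MemLp k 2 (rectMeasure T)) {b : ℝ → ℝ}
    (hb : ∀ᵐ z ∂rectMeasure T, sqrtSigma a u z * k z = b z.1) :
    ∫ z, k z * residual a u du P c (fun z => c z.1 / 2) z ∂rectMeasure T = 0 := by
  have hu := h.profile
  have hi : Integrable (fun z => k z * residual a u du P c (fun z => c z.1 / 2) z) (rectMeasure T) :=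
    hk.integrable_mul (h.memLp_residual hc (continuousOn_fst_rect (hc.div_const 2)))
  rw [integral_prod _ hi]
  refine integral_eq_zero_of_ae ?_
  filter_upwards [Measure.ae_ae_of_ae_prod hb, memLp_slice hkm hk, h.memLp_ratio_slice,
    ae_mem_time T] with t hbt hkt hrt ht
  by_cases h0 : b t = 0
  · refine integral_eq_zero_of_ae ?_
    filter_upwards [hbt] with x hx
    rcases mul_eq_zero.1 (hx.trans h0) with h1 | h1
    · simp [residual_eq_zero h1]
    · simp [h1]
  · have hs : ∀ᵐ x ∂spaceMeasure, sqrtSigma a u (t, x) ≠ 0 :=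
      hbt.mono fun x hx hz => h0 (by rw [← hx, hz, zero_mul])
    have hks : ∀ᵐ x ∂spaceMeasure, k (t, x) = b t * (sqrtSigma a u (t, x))⁻¹ := by
      filter_upwards [hs, hbt] with x h1 h2
      rw [← h2]
      field_simp
    have hinv : MemLp (fun x => (sqrtSigma a u (t, x))⁻¹) 2 spaceMeasure := by
      refine (memLp_congr_ae ?_).1 (hkt.const_mul (b t)⁻¹)
      filter_upwards [hks] with x hx
      rw [hx]
      field_simp
    have key := (hu.isHarmonicMean h.lt_a ht).integral_residual (hu.calS_ne_zero h.lt_a ht hs hinv)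
      hrt (integrable_const (c t / 2)) (c t)
    have e : (fun x => k (t, x) * residual a u du P c (fun z => c z.1 / 2) (t, x))
        =ᵐ[spaceMeasure] fun x => b t * ((sqrtSigma a u (t, x))⁻¹ *
          (ratio a u (fluxM a u du P) (t, x) / 2 - ((∫ x, ratio a u (fluxM a u du P) (t, x)
            / sqrtSigma a u (t, x) ∂spaceMeasure) / 2 - c t) * calS a u t / sqrtSigma a u (t, x)
            - sqrtSigma a u (t, x) * (c t / 2))) := by
      filter_upwards [hks] with x hx
      rw [hx, residual, nonGradient, h.mean_eq ht, mul_assoc]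
    have hmass : ∫ _, c t / 2 ∂spaceMeasure = c t := by
      rw [← spaceIntegral_eq, intervalIntegral.integral_const, smul_eq_mul]
      ring
    rw [integral_congr_ae e, integral_const_mul, key, hmass, sub_self, mul_zero]
    rfl

/-- The lower bound for the rate functional. -/
theorem FluxSetting.le_of_Jhat_le (h : FluxSetting T a ρl ρr π u du P P1 PX) {C : ℝ}
    (hC : ∀ H, Jhat T a ρl ρr u du H ≤ C) {p p' q q' : ℝ → ℝ} (hp : IsC1On T p p')
    (hq : IsC1On T q q') :
    I1 T a u du P + 1 / 4 * boundaryAction T a ρl ρr u du P P1 PX p q ≤ C := by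
  have hu := h.profile
  have hc : ContinuousOn (fun t => q t - p t) (Icc 0 T) := hq.continuousOn.sub hp.continuousOn
  let S : lateralSpace T →ₗ[ℝ] (ℝ × ℝ → ℝ) :=
    { toFun := fun p z => sqrtSigma a u z * lateralGrad T p z
      map_add' := fun G G' => by ext z; simp [mul_add]
      map_smul' := fun c G => by ext z; simp [mul_left_comm] }
  have hS : ∀ p, MemLp (S p) 2 (rectMeasure T) := fun p =>
    hu.memLp_sqrtSigma_mul h.lt_a (continuousOn_lateralGrad p)
  have hG := h.memLp_residual hc (continuousOn_fst_rect (hc.div_const 2))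
  refine le_of_forall_pos_lt_add fun ε hε => ?_
  -- If `k` annihilates every `√σ ∂ₓg`, then `√σ k` is a function of time alone, and the residual is
  -- orthogonal to such a `k`.
  obtain ⟨g, hg⟩ := exists_integral_sub_sq_lt S hS hG (fun k hkm hk hkS => by
    have hK : Integrable (fun z => sqrtSigma a u z * k z) (rectMeasure T) :=
      (MemLp.top_mul (hu.memLp_sqrtSigma h.lt_a) hk).integrable (by norm_num)
    obtain ⟨b, -, hb⟩ := exists_eq_time_of_integral_partialX_eq_zero
      (hu.measurable_sqrtSigma.mul hkm) hK fun H hH => by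
        rw [← hkS ⟨_, SmoothKT.mem_lateralSpace hH⟩]
        refine integral_congr_ae (Eventually.of_forall fun z => ?_)
        change partialX H z * (sqrtSigma a u z * k z) = k z * (sqrtSigma a u z * partialX H z)
        ring
    exact h.integral_mul_residual hc hkm hk hb) hε
  -- The interpolation has gradient `(q - p) / 2`, the profile used in `hG`. Adding `g` keeps the
  -- traces and subtracts `S g` from the residual, whose squared norm is then below `ε`.
  have hJ := h.Jhat_eq_sub_square ((isC11_interpolation hp hq).add (lateral_isC11 g))
  have hb := hC ((isC11_interpolation hp hq).add (lateral_isC11 g)).toC11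
  have e0 : ∀ t ∈ Icc 0 T, ((p t + q t) / 2 * 1 + (q t - p t) / 2 * (-1)) + g.1.1 t (-1) = p t :=
    fun t ht => by rw [(lateral_vanish g ht).1]; ring
  have e1 : ∀ t ∈ Icc 0 T, ((p t + q t) / 2 * 1 + (q t - p t) / 2 * 1) + g.1.1 t 1 = q t :=
    fun t ht => by rw [(lateral_vanish g ht).2]; ring
  rw [hJ] at hb
  simp only [Pi.add_apply] at hb
  have e2 : boundaryAction T a ρl ρr u du P P1 PX
      (fun t => ((p t + q t) / 2 * 1 + (q t - p t) / 2 * (-1)) + g.1.1 t (-1))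
      (fun t => ((p t + q t) / 2 * 1 + (q t - p t) / 2 * 1) + g.1.1 t 1)
      = boundaryAction T a ρl ρr u du P P1 PX p q := by
    refine timeIntegral_congr h.time_pos.le ?_
    filter_upwards [ae_mem_time T] with t ht
    rw [e0 t ht, e1 t ht]
  have e3 : ∫ z, residual a u du P
      (fun t => ((p t + q t) / 2 * 1 + (q t - p t) / 2 * 1) + g.1.1 t 1
        - (((p t + q t) / 2 * 1 + (q t - p t) / 2 * (-1)) + g.1.1 t (-1)))
      (fun z => ((p z.1 + q z.1) / 2 * 0 + (q z.1 - p z.1) / 2 * 1) + g.1.2.2 z.1 z.2) z ^ 2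
        ∂rectMeasure T
      = ∫ z, (residual a u du P (fun t => q t - p t) (fun z => (q z.1 - p z.1) / 2) z
          - S g z) ^ 2 ∂rectMeasure T := by
    refine integral_congr_ae ?_
    filter_upwards [ae_mem_rect T] with z hz
    have hSg : S g z = sqrtSigma a u z * g.1.2.2 z.1 z.2 := rfl
    simp only [residual, nonGradient, e0 z.1 hz.1, e1 z.1 hz.1, hSg]
    ring
  rw [e2, e3] at hb
  linarith

end Bounds

/-! ### Passage to the suprema -/

section Rate

variable {T a ρl ρr : ℝ} {π : Trajectory T} {u du P : ℝ → ℝ → ℝ} {P1 PX : ℝ → ℝ}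

theorem finiteEnergy_of_rate_lt_top (hπ : rate T a ρl ρr π < ⊤) : FiniteEnergy T π := by
  by_contra hE
  have h1 : J T a ρl ρr π (isC11_zero T).toC11 = ⊤ := dif_neg hE
  exact absurd (le_iSup (J T a ρl ρr π) _) (not_le.2 (h1 ▸ hπ))

theorem FiniteEnergy.energy_lt_top (hE : FiniteEnergy T π) (hT : 0 ≤ T) (hu : IsProfile T π u du) :
    energy T u < ⊤ := by
  obtain ⟨p, hp, hp'⟩ := hE
  rwa [hu.energy_eq hT hp]

theorem FiniteEnergy.rate_eq (hE : FiniteEnergy T π) (hT : 0 ≤ T) (hu : IsProfile T π u du) :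
    rate T a ρl ρr π = ⨆ H : C11 T, ((Jhat T a ρl ρr u du H : ℝ) : EReal) :=
  iSup_congr fun H => by
    rw [J, dif_pos hE, hE.choose_spec.1.Jhat_eq hT hu]

/-- The two bounds are inequalities between reals. The lower bound, applied with `R`, keeps the
supremum in `I2` below `+∞`, and the pair `α = β = 0` keeps it above `-∞`, so they can be compared
as reals. -/
theorem FluxSetting.rate_eq_add (h : FluxSetting T a ρl ρr π u du P P1 PX) {R : ℝ}
    (hR : ⨆ H : C11 T, ((Jhat T a ρl ρr u du H : ℝ) : EReal) = R) :
    (R : EReal) = ((I1 T a u du P : ℝ) : EReal) + I2 T a ρl ρr u du P P1 PX := by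
  have hT := h.time_pos
  have hJ : ∀ H, Jhat T a ρl ρr u du H ≤ R := fun H =>
    EReal.coe_le_coe_iff.1 (hR ▸ le_iSup (fun H : C11 T => ((Jhat T a ρl ρr u du H : ℝ) : EReal)) H)
  set s : EReal := ⨆ α : C10 T, ⨆ β : C10 T,
    ((boundaryAction T a ρl ρr u du P P1 PX α.1 β.1 : ℝ) : EReal) with hs
  have hle : ∀ α β : C10 T, ((boundaryAction T a ρl ρr u du P P1 PX α.1 β.1 : ℝ) : EReal) ≤ s :=
    fun α β => le_iSup₂ (f := fun α β : C10 T =>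
      ((boundaryAction T a ρl ρr u du P P1 PX α.1 β.1 : ℝ) : EReal)) α β
  have hub : s ≤ ((4 * (R - I1 T a u du P) : ℝ) : EReal) := iSup₂_le fun α β => by
    have := h.le_of_Jhat_le hJ (isC1On_of_contDiffOn hT α.2.1) (isC1On_of_contDiffOn hT β.2.1)
    exact EReal.coe_le_coe_iff.2 (by linarith)
  have hz : (0 : ℝ → ℝ) ∈ C10 T := ⟨contDiffOn_const, rfl, rfl⟩
  have hbot : s ≠ ⊥ := ((EReal.bot_lt_coe _).trans_le (hle ⟨0, hz⟩ ⟨0, hz⟩)).ne'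
  have htop : s ≠ ⊤ := (hub.trans_lt (EReal.coe_lt_top _)).ne
  have hcoe : ((s.toReal : ℝ) : EReal) = s := EReal.coe_toReal htop hbot
  have h1 : s.toReal ≤ 4 * (R - I1 T a u du P) := EReal.coe_le_coe_iff.1 (hcoe ▸ hub)
  have h2 : R ≤ I1 T a u du P + 1 / 4 * s.toReal := by
    rw [← EReal.coe_le_coe_iff, ← hR]
    exact iSup_le fun H => EReal.coe_le_coe_iff.2 (h.Jhat_le (fun α hα β hβ =>
      EReal.coe_le_coe_iff.1 (hcoe.symm ▸ hle ⟨α, hα⟩ ⟨β, hβ⟩)) H)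
  have h3 : I2 T a ρl ρr u du P P1 PX = ((1 / 4 * s.toReal : ℝ) : EReal) := by
    rw [EReal.coe_mul, hcoe]
    rfl
  rw [h3, ← EReal.coe_add, EReal.coe_eq_coe_iff]
  linarith

end Rate

end RobinLD

end

theorem propositionp02 (T a ρl ρr : ℝ) (hT : 0 < T) (ha : -1 / 2 < a)
    (hl0 : 0 < ρl) (hl1 : ρl < 1) (hr0 : 0 < ρr) (hr1 : ρr < 1)
    (π : RobinLD.Trajectory T) (hπ : RobinLD.rate T a ρl ρr π < ⊤) :
    (∃ u du : ℝ → ℝ → ℝ, RobinLD.IsProfile T π u du) ∧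
    ∀ u du : ℝ → ℝ → ℝ, RobinLD.IsProfile T π u du →
      (∃ P : ℝ → ℝ → ℝ, RobinLD.IsFlux T a u P) ∧
      (∃ P1 : ℝ → ℝ, RobinLD.IsTimeDerivative T u (fun _ => 1) P1) ∧
      (∃ PX : ℝ → ℝ, RobinLD.IsTimeDerivative T u (fun x => x) PX) ∧
      ∀ (P : ℝ → ℝ → ℝ) (P1 PX : ℝ → ℝ), RobinLD.IsFlux T a u P →
        RobinLD.IsTimeDerivative T u (fun _ => 1) P1 →
        RobinLD.IsTimeDerivative T u (fun x => x) PX →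
        RobinLD.MemL2SigmaInv T a u (RobinLD.fluxM a u du P) ∧
        IntervalIntegrable (RobinLD.gFun a ρl u du P P1 PX) volume 0 T ∧
        IntervalIntegrable (RobinLD.hFun a ρr u du P P1 PX) volume 0 T ∧
        IntervalIntegrable (RobinLD.bulkIntegrand a u du P) volume 0 T ∧
        RobinLD.rate T a ρl ρr π
          = ((RobinLD.I1 T a u du P : ℝ) : EReal) + RobinLD.I2 T a ρl ρr u du P P1 PX := by
  have hl : ρl ∈ Icc (0 : ℝ) 1 := ⟨hl0.le, hl1.le⟩
  have hr : ρr ∈ Icc (0 : ℝ) 1 := ⟨hr0.le, hr1.le⟩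
  have hfe := RobinLD.finiteEnergy_of_rate_lt_top hπ
  refine ⟨⟨_, _, hfe.choose_spec.1⟩, fun u du hu => ?_⟩
  have hE := hfe.energy_lt_top hT.le hu
  have hrate : RobinLD.rate T a ρl ρr π = _ := hfe.rate_eq hT.le hu
  -- The zero test function contributes a real number, so a rate below `+∞` is itself real and
  -- bounds every `Ĵ_H`.
  have hbot : RobinLD.rate T a ρl ρr π ≠ ⊥ := by
    rw [hrate]
    exact ((EReal.bot_lt_coe _).trans_le (le_iSup (fun H : RobinLD.C11 T =>
      ((RobinLD.Jhat T a ρl ρr u du H : ℝ) : EReal)) (RobinLD.isC11_zero T).toC11)).ne'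
  obtain ⟨R, hR⟩ : ∃ R : ℝ, (R : EReal) = RobinLD.rate T a ρl ρr π :=
    ⟨_, EReal.coe_toReal hπ.ne hbot⟩
  have hC : ∀ H, RobinLD.Jhat T a ρl ρr u du H ≤ R := fun H => by
    rw [← EReal.coe_le_coe_iff, hR, hrate]
    exact le_iSup (fun H : RobinLD.C11 T => ((RobinLD.Jhat T a ρl ρr u du H : ℝ) : EReal)) H
  obtain ⟨P, hP, hPl⟩ := RobinLD.exists_lateral_flux hT.le ha hu hE hC
  obtain ⟨P1, hP1, hP1f⟩ := RobinLD.exists_moment_density hT ha hl hr hu hC (κ := 0) (by simp)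
    (fun x => hasDerivAt_const x (1 : ℝ)) (by simp)
  obtain ⟨PX, hPX, hPXf⟩ := RobinLD.exists_moment_density hT ha hl hr hu hC (κ := 1) (by simp)
    (fun x => hasDerivAt_id' x) (fun x hx => abs_le.2 hx)
  refine ⟨⟨P, RobinLD.isFlux_of_lateral hT.le ha hu hP hPl⟩,
    ⟨P1, RobinLD.isTimeDerivative_of_timeForm hT hP1 hP1f⟩,
    ⟨PX, RobinLD.isTimeDerivative_of_timeForm hT hPX hPXf⟩, fun Q Q1 QX hQ hQ1 hQX => ?_⟩
  have h : RobinLD.FluxSetting T a ρl ρr π u du Q Q1 QX :=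
    ⟨hT, ha, hl, hr, hu, hE, ⟨R, hC⟩, hQ, hQ1, hQX⟩
  simp only [intervalIntegrable_iff_integrableOn_Ioc_of_le hT.le]
  exact ⟨h.memL2_fluxM, h.integrable_gFun, h.integrable_hFun, h.integrable_bulk,
    hR ▸ h.rate_eq_add (hrate.symm.trans hR.symm)⟩
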